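/- Fix an integer $n\ge 3$. The free $n$-completion $F(\Gamma_0)$ of a connected bipartite graph $\Gamma_0$ of girth at least $2n$ is the union of the graphs $\Gamma_0\subseteq\Gamma_1\subseteq\Gamma_2\subseteq\cdots$, where $\Gamma_{i+1}$ is obtained from $\Gamma_i$ by adding, for every two vertices $a,b$ of $\Gamma_i$ whose distance in $\Gamma_i$ is $n+1$, a path of length $n-1$ from $a$ to $b$ through $n-2$ new vertices. For $n+3\le k\le\omega$ let $\Gamma^k=F(\gamma_k)$, where $\gamma_k=(x_0,\dots,x_k)$ is a path of length $k$ (and $\gamma_\omega=(x_0,x_1,x_2,\dots)$), and regard $\Gamma^k$ as a structure in the language of graphs expanded by two unary predicates for the classes of the bipartition, the first of which is the class containing $x_0$. For $k\le m$, the inclusion $\gamma_k\subseteq\gamma_m$ induces a natural inclusion $\Gamma^k\subseteq\Gamma^m$. Corollary. Let $n+3\le k,m\le\omega$. Then $\Gamma^k\preccurlyeq\Gamma^m$ if and only if $k\le m$. More precisely: if $k\le m$, then $\Gamma^k$ is an elementary substructure of $\Gamma^m$ via the natural inclusion; and if there is any elementary embedding of $\Gamma^k$ into $\Gamma^m$,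 then $k\le m$. In particular the $\Gamma^k$ form a strict elementary chain: for $n+3\le k<m\le\omega$, $\Gamma^k$ is a proper elementary substructure of $\Gamma^m$. -/

import Mathlib

open FirstOrder

namespace FreePolygon

/-! ### The language of bipartite graphs -/

/-- Relation symbols: one unary predicate for each of the two classes of the bipartition
("points" and "lines") and the binary incidence relation. -/
inductive BipRel : ℕ → Type
  | point : BipRel 1
  | line : BipRel 1
  | inc : BipRel 2

/-- The language of graphs expanded by predicates for the bipartition. -/
def bipLang : FirstOrder.Language.{0, 0} := ⟨fun _ => Empty, BipRel⟩

/-- A graph `G` whose vertices are 2-coloured by `c`, as a first-order structure. -/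
@[reducible] def bipStructure {W : Type*} (G : SimpleGraph W) (c : W → Bool) : bipLang.Structure W where
  funMap := fun f => Empty.elim f
  RelMap := fun {_} r =>
    match r with
    | BipRel.point => fun x => c (x 0) = true
    | BipRel.line => fun x => c (x 0) = false
    | BipRel.inc => fun x => G.Adj (x 0) (x 1)

/-! ### The free `n`-completion -/

/-- Names for the vertices of free `n`-completions: `base x` is an original vertex, and
`arc a b j` (with `0 ≤ j < n - 2`) is the interior vertex `x_{j+1}` of the path
`(a = x_0, x_1, …, x_{n-2}, x_{n-1} = b)` that is put in as a clean arc between `a` and `b`. -/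
inductive ArcTerm (n : ℕ) (V : Type*) : Type _
  | base (x : V) : ArcTerm n V
  | arc (a b : ArcTerm n V) (j : Fin (n - 2)) : ArcTerm n V

variable {n : ℕ} {V : Type*}

/-- The edges, each listed in one direction: those of the graph `H` on the original vertices,
and the `n - 1` edges of each path `(a, arc a b 0, …, arc a b (n - 3), b)`. -/
inductive Joined (H : SimpleGraph V) : ArcTerm n V → ArcTerm n V → Prop
  | base {x y : V} (h : H.Adj x y) : Joined H (.base x) (.base y)
  | first (a b : ArcTerm n V) (j : Fin (n - 2)) (h : j.val = 0) : Joined H a (.arc a b j)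
  | step (a b : ArcTerm n V) (i j : Fin (n - 2)) (h : i.val + 1 = j.val) :
      Joined H (.arc a b i) (.arc a b j)
  | last (a b : ArcTerm n V) (j : Fin (n - 2)) (h : j.val + 1 = n - 2) : Joined H (.arc a b j) b

/-- The graph on all names; the graphs below are the induced subgraphs of it on the sets of
names that are actually used. -/
def termGraph (n : ℕ) (H : SimpleGraph V) : SimpleGraph (ArcTerm n V) :=
  SimpleGraph.fromRel (Joined H)

/-- The vertex set of the `i`-th step `Γ_i` of the free `n`-completion of the graph `Γ_0 = H[S]`
induced by `H` on `S`: `Γ_{i+1}` is obtained from `Γ_i` by adding one clean arc between every two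
elements that have distance `n + 1` in `Γ_i`. The well-ordering only serves to choose, for each
unordered pair `{a, b}`, one of the names `arc a b _`, `arc b a _` for its arc. -/
def stage (n : ℕ) (H : SimpleGraph V) (S : Set V) : ℕ → Set (ArcTerm n V)
  | 0 => ArcTerm.base '' S
  | i + 1 => stage n H S i ∪
      {t | ∃ (a b : ArcTerm n V) (j : Fin (n - 2)), t = .arc a b j ∧ WellOrderingRel a b ∧
        ∃ (ha : a ∈ stage n H S i) (hb : b ∈ stage n H S i),
          ((termGraph n H).induce (stage n H S i)).dist ⟨a, ha⟩ ⟨b, hb⟩ = n + 1}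

/-- The vertex set of the free `n`-completion `F(H[S]) = ⋃ i, Γ_i`. -/
def freeCompletion (n : ℕ) (H : SimpleGraph V) (S : Set V) : Set (ArcTerm n V) :=
  ⋃ i, stage n H S i

/-- The extension of a 2-colouring of the original vertices: colours alternate along each arc. -/
def colour (c : V → Bool) : ArcTerm n V → Bool
  | .base x => c x
  | .arc a _ j => xor (colour c a) (decide (Odd (j.val + 1)))

/-! ### The free `n`-gons `Γ^k` -/

/-- The vertex set of `Γ^k`, the free `n`-completion of the path `γ_k = (x_0, …, x_k)` of length
`k`; for `k = ⊤` (i.e. `ω`) the path is `(x_0, x_1, x_2, …)`. The vertex `x_i` is `i : ℕ`. All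
`γ_k` are initial segments of one path, so that all `Γ^k` live in one set of names. -/
def gammaSet (n : ℕ) (k : ℕ∞) : Set (ArcTerm n ℕ) :=
  freeCompletion n (SimpleGraph.hasse ℕ) {i : ℕ | (i : ℕ∞) ≤ k}

/-- The free `n`-gon `Γ^k`. -/
def Gamma (n : ℕ) (k : ℕ∞) : Type := ↥(gammaSet n k)

/-- `Γ^k` as a graph with a bipartition, in which `x_0, x_2, …` are points and `x_1, x_3, …` are
lines. -/
instance gammaStructure (n : ℕ) (k : ℕ∞) : bipLang.Structure (Gamma n k) :=
  bipStructure ((termGraph n (SimpleGraph.hasse ℕ)).induce (gammaSet n k))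
    (fun x => colour (fun i : ℕ => decide (Even i)) x.1)

/-- `Γ^k ≼ Γ^m`: the free `n`-gon `Γ^k` is an elementary substructure of `Γ^m`, by the natural
inclusion given by `γ_k ⊆ γ_m`. -/
def ElemSub (n : ℕ) (k m : ℕ∞) : Prop :=
  ∃ f : Gamma n k ↪ₑ[bipLang] Gamma n m, ∀ x : Gamma n k, (f x).1 = x.1

end FreePolygon

/-! A set `A` is strong if every finite nonempty set `C` outside it is free: inside `A ∪ C`, it
contains a vertex with at most one neighbour, or the `n - 2` interior vertices of a path, each with
at most two neighbours. Sets that are not free are called closed below. A set of names that is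
closed under ingredients is strong, because its complement can be peeled off from the most recent
vertices (`DownSet.strong`). So `Γ^k` is an open polygon, each initial path is strong in it, and
`Γ^k` is strong in `Γ^m` for `k ≤ m`. That `Γ^k` lies in `Γ^m` at all needs an argument, since a
longer path might shorten distances; folding the longer path onto the shorter one gives retractions
of all stages (`Retract.succ`).

An open polygon is strong in its elementary extensions: a closed set over a finite base would have
arbitrarily many disjoint copies inside the polygon, and three copies over one base violate openness
(`Strong.no_copies`, `IsGon.strong_range`). For the opposite direction, call an open polygon rich if
it has generic isolated vertices of both colours. An arc from such a vertex to a given vertex `x`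
yields a generic vertex attached to `x` alone (`Gen.single`). Hence a finite part of a strong
extension of a rich `M` can be rebuilt over `M`, loose end by loose end and arc by arc, in
elementary extensions of `M` (`Rich.exists_realization`). An ultraproduct of these partial
realizations places a rich strong extension `N` strongly in some `K` with `M ≼ K`
(`Rich.exists_elementary`). Induction on formulas, alternating between `M ⊆ N` and `N ⊆ K`, shows
that strong embeddings of rich polygons are elementary (`Rich.realize_iff`).

The bound `n + 3` enters through richness: the arc from `x_0` to `x_{n+3}` closes the path to a
strong cycle of length `2n + 2`. Over a finite strong set containing the cycle one builds an
infinite sequence of arcs, each from a cycle vertex to the first vertex of the arc before. A set of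
bounded size misses one of many arcs, and then the first vertex of a late arc cannot help to close
it (`ArcChain.goodFor`). So cycle vertices have generic loose neighbours. A loose path of length `n
- 1` grown from the cycle loses its interior, a clean arc, and leaves a generic isolated vertex
(`StrongCycle.rich`).

That an elementary embedding forces `k ≤ m` follows by counting. The quantity `(n - 1)|V| - (n -
2)|E|` does not decrease from a strong finite set to a larger finite set, while adding the arcs of a
finite set of names to its original vertices does not increase it. A path of length `l` has value `n
- 1 + l`. If `m < k`, an elementary embedding would send a strong path of length `m + 1` to a strong
path of `Γ^m`, inside a finite set generated by `γ_m`, whose value is too small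
(`le_of_elementary`). -/

namespace FreePolygon

open SimpleGraph Set FirstOrder.Language FirstOrder.Language.Structure

/-! ### Free and closed finite sets; strong sets in graphs. -/

section Openness

variable {V V' : Type*} {G : SimpleGraph V} {G' : SimpleGraph V'} {n : ℕ}

/-- The vertex `v` has at most one neighbour in `X`. -/
def Loose (G : SimpleGraph V) (X : Set V) (v : V) : Prop :=
  ∀ x ∈ X, ∀ y ∈ X, G.Adj v x → G.Adj v y → x = y

/-- The vertex `v` has at most two neighbours in `X`. -/
def Slim (G : SimpleGraph V) (X : Set V) (v : V) : Prop :=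
  ∀ x ∈ X, ∀ y ∈ X, ∀ z ∈ X, G.Adj v x → G.Adj v y → G.Adj v z → x = y ∨ x = z ∨ y = z

/-- Inside `X`, the set `C` contains a loose end or the interior of a clean arc. -/
def Free (n : ℕ) (G : SimpleGraph V) (X C : Set V) : Prop :=
  (∃ v ∈ C, Loose G X v) ∨ ∃ p : ℕ → V, InjOn p (Icc 1 (n - 2)) ∧
    (∀ i ∈ Icc 1 (n - 2), p i ∈ C ∧ Slim G X (p i)) ∧
    ∀ i, 1 ≤ i → i + 1 ≤ n - 2 → G.Adj (p i) (p (i + 1))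

/-- The graph is open over `A`. -/
def Strong (n : ℕ) (G : SimpleGraph V) (A : Set V) : Prop :=
  ∀ C : Set V, C.Finite → C.Nonempty → Disjoint A C → Free n G (A ∪ C) C

/-- `h` restricts to an isomorphism of the induced graph on `X` onto its image. -/
structure PIso (G : SimpleGraph V) (G' : SimpleGraph V') (h : V → V') (X : Set V) : Prop where
  inj : InjOn h X
  adj : ∀ x ∈ X, ∀ y ∈ X, (G'.Adj (h x) (h y) ↔ G.Adj x y)

lemma PIso.mono {h : V → V'} {X Y : Set V} (H : PIso G G' h Y) (hXY : X ⊆ Y) : PIso G G' h X :=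
  ⟨H.inj.mono hXY, fun x hx y hy => H.adj x (hXY hx) y (hXY hy)⟩

lemma Loose.mono {X Y : Set V} {v : V} (hXY : X ⊆ Y) (h : Loose G Y v) : Loose G X v :=
  fun x hx y hy => h x (hXY hx) y (hXY hy)

lemma Slim.mono {X Y : Set V} {v : V} (hXY : X ⊆ Y) (h : Slim G Y v) : Slim G X v :=
  fun x hx y hy z hz => h x (hXY hx) y (hXY hy) z (hXY hz)

lemma Free.mono {X Y C D : Set V} (hXY : X ⊆ Y) (hCD : C ⊆ D) (h : Free n G Y C) :
    Free n G X D := by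
  rcases h with ⟨v, hv, h⟩ | ⟨p, h1, h2, h3⟩
  · exact Or.inl ⟨v, hCD hv, h.mono hXY⟩
  · exact Or.inr ⟨p, h1, fun i hi => ⟨hCD (h2 i hi).1, (h2 i hi).2.mono hXY⟩, h3⟩

/-- Looseness and slimness depend only on neighbours, so enlarging the ambient set by vertices not
joined to `C` is harmless. -/
lemma Free.extend {X Y C : Set V} (H : ∀ v ∈ C, ∀ x ∈ Y, G.Adj v x → x ∈ X)
    (h : Free n G X C) : Free n G Y C := by
  rcases h with ⟨v, hv, h⟩ | ⟨p, h1, h2, h3⟩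
  · exact Or.inl ⟨v, hv, fun x hx y hy ax ay => h x (H v hv x hx ax) y (H v hv y hy ay) ax ay⟩
  · exact Or.inr ⟨p, h1, fun i hi => ⟨(h2 i hi).1, fun x hx y hy z hz ax ay az =>
      have hv := (h2 i hi).1
      (h2 i hi).2 x (H _ hv x hx ax) y (H _ hv y hy ay) z (H _ hv z hz az) ax ay az⟩, h3⟩

lemma PIso.free_image (hn : 3 ≤ n) {h : V → V'} {X C : Set V} (H : PIso G G' h X) (hC : C ⊆ X) :
    Free n G' (h '' X) (h '' C) ↔ Free n G X C := by
  constructor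
  · rintro (⟨_, ⟨v, hv, rfl⟩, hl⟩ | ⟨p, h1, h2, h3⟩)
    · refine Or.inl ⟨v, hv, fun x hx y hy ax ay => H.inj hx hy ?_⟩
      exact hl _ ⟨x, hx, rfl⟩ _ ⟨y, hy, rfl⟩ ((H.adj _ (hC hv) _ hx).2 ax)
        ((H.adj _ (hC hv) _ hy).2 ay)
    · have : ∀ i, ∃ v, i ∈ Icc 1 (n - 2) → v ∈ C ∧ h v = p i := by
        intro i
        by_cases hi : i ∈ Icc 1 (n - 2)
        · obtain ⟨v, hv, hp⟩ := (h2 i hi).1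
          exact ⟨v, fun _ => ⟨hv, hp⟩⟩
        · obtain ⟨v, -⟩ := (h2 1 ⟨le_rfl, by omega⟩).1
          exact ⟨v, fun h => absurd h hi⟩
      choose q hq using this
      refine Or.inr ⟨q, fun i hi j hj hij => h1 hi hj ?_, fun i hi => ⟨(hq i hi).1, ?_⟩, ?_⟩
      · rw [← (hq i hi).2, ← (hq j hj).2, hij]
      · intro x hx y hy z hz ax ay az
        have hv := hC (hq i hi).1
        have := (h2 i hi).2 _ ⟨x, hx, rfl⟩ _ ⟨y, hy, rfl⟩ _ ⟨z, hz, rfl⟩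
        rw [← (hq i hi).2, H.adj _ hv _ hx, H.adj _ hv _ hy, H.adj _ hv _ hz] at this
        rcases this ax ay az with h | h | h
        · exact Or.inl (H.inj hx hy h)
        · exact Or.inr (Or.inl (H.inj hx hz h))
        · exact Or.inr (Or.inr (H.inj hy hz h))
      · intro i hi hi'
        have a := hq i ⟨hi, by omega⟩
        have b := hq (i + 1) ⟨by omega, by omega⟩
        rw [← H.adj _ (hC a.1) _ (hC b.1), a.2, b.2]
        exact h3 i hi hi'
  · rintro (⟨v, hv, hl⟩ | ⟨p, h1, h2, h3⟩)
    · refine Or.inl ⟨h v, ⟨v, hv, rfl⟩, ?_⟩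
      rintro _ ⟨x, hx, rfl⟩ _ ⟨y, hy, rfl⟩ ax ay
      rw [hl x hx y hy ((H.adj _ (hC hv) _ hx).1 ax) ((H.adj _ (hC hv) _ hy).1 ay)]
    · refine Or.inr ⟨h ∘ p, fun i hi j hj hij => h1 hi hj (H.inj (hC (h2 i hi).1)
        (hC (h2 j hj).1) hij), fun i hi => ⟨⟨_, (h2 i hi).1, rfl⟩, ?_⟩, ?_⟩
      · rintro _ ⟨x, hx, rfl⟩ _ ⟨y, hy, rfl⟩ _ ⟨z, hz, rfl⟩ ax ay az
        have hv := hC (h2 i hi).1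
        rcases (h2 i hi).2 x hx y hy z hz ((H.adj _ hv _ hx).1 ax) ((H.adj _ hv _ hy).1 ay)
          ((H.adj _ hv _ hz).1 az) with h | h | h <;> simp [h]
      · intro i hi hi'
        exact (H.adj _ (hC (h2 i ⟨hi, by omega⟩).1) _ (hC (h2 (i + 1) ⟨by omega, hi'⟩).1)).2
          (h3 i hi hi')

/-- The part of a finite set lying outside `B` is already free over `B`, hence over `A`, so only
sets inside `B` need testing. This is the transitivity of strongness. -/
lemma Strong.of_subset {A B : Set V} (hB : Strong n G B) (hAB : A ⊆ B)
    (h : ∀ C : Set V, C.Finite → C.Nonempty → Disjoint A C → C ⊆ B → Free n G (A ∪ C) C) :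
    Strong n G A := by
  intro D hD hne hdis
  by_cases hDB : D ⊆ B
  · exact h D hD hne hdis hDB
  · obtain ⟨x, hx, hxB⟩ := not_subset.1 hDB
    refine (hB (D \ B) hD.sdiff ⟨x, hx, hxB⟩ disjoint_sdiff_right).mono ?_ sdiff_subset
    rintro y (hy | hy)
    · exact Or.inl (hAB hy)
    · by_cases hyB : y ∈ B
      · exact Or.inl hyB
      · exact Or.inr ⟨hy, hyB⟩

/-- If `D` left `B`, its part outside would be free over `B` and hence make `D` free over `A`. Used
to confine closed sets. -/
lemma Strong.subset_of_not_free {A B D : Set V} (hB : Strong n G B) (hAB : A ⊆ B)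
    (hD : D.Finite) (h : ¬ Free n G (A ∪ D) D) : D ⊆ B := by
  by_contra hDB
  obtain ⟨x, hx, hxB⟩ := not_subset.1 hDB
  refine h ((hB (D \ B) hD.sdiff ⟨x, hx, hxB⟩ disjoint_sdiff_right).mono ?_ sdiff_subset)
  rintro y (hy | hy)
  · exact Or.inl (hAB hy)
  · by_cases hyB : y ∈ B
    · exact Or.inl hyB
    · exact Or.inr ⟨hy, hyB⟩

/-- A path of length `n - 1`, listed as `p 0, …, p (n - 1)`. -/
structure ArcPath (n : ℕ) (G : SimpleGraph V) (p : ℕ → V) : Prop where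
  inj : ∀ i ≤ n - 1, ∀ j ≤ n - 1, p i = p j → i = j
  adj : ∀ i < n - 1, G.Adj (p i) (p (i + 1))

/-- The interior vertices of a path of length `n - 1`. -/
def inner (n : ℕ) (p : ℕ → V) : Set V := p '' Icc 1 (n - 2)

lemma inner_finite (p : ℕ → V) : (inner n p).Finite := (finite_Icc 1 (n - 2)).image p

/-- The path `p` is a clean arc over `A`. -/
structure CleanArc (n : ℕ) (G : SimpleGraph V) (A : Set V) (p : ℕ → V) : Prop
    extends ArcPath n G p where
  left : p 0 ∈ A
  right : p (n - 1) ∈ A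
  out : ∀ i ∈ Icc 1 (n - 2), p i ∉ A
  clean : ∀ i ∈ Icc 1 (n - 2), ∀ x ∈ A ∪ inner n p, G.Adj (p i) x → x = p (i - 1) ∨ x = p (i + 1)

/-- Pigeonhole: `n - 2` distinct vertices of the interior fill it. -/
lemma surj_of_injOn {s p : ℕ → V} (hs : InjOn s (Icc 1 (n - 2)))
    (h : ∀ i ∈ Icc 1 (n - 2), s i ∈ inner n p) :
    ∀ k ∈ Icc 1 (n - 2), ∃ i ∈ Icc 1 (n - 2), s i = p k := by
  classical
  have h1 : (Finset.Icc 1 (n - 2)).image s ⊆ (Finset.Icc 1 (n - 2)).image p := by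
    intro x hx
    obtain ⟨i, hi, rfl⟩ := Finset.mem_image.1 hx
    obtain ⟨j, hj, h⟩ := h i (by simpa using hi)
    exact Finset.mem_image.2 ⟨j, by simpa using hj, h⟩
  have h2 := Finset.eq_of_subset_of_card_le h1 (by
    rw [Finset.card_image_of_injOn (f := s) (by simpa using hs)]
    exact Finset.card_image_le)
  intro k hk
  have : p k ∈ (Finset.Icc 1 (n - 2)).image p := Finset.mem_image.2 ⟨k, by simpa using hk, rfl⟩
  rw [← h2] at this
  obtain ⟨i, hi, h⟩ := Finset.mem_image.1 this
  exact ⟨i, by simpa using hi, h⟩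

/-- A path of length `n - 1` that leaves a strong subset is a clean arc over it. -/
lemma Strong.cleanArc (hn : 3 ≤ n) {A : Set V} (hA : Strong n G A) {p : ℕ → V}
    (hp : ArcPath n G p) (h0 : p 0 ∈ A) (h1 : p (n - 1) ∈ A) (hout : ∃ i ∈ Icc 1 (n - 2), p i ∉ A) :
    CleanArc n G A p ∧ Strong n G (A ∪ inner n p) := by
  have notloose : ∀ X : Set V, (A ⊆ X) → inner n p ⊆ X → ∀ k ∈ Icc 1 (n - 2), ¬ Loose G X (p k) := by
    intro X hAX hX k hk hl
    have hm : ∀ i ≤ n - 1, p i ∈ X := by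
      intro i hi
      rcases Nat.eq_zero_or_pos i with rfl | hi0
      · exact hAX h0
      · by_cases hi1 : i = n - 1
        · exact hAX (hi1 ▸ h1)
        · exact hX ⟨i, ⟨hi0, by omega⟩, rfl⟩
    obtain ⟨hk1, hk2⟩ := hk
    have a1 := hp.adj (k - 1) (by omega)
    have a2 := hp.adj k (by omega)
    rw [Nat.sub_add_cancel hk1] at a1
    have := hp.inj _ (by omega) _ (by omega)
      (hl _ (hm (k - 1) (by omega)) _ (hm (k + 1) (by omega)) a1.symm a2)
    omega
  have nbrs : ∀ X : Set V, (A ⊆ X) → inner n p ⊆ X → ∀ k ∈ Icc 1 (n - 2), Slim G X (p k) →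
      ∀ x ∈ X, G.Adj (p k) x → x = p (k - 1) ∨ x = p (k + 1) := by
    intro X hAX hX k hk hs x hx ax
    have hm : ∀ i ≤ n - 1, p i ∈ X := by
      intro i hi
      rcases Nat.eq_zero_or_pos i with rfl | hi0
      · exact hAX h0
      · by_cases hi1 : i = n - 1
        · exact hAX (hi1 ▸ h1)
        · exact hX ⟨i, ⟨hi0, by omega⟩, rfl⟩
    obtain ⟨hk1, hk2⟩ := hk
    have a1 := hp.adj (k - 1) (by omega)
    have a2 := hp.adj k (by omega)
    rw [Nat.sub_add_cancel hk1] at a1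
    rcases hs x hx _ (hm (k - 1) (by omega)) _ (hm (k + 1) (by omega)) ax a1.symm a2 with h | h | h
    · exact Or.inl h
    · exact Or.inr h
    · have := hp.inj _ (by omega) _ (by omega) h
      omega
  -- Strongness applied to the part of the interior outside `A`. Every interior vertex has two
  -- neighbours on the path, so none is loose; an arc of `n - 2` vertices then exhausts the
  -- interior.
  have hC := hA (inner n p \ A) (inner_finite p).sdiff (by
    obtain ⟨i, hi, hiA⟩ := hout
    exact ⟨p i, ⟨i, hi, rfl⟩, hiA⟩) disjoint_sdiff_right
  have hX : A ∪ inner n p \ A = A ∪ inner n p := union_sdiff_self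
  rw [hX] at hC
  have key : CleanArc n G A p := by
    rcases hC with ⟨v, ⟨⟨k, hk, rfl⟩, -⟩, hl⟩ | ⟨s, hs1, hs2, -⟩
    · exact absurd hl (notloose _ subset_union_left subset_union_right k hk)
    · have hsurj := surj_of_injOn hs1 (fun i hi => (hs2 i hi).1.1)
      refine ⟨hp, h0, h1, fun k hk => ?_, fun k hk => ?_⟩
      · obtain ⟨i, hi, h⟩ := hsurj k hk
        exact h ▸ (hs2 i hi).1.2
      · obtain ⟨i, hi, h⟩ := hsurj k hk
        exact nbrs _ subset_union_left subset_union_right k hk (h ▸ (hs2 i hi).2)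
  refine ⟨key, ?_⟩
  intro D hD hne hdis
  rw [disjoint_union_left] at hdis
  have hQA : Disjoint A (inner n p) := by
    rw [disjoint_right]
    rintro _ ⟨k, hk, rfl⟩
    exact key.out k hk
  have hXX : A ∪ (D ∪ inner n p) = A ∪ inner n p ∪ D := by
    rw [union_assoc, union_comm D]
  have hQX : inner n p ⊆ A ∪ inner n p ∪ D := fun x hx => Or.inl (Or.inr hx)
  have hAX : A ⊆ A ∪ inner n p ∪ D := fun x hx => Or.inl (Or.inl hx)
  have h2 := hA (D ∪ inner n p) (hD.union (inner_finite p)) (hne.mono subset_union_left)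
    (disjoint_union_right.2 ⟨hdis.1, hQA⟩)
  rw [hXX] at h2
  rcases h2 with ⟨v, hv | ⟨k, hk, rfl⟩, hl⟩ | ⟨s, hs1, hs2, hs3⟩
  · exact Or.inl ⟨v, hv, hl⟩
  · exact absurd hl (notloose _ hAX hQX k hk)
  by_cases hall : ∀ i ∈ Icc 1 (n - 2), s i ∈ D
  · exact Or.inr ⟨s, hs1, fun i hi => ⟨hall i hi, (hs2 i hi).2⟩, hs3⟩
  push Not at hall
  obtain ⟨i₀, hi₀, hi₀D⟩ := hall
  -- An arc `s` in `D ∪ inner n p` that meets the interior of `p` stays in it: a slim interior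
  -- vertex has only its path neighbours, and the ends of `p` lie in `A`.
  have step : ∀ i ∈ Icc 1 (n - 2), ∀ j ∈ Icc 1 (n - 2), G.Adj (s i) (s j) → s i ∈ inner n p →
      s j ∈ inner n p := by
    rintro i hi j hj ha ⟨k, hk, hki⟩
    have hsl := (hs2 i hi).2
    rw [← hki] at hsl ha
    have hsj : s j ∈ A ∪ inner n p ∪ D := by
      rcases (hs2 j hj).1 with h | h
      · exact Or.inr h
      · exact Or.inl (Or.inr h)
    have hsA : s j ∉ A := by
      rcases (hs2 j hj).1 with h | h
      · exact disjoint_right.1 hdis.1 h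
      · exact disjoint_right.1 hQA h
    have hin : ∀ m ≤ n - 1, s j = p m → s j ∈ inner n p := by
      intro m hm hmj
      rw [hmj] at hsA ⊢
      refine ⟨m, ⟨?_, ?_⟩, rfl⟩
      · rcases Nat.eq_zero_or_pos m with rfl | h
        · exact absurd h0 hsA
        · exact h
      · by_contra h
        have : m = n - 1 := by omega
        exact hsA (this ▸ h1)
    rcases nbrs _ hAX hQX k hk hsl _ hsj ha with h | h
    · exact hin (k - 1) (by have := hk.2; omega) h
    · exact hin (k + 1) (by have := hk.2; omega) h
  have hstart : s i₀ ∈ inner n p := (hs2 i₀ hi₀).1.resolve_left hi₀D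
  have up : ∀ d, i₀ + d ≤ n - 2 → s (i₀ + d) ∈ inner n p := by
    intro d
    induction d with
    | zero => intro _; exact hstart
    | succ d ih =>
      intro hd
      exact step (i₀ + d) ⟨by have := hi₀.1; omega, by omega⟩ (i₀ + (d + 1))
        ⟨by have := hi₀.1; omega, hd⟩ (hs3 _ (by have := hi₀.1; omega) (by omega)) (ih (by omega))
  have down : ∀ d, d + 1 ≤ i₀ → s (i₀ - d) ∈ inner n p := by
    intro d
    induction d with
    | zero => intro _; exact hstart
    | succ d ih =>
      intro hd
      have h2 := hi₀.2
      have e : i₀ - (d + 1) + 1 = i₀ - d := by omega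
      have := hs3 (i₀ - (d + 1)) (by omega) (by omega)
      rw [e] at this
      exact step (i₀ - d) ⟨by omega, by omega⟩ _ ⟨by omega, by omega⟩ this.symm (ih (by omega))
  have all : ∀ i ∈ Icc 1 (n - 2), s i ∈ inner n p := by
    intro i hi
    rcases le_total i₀ i with h | h
    · have := up (i - i₀) (by have := hi.2; omega)
      rwa [Nat.add_sub_cancel' h] at this
    · have := down (i₀ - i) (by have := hi.1; omega)
      rwa [Nat.sub_sub_self h] at this
  have hsurj := surj_of_injOn hs1 all
  -- Here `s` fills the interior of `p`, so all its vertices are slim in the whole set and none is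
  -- joined to `D`; the freeness of `D` over `A` persists.
  refine Free.extend (X := A ∪ D) ?_ (hA D hD hne hdis.1)
  rintro v hv x ((hx | ⟨k, hk, rfl⟩) | hx) ax
  · exact Or.inl hx
  · exfalso
    obtain ⟨i, hi, h⟩ := hsurj k hk
    have hvQ : ∀ m ≤ n - 1, v ≠ p m := by
      rintro m hm rfl
      by_cases hm0 : m = 0
      · exact disjoint_right.1 hdis.1 hv (hm0 ▸ h0)
      by_cases hm1 : m = n - 1
      · exact disjoint_right.1 hdis.1 hv (hm1 ▸ h1)
      exact disjoint_right.1 hdis.2 hv ⟨m, ⟨by omega, by omega⟩, rfl⟩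
    have hk2 := hk.2
    rcases nbrs _ hAX hQX k hk (h ▸ (hs2 i hi).2) v (Or.inr hv) ax.symm with h | h
    · exact hvQ _ (by omega) h
    · exact hvQ _ (by omega) h
  · exact Or.inr hx

/-- An open graph does not contain arbitrarily many disjoint closed extensions of a fixed finite
set. -/
lemma Strong.no_copies (hn : 3 ≤ n) (hG : Strong n G ∅) {B : Set V} (hB : B.Finite)
    (h : ∀ F : Set V, F.Finite → ∃ E : Set V, E.Finite ∧ E.Nonempty ∧ Disjoint F E ∧ Disjoint B E ∧
      ¬ Free n G (B ∪ E) E ∧ ∀ b ∈ B, ∃ e ∈ E, G.Adj b e) : False := by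
  -- Three disjoint copies give each vertex of `B` three neighbours, so it is neither loose nor slim
  -- in the union.
  obtain ⟨E₁, f₁, ne₁, -, dB₁, c₁, a₁⟩ := h ∅ finite_empty
  obtain ⟨E₂, f₂, ne₂, d₂, dB₂, c₂, a₂⟩ := h E₁ f₁
  obtain ⟨E₃, f₃, ne₃, d₃, dB₃, c₃, a₃⟩ := h (E₁ ∪ E₂) (f₁.union f₂)
  rw [disjoint_union_left] at d₃
  let C := B ∪ (E₁ ∪ E₂ ∪ E₃)
  have hE : ∀ v ∈ C, v ∉ B → ∃ E : Set V, v ∈ E ∧ ¬ Free n G (B ∪ E) E ∧ B ∪ E ⊆ C := by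
    rintro v (hv | (hv | hv) | hv) hvB
    · exact absurd hv hvB
    · exact ⟨E₁, hv, c₁, by intro x hx; simp only [C, mem_union] at *; tauto⟩
    · exact ⟨E₂, hv, c₂, by intro x hx; simp only [C, mem_union] at *; tauto⟩
    · exact ⟨E₃, hv, c₃, by intro x hx; simp only [C, mem_union] at *; tauto⟩
  have hB3 : ∀ b ∈ B, ∃ x ∈ C, ∃ y ∈ C, ∃ z ∈ C, G.Adj b x ∧ G.Adj b y ∧ G.Adj b z ∧
      x ≠ y ∧ x ≠ z ∧ y ≠ z := by
    intro b hb
    obtain ⟨x, hx, ax⟩ := a₁ b hb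
    obtain ⟨y, hy, ay⟩ := a₂ b hb
    obtain ⟨z, hz, az⟩ := a₃ b hb
    refine ⟨x, by simp [C, hx], y, by simp [C, hy], z, by simp [C, hz], ax, ay, az, ?_, ?_, ?_⟩
    · exact fun h => disjoint_left.1 d₂ hx (h ▸ hy)
    · exact fun h => disjoint_left.1 d₃.1 hx (h ▸ hz)
    · exact fun h => disjoint_left.1 d₃.2 hy (h ▸ hz)
  have hfree := hG C (hB.union ((f₁.union f₂).union f₃)) (ne₁.mono (by
    intro x hx; simp only [C, mem_union]; tauto)) (empty_disjoint _)
  rw [empty_union] at hfree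
  rcases hfree with ⟨v, hv, hl⟩ | ⟨s, hs1, hs2, hs3⟩
  · by_cases hvB : v ∈ B
    · obtain ⟨x, hx, y, hy, z, hz, ax, ay, az, h, -⟩ := hB3 v hvB
      exact h (hl x hx y hy ax ay)
    · obtain ⟨E, hvE, hc, hsub⟩ := hE v hv hvB
      exact hc (Or.inl ⟨v, hvE, hl.mono hsub⟩)
  · have nB : ∀ i ∈ Icc 1 (n - 2), s i ∉ B := by
      intro i hi hb
      obtain ⟨x, hx, y, hy, z, hz, ax, ay, az, h1, h2, h3⟩ := hB3 _ hb
      rcases (hs2 i hi).2 x hx y hy z hz ax ay az with h | h | h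
      · exact h1 h
      · exact h2 h
      · exact h3 h
    have h1 : 1 ∈ Icc 1 (n - 2) := ⟨le_rfl, by omega⟩
    obtain ⟨E, hvE, hc, hsub⟩ := hE _ (hs2 1 h1).1 (nB 1 h1)
    -- The arc cannot leave its copy: its vertex is not loose in `B ∪ E`, so it has two neighbours
    -- there, and slimness makes the next vertex one of them.
    have all : ∀ d, 1 + d ≤ n - 2 → s (1 + d) ∈ E := by
      intro d
      induction d with
      | zero => intro _; exact hvE
      | succ d ih =>
        intro hd
        have hsE := ih (by omega)
        have hnl : ¬ Loose G (B ∪ E) (s (1 + d)) := fun h => hc (Or.inl ⟨_, hsE, h⟩)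
        unfold Loose at hnl
        push Not at hnl
        obtain ⟨x, hx, y, hy, ax, ay, hxy⟩ := hnl
        have hi : 1 + (d + 1) ∈ Icc 1 (n - 2) := ⟨by omega, hd⟩
        have := (hs2 (1 + d) ⟨by omega, by omega⟩).2 _ (hs2 _ hi).1 x (hsub hx) y (hsub hy)
          (hs3 (1 + d) (by omega) (by omega)) ax ay
        have hm : s (1 + (d + 1)) ∈ B ∪ E := by
          rcases this with h | h | h
          · exact h ▸ hx
          · exact h ▸ hy
          · exact absurd h hxy
        exact hm.resolve_left (nB _ hi)
    refine hc (Or.inr ⟨s, hs1, fun i hi => ⟨?_, (hs2 i hi).2.mono hsub⟩, hs3⟩)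
    have := all (i - 1) (by have := hi.1; have := hi.2; omega)
    rwa [Nat.add_sub_cancel' hi.1] at this

/-- A finite set that is closed over `A` is closed over a finite set of its neighbours in `A`. -/
lemma exists_finite_not_free {A D : Set V} (hD : D.Finite) (h : ¬ Free n G (A ∪ D) D) :
    ∃ B ⊆ A, B.Finite ∧ ¬ Free n G (B ∪ D) D ∧ ∀ b ∈ B, ∃ d ∈ D, G.Adj b d := by
  have h1 : ∀ d, ∃ N ⊆ A, N.Finite ∧ (∀ b ∈ N, G.Adj d b) ∧
      (Loose G (N ∪ D) d → Loose G (A ∪ D) d) := by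
    intro d
    by_cases hl : Loose G (A ∪ D) d
    · exact ⟨∅, empty_subset _, finite_empty, by simp, fun _ => hl⟩
    · have hl' := hl
      unfold Loose at hl'
      push Not at hl'
      obtain ⟨x, hx, y, hy, ax, ay, hxy⟩ := hl'
      refine ⟨{x, y} ∩ A, inter_subset_right, (toFinite {x, y}).inter_of_left A, ?_, ?_⟩
      · rintro b ⟨rfl | rfl, -⟩ <;> assumption
      · intro h
        refine absurd (h x ?_ y ?_ ax ay) hxy
        · exact hx.imp (fun h => ⟨by simp, h⟩) id
        · exact hy.imp (fun h => ⟨by simp, h⟩) id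
  have h2 : ∀ d, ∃ N ⊆ A, N.Finite ∧ (∀ b ∈ N, G.Adj d b) ∧
      (Slim G (N ∪ D) d → Slim G (A ∪ D) d) := by
    intro d
    by_cases hl : Slim G (A ∪ D) d
    · exact ⟨∅, empty_subset _, finite_empty, by simp, fun _ => hl⟩
    · have hl' := hl
      unfold Slim at hl'
      push Not at hl'
      obtain ⟨x, hx, y, hy, z, hz, ax, ay, az, h1, h2, h3⟩ := hl'
      refine ⟨{x, y, z} ∩ A, inter_subset_right, (toFinite {x, y, z}).inter_of_left A, ?_, ?_⟩
      · rintro b ⟨rfl | rfl | rfl, -⟩ <;> assumption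
      · intro h
        exfalso
        rcases h x (hx.imp (fun h => ⟨by simp, h⟩) id) y (hy.imp (fun h => ⟨by simp, h⟩) id)
          z (hz.imp (fun h => ⟨by simp, h⟩) id) ax ay az with h | h | h
        · exact h1 h
        · exact h2 h
        · exact h3 h
  choose N hN1 hN2 hN3 hN4 using h1
  choose M hM1 hM2 hM3 hM4 using h2
  refine ⟨⋃ d ∈ D, (N d ∪ M d), ?_, ?_, ?_, ?_⟩
  · simp only [iUnion_subset_iff, union_subset_iff]
    exact fun d _ => ⟨hN1 d, hM1 d⟩
  · exact hD.biUnion fun d _ => (hN2 d).union (hM2 d)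
  · have sN : ∀ d ∈ D, N d ∪ D ⊆ (⋃ d ∈ D, (N d ∪ M d)) ∪ D := by
      rintro d hd x (hx | hx)
      · exact Or.inl (mem_biUnion hd (Or.inl hx))
      · exact Or.inr hx
    have sM : ∀ d ∈ D, M d ∪ D ⊆ (⋃ d ∈ D, (N d ∪ M d)) ∪ D := by
      rintro d hd x (hx | hx)
      · exact Or.inl (mem_biUnion hd (Or.inr hx))
      · exact Or.inr hx
    rintro (⟨v, hv, hl⟩ | ⟨s, hs1, hs2, hs3⟩)
    · exact h (Or.inl ⟨v, hv, hN4 v (hl.mono (sN v hv))⟩)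
    · exact h (Or.inr ⟨s, hs1, fun i hi => ⟨(hs2 i hi).1, hM4 _ ((hs2 i hi).2.mono
        (sM _ (hs2 i hi).1))⟩, hs3⟩)
  · simp only [mem_iUnion, exists_prop, forall_exists_index, and_imp]
    rintro b d hd (hb | hb)
    · exact ⟨d, hd, (hN3 d b hb).symm⟩
    · exact ⟨d, hd, (hM3 d b hb).symm⟩

end Openness

/-! ### Walks, girth and clean arcs in open generalized polygons. -/

section Polygons

variable {V : Type*} {G : SimpleGraph V} {n : ℕ} {col : V → Prop}

/-- An open generalized `n`-gon with the two classes of its bipartition. -/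
structure IsPoly (n : ℕ) (G : SimpleGraph V) (col : V → Prop) : Prop where
  three_le : 3 ≤ n
  bip : ∀ x y, G.Adj x y → (col x ↔ ¬ col y)
  girth : ∀ (x : V) (w : G.Walk x x), w.IsCycle → 2 * n ≤ w.length
  conn : ∀ x y, ((col x ↔ col y) ↔ Even (n - 1)) → ∃ w : G.Walk x y, w.length ≤ n - 1
  isOpen : Strong n G ∅

lemma exists_walk_of_path (p : ℕ → V) (i j : ℕ) (hij : i ≤ j)
    (h : ∀ k, i ≤ k → k < j → G.Adj (p k) (p (k + 1))) :
    ∃ w : G.Walk (p i) (p j), w.length = j - i ∧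
      (∀ x ∈ w.support, ∃ k, i ≤ k ∧ k ≤ j ∧ x = p k) ∧
      ∀ e ∈ w.edges, ∃ k, i ≤ k ∧ k < j ∧ e = s(p k, p (k + 1)) := by
  induction j, hij using Nat.le_induction with
  | base => exact ⟨.nil, by simp, fun x hx => ⟨i, le_rfl, le_rfl, by simpa using hx⟩, by simp⟩
  | succ j hij ih =>
    obtain ⟨w, h1, h2, h3⟩ := ih fun k hk hk' => h k hk (by omega)
    refine ⟨w.concat (h j hij (by omega)), ?_, ?_, ?_⟩
    · rw [Walk.length_concat]; omega
    · intro x hx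
      rw [Walk.support_concat, List.mem_append] at hx
      rcases hx with hx | hx
      · obtain ⟨k, a, b, c⟩ := h2 x hx
        exact ⟨k, a, by omega, c⟩
      · exact ⟨j + 1, by omega, le_rfl, by simpa using hx⟩
    · intro e he
      rw [Walk.edges_concat, List.concat_eq_append, List.mem_append] at he
      rcases he with hx | hx
      · obtain ⟨k, a, b, c⟩ := h3 e hx
        exact ⟨k, a, by omega, c⟩
      · exact ⟨j, hij, by omega, by simpa using hx⟩

lemma two_mul_le_of_walk (hG : ∀ (x : V) (w : G.Walk x x), w.IsCycle → 2 * n ≤ w.length)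
    {u v : V} (h : G.Adj u v) (w : G.Walk v u) (hw : s(u, v) ∉ w.edges) :
    2 * n ≤ w.length + 1 := by
  classical
  have := hG u (Walk.cons h w.bypass) (by
    rw [Walk.cons_isCycle_iff]
    exact ⟨w.bypass_isPath, fun h => hw (w.edges_bypass_subset_edges h)⟩)
  have h2 := w.length_bypass_le_length
  rw [Walk.length_cons] at this
  omega

/-- The first edge of `P` either starts the shortened `w` and can be cancelled, or lies on a cycle
formed with `w`. In particular a path of length at most `n` is a shortest one. -/
lemma not_lt_of_isPath (hG : ∀ (x : V) (w : G.Walk x x), w.IsCycle → 2 * n ≤ w.length)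
    {a b : V} (P : G.Walk a b) (hP : P.IsPath) (w : G.Walk a b) (h : P.length + w.length < 2 * n) :
    P.length ≤ w.length := by
  classical
  induction P with
  | nil => simp
  | @cons a c b hac P ih =>
    obtain ⟨hP1, hP2⟩ := (Walk.cons_isPath_iff _ _).1 hP
    have hb := w.length_bypass_le_length
    rw [Walk.length_cons] at h
    by_cases he : s(a, c) ∈ w.bypass.edges
    · have hbp := w.bypass_isPath
      generalize w.bypass = w' at he hb hbp
      cases w' with
      | nil => simp at he
      | @cons _ d _ had w' =>
        obtain ⟨h1, h2⟩ := (Walk.cons_isPath_iff _ _).1 hbp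
        rw [Walk.edges_cons, List.mem_cons] at he
        rcases he with he | he
        · have : c = d := by
            simp only [Sym2.eq_iff, true_and] at he
            rcases he with h | ⟨h, h'⟩
            · exact h
            · rw [h', h]
          subst this
          rw [Walk.length_cons] at hb
          have := ih hP1 w' (by omega)
          rw [Walk.length_cons]
          omega
        · exact absurd (w'.fst_mem_support_of_mem_edges he) h2
    · have := two_mul_le_of_walk hG hac (P.append w.bypass.reverse) (by
        rw [Walk.edges_append, List.mem_append, Walk.edges_reverse, List.mem_reverse]
        rintro (h | h)
        · exact hP2 (P.fst_mem_support_of_mem_edges h)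
        · exact he h)
      rw [Walk.length_append, Walk.length_reverse] at this
      omega

lemma no_chord (hG : ∀ (x : V) (w : G.Walk x x), w.IsCycle → 2 * n ≤ w.length)
    {p : ℕ → V} {i j : ℕ} (hij : i < j) (hinj : InjOn p (Icc i j))
    (h : ∀ k, i ≤ k → k < j → G.Adj (p k) (p (k + 1))) (hadj : G.Adj (p i) (p j))
    (hlen : j - i + 1 < 2 * n) : j = i + 1 := by
  by_contra hne
  obtain ⟨w, h1, h2, h3⟩ := exists_walk_of_path p i j hij.le h
  have := two_mul_le_of_walk hG hadj.symm w (by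
    intro he
    obtain ⟨k, hk1, hk2, hk⟩ := h3 _ he
    rw [Sym2.eq_iff] at hk
    rcases hk with ⟨ha, hb⟩ | ⟨ha, hb⟩
    · have := hinj ⟨by omega, by omega⟩ ⟨hk1, hk2.le⟩ ha
      omega
    · have := hinj ⟨by omega, by omega⟩ ⟨hk1, hk2.le⟩ hb
      have := hinj ⟨by omega, by omega⟩ ⟨by omega, by omega⟩ ha
      omega)
  omega

lemma even_length_iff (hb : ∀ x y, G.Adj x y → (col x ↔ ¬ col y)) {x y : V} (w : G.Walk x y) :
    (col x ↔ col y) ↔ Even w.length := by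
  induction w with
  | nil => simp
  | cons h w ih =>
    have := hb _ _ h
    rw [Walk.length_cons, Nat.even_add_one, ← ih]
    tauto

/-- Every walk inside `A` from `a` to `b` has length at least `n`. -/
def Far (n : ℕ) (G : SimpleGraph V) (A : Set V) (a b : V) : Prop :=
  ∀ w : G.Walk a b, (∀ x ∈ w.support, x ∈ A) → n ≤ w.length

/-- Parity gives a path of length at most `n - 1`, and `Far` makes it leave `A`. Its vertices
outside `A` are not loose, so strongness yields `n - 2` of them; hence the length is exactly `n - 1`
and `Strong.cleanArc` applies. -/
lemma IsPoly.exists_cleanArc (hG : IsPoly n G col) {A : Set V} (hA : Strong n G A) {a b : V}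
    (ha : a ∈ A) (hb : b ∈ A) (hpar : (col a ↔ col b) ↔ Even (n - 1)) (hfar : Far n G A a b) :
    ∃ p : ℕ → V, p 0 = a ∧ p (n - 1) = b ∧ CleanArc n G A p ∧ Strong n G (A ∪ inner n p) := by
  classical
  have hn := hG.three_le
  obtain ⟨w₀, hw₀⟩ := hG.conn a b hpar
  obtain ⟨w, hw, hlen⟩ : ∃ w : G.Walk a b, w.IsPath ∧ w.length ≤ n - 1 :=
    ⟨w₀.bypass, w₀.bypass_isPath, w₀.length_bypass_le_length.trans hw₀⟩
  have hne : ∃ x ∈ w.support, x ∉ A := by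
    by_contra h
    push Not at h
    have := hfar w h
    omega
  let C : Set V := {x | x ∈ w.support ∧ x ∉ A}
  have hsub : ∀ x ∈ C, ∃ i, 0 < i ∧ i < w.length ∧ w.getVert i = x := by
    rintro x ⟨hx, hxA⟩
    obtain ⟨i, rfl, hi⟩ := Walk.mem_support_iff_exists_getVert.1 hx
    refine ⟨i, ?_, ?_, rfl⟩
    · rcases Nat.eq_zero_or_pos i with rfl | h
      · simp [ha] at hxA
      · exact h
    · rcases hi.lt_or_eq with h | h
      · exact h
      · subst h
        simp [hb] at hxA
  have hmem : ∀ i, w.getVert i ∈ A ∪ C := by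
    intro i
    by_cases h : w.getVert i ∈ A
    · exact Or.inl h
    · exact Or.inr ⟨w.getVert_mem_support i, h⟩
  have hinj := hw.getVert_injOn
  have hfree := hA C (Set.Finite.subset (List.finite_toSet w.support) fun x hx => hx.1) hne
    (disjoint_right.2 fun x hx => hx.2)
  have hpath : w.length = n - 1 ∧ ∃ i ∈ Icc 1 (n - 2), w.getVert i ∉ A := by
    rcases hfree with ⟨v, hv, hl⟩ | ⟨s, hs1, hs2, -⟩
    · exfalso
      obtain ⟨i, h0, h1, rfl⟩ := hsub v hv
      have a1 := w.adj_getVert_succ (i := i - 1) (by omega)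
      have a2 := w.adj_getVert_succ h1
      rw [Nat.sub_add_cancel h0] at a1
      have := hinj (show i - 1 ≤ w.length by omega) (show i + 1 ≤ w.length by omega)
        (hl _ (hmem _) _ (hmem _) a1.symm a2)
      omega
    · have hcard : n - 2 ≤ w.length - 1 := by
        have h1 : (Finset.Icc 1 (n - 2)).image s ⊆ (Finset.Icc 1 (w.length - 1)).image w.getVert := by
          intro x hx
          obtain ⟨i, hi, rfl⟩ := Finset.mem_image.1 hx
          obtain ⟨j, hj1, hj2, h⟩ := hsub _ (hs2 i (by simpa using hi)).1
          exact Finset.mem_image.2 ⟨j, by simp; omega, h⟩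
        have h2 := Finset.card_le_card h1
        rw [Finset.card_image_of_injOn (f := s) (by simpa using hs1)] at h2
        have h3 := h2.trans Finset.card_image_le
        simpa using h3
      have hl : w.length = n - 1 := by omega
      refine ⟨hl, ?_⟩
      obtain ⟨j, h1, h2, h3⟩ := hsub _ (hs2 1 ⟨le_rfl, by omega⟩).1
      exact ⟨j, ⟨h1, by omega⟩, h3 ▸ (hs2 1 ⟨le_rfl, by omega⟩).1.2⟩
  obtain ⟨hl, hout⟩ := hpath
  have e : w.getVert (n - 1) = b := by rw [← hl, w.getVert_length]
  refine ⟨w.getVert, w.getVert_zero, e, ?_⟩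
  refine hA.cleanArc hn ⟨fun i hi j hj h => hinj (show i ≤ w.length by omega)
    (show j ≤ w.length by omega) h, fun i hi => w.adj_getVert_succ (by omega)⟩
    (by simpa using ha) (by rwa [e]) hout

lemma CleanArc.mem {A : Set V} {p : ℕ → V} (h : CleanArc n G A p) {i : ℕ} (hi : i ≤ n - 1) :
    p i ∈ A ∪ inner n p := by
  rcases Nat.eq_zero_or_pos i with rfl | hi0
  · exact Or.inl h.left
  · by_cases hi1 : i = n - 1
    · exact Or.inl (hi1 ▸ h.right)
    · exact Or.inr ⟨i, ⟨hi0, by omega⟩, rfl⟩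

/-- If no vertex of `C` is loose, then a free set contains the interior of a clean arc, and the
ends of this arc are not joined by a short walk in the remaining graph. -/
lemma IsPoly.exists_cleanArc_of_free (hG : IsPoly n G col) {X C : Set V} (hCX : C ⊆ X)
    (hfree : Free n G X C) (hl : ∀ v ∈ C, ¬ Loose G X v) :
    ∃ p : ℕ → V, inner n p ⊆ C ∧ CleanArc n G (X \ inner n p) p ∧
      Far n G (X \ inner n p) (p 0) (p (n - 1)) := by
  have hn := hG.three_le
  rcases hfree with ⟨v, hv, h⟩ | ⟨s, hs1, hs2, hs3⟩
  · exact absurd h (hl v hv)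
  have hsX : ∀ i ∈ Icc 1 (n - 2), s i ∈ X := fun i hi => hCX (hs2 i hi).1
  have two : ∀ i ∈ Icc 1 (n - 2), ∃ x ∈ X, ∃ y ∈ X, G.Adj (s i) x ∧ G.Adj (s i) y ∧ x ≠ y := by
    intro i hi
    have := hl _ (hs2 i hi).1
    unfold Loose at this
    push Not at this
    obtain ⟨x, hx, y, hy, ax, ay, hxy⟩ := this
    exact ⟨x, hx, y, hy, ax, ay, hxy⟩
  have other : ∀ i ∈ Icc 1 (n - 2), ∀ z ∈ X, G.Adj (s i) z →
      ∃ x ∈ X, G.Adj (s i) x ∧ x ≠ z := by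
    intro i hi z hz az
    obtain ⟨x, hx, y, hy, ax, ay, hxy⟩ := two i hi
    by_cases h : x = z
    · exact ⟨y, hy, ay, fun h' => hxy (h.trans h'.symm)⟩
    · exact ⟨x, hx, ax, h⟩
  obtain ⟨a, ha, b, hb, ada, adb, hab3, ha4, hb4⟩ : ∃ a ∈ X, ∃ b ∈ X, G.Adj (s 1) a ∧
      G.Adj (s (n - 2)) b ∧ (n = 3 → a ≠ b) ∧ (4 ≤ n → a ≠ s 2) ∧ (4 ≤ n → b ≠ s (n - 3)) := by
    -- For `n = 3` the arc has one interior vertex, and both ends must be found among its own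
    -- neighbours; otherwise each end is a neighbour of an extreme vertex different from the one on
    -- the path.
    by_cases h3 : n = 3
    · subst h3
      obtain ⟨x, hx, y, hy, ax, ay, hxy⟩ := two 1 ⟨le_rfl, le_rfl⟩
      exact ⟨x, hx, y, hy, ax, ay, fun _ => hxy, by omega, by omega⟩
    · have e : n - 3 + 1 = n - 2 := by omega
      have h1 := hs3 1 le_rfl (by omega)
      have h2 := hs3 (n - 3) (by omega) (by omega)
      rw [e] at h2
      obtain ⟨a, ha, ada, ha'⟩ := other 1 ⟨le_rfl, by omega⟩ _ (hsX 2 ⟨by omega, by omega⟩) h1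
      obtain ⟨b, hb, adb, hb'⟩ := other (n - 2) ⟨by omega, le_rfl⟩ _
        (hsX (n - 3) ⟨by omega, by omega⟩) h2.symm
      exact ⟨a, ha, b, hb, ada, adb, fun h => absurd h h3, fun _ => ha', fun _ => hb'⟩
  have haI : ∀ k ∈ Icc 1 (n - 2), a ≠ s k := by
    rintro k ⟨hk1, hk2⟩ rfl
    rcases hk1.lt_or_eq with h | h
    · have := no_chord hG.girth h (hs1.mono (Icc_subset_Icc le_rfl hk2))
        (fun i h1 h2 => hs3 i h1 (by omega)) ada (by omega)
      subst this
      exact ha4 (by omega) rfl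
    · subst h
      exact ada.ne rfl
  have hbI : ∀ k ∈ Icc 1 (n - 2), b ≠ s k := by
    rintro k ⟨hk1, hk2⟩ rfl
    rcases hk2.lt_or_eq with h | h
    · have := no_chord hG.girth h (hs1.mono (Icc_subset_Icc hk1 le_rfl))
        (fun i h1 h2 => hs3 i (by omega) (by omega)) adb.symm (by omega)
      have e : k = n - 3 := by omega
      subst e
      exact hb4 (by omega) rfl
    · subst h
      exact adb.ne rfl
  have hab : a ≠ b := by
    by_cases h3 : n = 3
    · exact hab3 h3
    · rintro rfl
      let q : ℕ → V := fun i => if i = 0 then a else s i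
      have hq : ∀ i, 1 ≤ i → q i = s i := fun i hi => if_neg (by omega)
      have := no_chord hG.girth (p := q) (i := 0) (j := n - 2) (by omega) (by
        rintro i ⟨-, hi⟩ j ⟨-, hj⟩ hij
        by_cases hi0 : i = 0 <;> by_cases hj0 : j = 0
        · omega
        · rw [hq j (by omega), hi0] at hij
          exact absurd hij (haI j ⟨by omega, hj⟩)
        · rw [hq i (by omega), hj0] at hij
          exact absurd hij.symm (haI i ⟨by omega, hi⟩)
        · rw [hq i (by omega), hq j (by omega)] at hij
          exact hs1 ⟨by omega, hi⟩ ⟨by omega, hj⟩ hij) (by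
        intro k _ hk
        by_cases hk0 : k = 0
        · subst hk0
          rw [hq (0 + 1) (by omega)]
          exact ada.symm
        · rw [hq _ (by omega), hq _ (by omega)]
          exact hs3 k (by omega) (by omega)) (by
        rw [hq (n - 2) (by omega)]
        exact adb.symm) (by omega)
      omega
  let p : ℕ → V := fun i => if i = 0 then a else if i = n - 1 then b else s i
  have p0 : p 0 = a := if_pos rfl
  have p1 : p (n - 1) = b := by
    have : n - 1 ≠ 0 := by omega
    simp [p, this]
  have ps : ∀ i ∈ Icc 1 (n - 2), p i = s i := by
    rintro i ⟨h1, h2⟩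
    simp only [p]
    rw [if_neg (by omega), if_neg (by omega)]
  have hinner : inner n p = s '' Icc 1 (n - 2) := image_congr ps
  have hcase : ∀ i ≤ n - 1, i = 0 ∨ i = n - 1 ∨ i ∈ Icc 1 (n - 2) := by
    intro i hi
    simp only [mem_Icc]
    omega
  have hp : ArcPath n G p := by
    refine ⟨?_, ?_⟩
    · intro i hi j hj hij
      rcases hcase i hi with rfl | rfl | hi' <;> rcases hcase j hj with rfl | rfl | hj'
      · rfl
      · rw [p0, p1] at hij; exact absurd hij hab
      · rw [p0, ps j hj'] at hij; exact absurd hij (haI j hj')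
      · rw [p0, p1] at hij; exact absurd hij.symm hab
      · rfl
      · rw [p1, ps j hj'] at hij; exact absurd hij (hbI j hj')
      · rw [p0, ps i hi'] at hij; exact absurd hij.symm (haI i hi')
      · rw [p1, ps i hi'] at hij; exact absurd hij.symm (hbI i hi')
      · rw [ps i hi', ps j hj'] at hij; exact hs1 hi' hj' hij
    · intro i hi
      by_cases h0 : i = 0
      · subst h0
        rw [p0, ps 1 ⟨le_rfl, by omega⟩]
        exact ada.symm
      · by_cases h1 : i = n - 2
        · have e : i + 1 = n - 1 := by omega
          rw [e, p1, ps i ⟨by omega, by omega⟩, h1]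
          exact adb
        · rw [ps i ⟨by omega, by omega⟩, ps (i + 1) ⟨by omega, by omega⟩]
          exact hs3 i (by omega) (by omega)
  have pX : ∀ i ≤ n - 1, p i ∈ X := by
    intro i hi
    rcases hcase i hi with rfl | rfl | hi'
    · rwa [p0]
    · rwa [p1]
    · rw [ps i hi']; exact hsX i hi'
  refine ⟨p, ?_, ⟨hp, ?_, ?_, ?_, ?_⟩, ?_⟩
  · rw [hinner]
    rintro _ ⟨i, hi, rfl⟩
    exact (hs2 i hi).1
  · rw [p0, hinner]
    refine ⟨ha, ?_⟩
    rintro ⟨k, hk, h⟩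
    exact haI k hk h.symm
  · rw [p1, hinner]
    refine ⟨hb, ?_⟩
    rintro ⟨k, hk, h⟩
    exact hbI k hk h.symm
  · intro i hi h
    exact h.2 ⟨i, hi, rfl⟩
  · intro i hi x hx ax
    have hxX : x ∈ X := by
      rcases hx with hx | ⟨k, hk, rfl⟩
      · exact hx.1
      · exact pX k (by have := hk.2; omega)
    have h1 := hi.1
    have h2 := hi.2
    have a1 := hp.adj (i - 1) (by omega)
    have a2 := hp.adj i (by omega)
    rw [Nat.sub_add_cancel h1] at a1
    have hsl := (hs2 i hi).2
    rw [← ps i hi] at hsl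
    rcases hsl x hxX _ (pX (i - 1) (by omega)) _ (pX (i + 1) (by omega)) ax a1.symm a2 with h | h | h
    · exact Or.inl h
    · exact Or.inr h
    · have := hp.inj _ (by omega) _ (by omega) h
      omega
  · intro w hw
    -- A walk `w` avoiding the interior, the path from `p 1` and the edge from `p 0` to `p 1`
    -- enclose a cycle of length at least `2n`, so `w` has length at least `n + 1`.
    obtain ⟨w', h1, h2, h3⟩ := exists_walk_of_path p 1 (n - 1) (by omega)
      (fun k _ hk => hp.adj k hk)
    have := two_mul_le_of_walk hG.girth (hp.adj 0 (by omega)) (w'.append w.reverse) (by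
      rw [Walk.edges_append, List.mem_append, Walk.edges_reverse, List.mem_reverse]
      rintro (h | h)
      · obtain ⟨k, hk1, hk2, hk⟩ := h3 _ h
        rw [Sym2.eq_iff] at hk
        rcases hk with ⟨hk, -⟩ | ⟨hk, -⟩
        · have := hp.inj _ (by omega) _ (by omega) hk
          omega
        · have := hp.inj _ (by omega) _ (by omega) hk
          omega
      · exact (hw _ (w.snd_mem_support_of_mem_edges h)).2 ⟨1, ⟨le_rfl, by omega⟩, rfl⟩)
    rw [Walk.length_append, Walk.length_reverse] at this
    omega

end Polygons

/-! ### Integer functions certifying lower bounds on distances. -/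

section Potentials

variable {V : Type*} {G : SimpleGraph V} {n : ℕ}

/-- `φ` changes by at most one along the edges inside `A`. -/
def Pot (G : SimpleGraph V) (A : Set V) (φ : V → ℤ) : Prop :=
  ∀ x ∈ A, ∀ y ∈ A, G.Adj x y → φ y ≤ φ x + 1

lemma Pot.walk {A : Set V} {φ : V → ℤ} (h : Pot G A φ) {x y : V} (w : G.Walk x y)
    (hw : ∀ z ∈ w.support, z ∈ A) : φ y ≤ φ x + w.length := by
  induction w with
  | nil => simp
  | cons ha w ih =>
    have h1 := h _ (hw _ (by simp)) _ (hw _ (by simp)) ha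
    have h2 := ih fun z hz => hw z (by simp [hz])
    rw [Walk.length_cons]
    push_cast
    linarith

lemma Pot.far {A : Set V} {φ : V → ℤ} (h : Pot G A φ) {x y : V} (hxy : φ x + n ≤ φ y) :
    Far n G A x y := by
  intro w hw
  have := h.walk w hw
  omega

/-- Interior vertices of a clean arc have no neighbours off the arc, so their values may be
prescribed freely as long as consecutive values on the arc differ by at most one. -/
lemma Pot.extend {A : Set V} {φ : V → ℤ} (h : Pot G A φ) {p : ℕ → V} (hp : CleanArc n G A p)
    (ψ : ℕ → ℤ) (h0 : ψ 0 = φ (p 0)) (h1 : ψ (n - 1) = φ (p (n - 1)))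
    (hψ : ∀ i < n - 1, |ψ (i + 1) - ψ i| ≤ 1) :
    ∃ φ' : V → ℤ, (∀ x ∈ A, φ' x = φ x) ∧ (∀ i ≤ n - 1, φ' (p i) = ψ i) ∧
      Pot G (A ∪ inner n p) φ' := by
  classical
  let φ' : V → ℤ := fun x => if hx : ∃ i ∈ Icc 1 (n - 2), p i = x then ψ hx.choose else φ x
  have eA : ∀ x ∈ A, φ' x = φ x := by
    intro x hx
    refine dif_neg ?_
    rintro ⟨i, hi, rfl⟩
    exact hp.out i hi hx
  have ep : ∀ i ≤ n - 1, φ' (p i) = ψ i := by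
    intro i hi
    rcases Nat.eq_zero_or_pos i with rfl | hi0
    · rw [eA _ hp.left, h0]
    by_cases hi1 : i = n - 1
    · rw [hi1, eA _ hp.right, h1]
    have hx : ∃ j ∈ Icc 1 (n - 2), p j = p i := ⟨i, ⟨hi0, by omega⟩, rfl⟩
    have : φ' (p i) = ψ hx.choose := dif_pos hx
    rw [this]
    obtain ⟨⟨hj1, hj2⟩, hj3⟩ := hx.choose_spec
    rw [hp.inj _ (by omega) _ hi hj3]
  have estep : ∀ i ∈ Icc 1 (n - 2), ∀ x ∈ A ∪ inner n p, G.Adj (p i) x →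
      |φ' x - φ' (p i)| ≤ 1 := by
    rintro i hi x hx ax
    have hi1 := hi.1
    have hi2 := hi.2
    rcases hp.clean i hi x hx ax with rfl | rfl
    · have := hψ (i - 1) (by omega)
      rw [Nat.sub_add_cancel hi1] at this
      rw [ep _ (by omega), ep _ (by omega), abs_sub_comm]
      exact this
    · rw [ep _ (by omega), ep _ (by omega)]
      exact hψ i (by omega)
  refine ⟨φ', eA, ep, ?_⟩
  intro x hx y hy hxy
  rcases hx with hxA | ⟨i, hi, rfl⟩
  · rcases hy with hyA | ⟨i, hi, rfl⟩
    · rw [eA x hxA, eA y hyA]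
      exact h x hxA y hyA hxy
    · have := abs_le.1 (estep i hi x (Or.inl hxA) hxy.symm)
      linarith
  · have := abs_le.1 (estep i hi y hy hxy)
    linarith

/-- The witness is the distance from `u` inside `A`, cut off at `T`; the cut-off also supplies the
value at unreachable vertices. -/
lemma exists_pot (A : Set V) {u : V} (hu : u ∈ A) (T : ℕ) :
    ∃ φ : V → ℤ, Pot G A φ ∧ φ u = 0 ∧ (∀ y, 0 ≤ φ y ∧ φ y ≤ T) ∧
      ∀ y t, t ≤ T → (∀ w : G.Walk u y, (∀ z ∈ w.support, z ∈ A) → t ≤ w.length) → t ≤ φ y := by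
  classical
  let S : V → Set ℕ := fun y =>
    insert T {l | ∃ w : G.Walk u y, (∀ z ∈ w.support, z ∈ A) ∧ w.length = l}
  have hS : ∀ y, (S y).Nonempty := fun y => ⟨T, mem_insert _ _⟩
  refine ⟨fun y => (sInf (S y) : ℕ), ?_, ?_, ?_, ?_⟩
  · intro x hx y hy hxy
    have : sInf (S y) ≤ sInf (S x) + 1 := by
      rcases Nat.sInf_mem (hS x) with h | ⟨w, hw, h⟩
      · have : sInf (S y) ≤ T := Nat.sInf_le (mem_insert _ _)
        omega
      · rw [← h]
        refine Nat.sInf_le (mem_insert_of_mem _ ⟨w.concat hxy, ?_, Walk.length_concat _ _⟩)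
        intro z hz
        rw [Walk.support_concat, List.mem_append] at hz
        rcases hz with hz | hz
        · exact hw z hz
        · rwa [List.mem_singleton.1 hz]
    show ((sInf (S y) : ℕ) : ℤ) ≤ (sInf (S x) : ℕ) + 1
    exact_mod_cast this
  · have : sInf (S u) ≤ 0 := Nat.sInf_le (mem_insert_of_mem _ ⟨.nil, by simpa using hu, rfl⟩)
    have : sInf (S u) = 0 := by omega
    simp [this]
  · intro y
    refine ⟨Int.natCast_nonneg _, Int.ofNat_le.2 (Nat.sInf_le (mem_insert _ _))⟩
  · intro y t ht h
    have : t ≤ sInf (S y) := by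
      rcases Nat.sInf_mem (hS y) with h' | ⟨w, hw, h'⟩
      · rwa [h']
      · rw [← h']
        exact h w hw
    exact Int.ofNat_le.2 this

end Potentials

/-! ### Atomic types of finite tuples and what elementary maps transfer. -/

section Patterns

/-- The incidence relation of a structure. -/
def inc {M : Type*} [bipLang.Structure M] (x y : M) : Prop :=
  RelMap (L := bipLang) (n := 2) BipRel.inc ![x, y]

/-- The predicate for the first class of the bipartition. -/
def col {M : Type*} [bipLang.Structure M] (x : M) : Prop :=
  RelMap (L := bipLang) (n := 1) BipRel.point ![x]

/-- The predicate for the second class of the bipartition. -/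
def lin {M : Type*} [bipLang.Structure M] (x : M) : Prop :=
  RelMap (L := bipLang) (n := 1) BipRel.line ![x]

/-- The incidence graph of a structure. -/
def gr (M : Type*) [bipLang.Structure M] : SimpleGraph M := SimpleGraph.fromRel inc

/-- The structure is a graph with a partition into two classes. -/
structure IsBip (M : Type*) [bipLang.Structure M] : Prop where
  symm : ∀ x y : M, inc x y → inc y x
  ne : ∀ x y : M, inc x y → x ≠ y
  lin_iff : ∀ x : M, lin x ↔ ¬ col x

lemma IsBip.adj_iff {M : Type*} [bipLang.Structure M] (h : IsBip M) {x y : M} :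
    (gr M).Adj x y ↔ inc x y := by
  rw [gr, SimpleGraph.fromRel_adj]
  exact ⟨fun h' => h'.2.elim id (h.symm _ _), fun h' => ⟨h.ne _ _ h', Or.inl h'⟩⟩

lemma relMap_inc {M : Type*} [bipLang.Structure M] (x : Fin 2 → M) :
    RelMap (L := bipLang) (n := 2) BipRel.inc x ↔ inc (x 0) (x 1) := by
  unfold inc
  have : x = ![x 0, x 1] := by ext i; fin_cases i <;> rfl
  rw [← this]

lemma relMap_point {M : Type*} [bipLang.Structure M] (x : Fin 1 → M) :
    RelMap (L := bipLang) (n := 1) BipRel.point x ↔ col (x 0) := by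
  unfold col
  have : x = ![x 0] := by ext i; fin_cases i; rfl
  rw [← this]

lemma relMap_line {M : Type*} [bipLang.Structure M] (x : Fin 1 → M) :
    RelMap (L := bipLang) (n := 1) BipRel.line x ↔ lin (x 0) := by
  unfold lin
  have : x = ![x 0] := by ext i; fin_cases i; rfl
  rw [← this]

variable {ι : Type}

/-- The atomic formulas in the variables `ι`. -/
def atomFormula : (ι × ι) ⊕ (ι × ι) ⊕ ι ⊕ ι → bipLang.Formula ι
  | .inl (i, j) => Term.equal (Term.var i) (Term.var j)
  | .inr (.inl (i, j)) => Relations.formula₂ (L := bipLang) BipRel.inc (Term.var i) (Term.var j)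
  | .inr (.inr (.inl i)) => Relations.formula₁ (L := bipLang) BipRel.point (Term.var i)
  | .inr (.inr (.inr i)) => Relations.formula₁ (L := bipLang) BipRel.line (Term.var i)

/-- Two tuples have the same atomic type. -/
structure SamePat {M N : Type} [bipLang.Structure M] [bipLang.Structure N] (v : ι → M)
    (w : ι → N) : Prop where
  eq_iff : ∀ i j, v i = v j ↔ w i = w j
  inc_iff : ∀ i j, inc (v i) (v j) ↔ inc (w i) (w j)
  col_iff : ∀ i, col (v i) ↔ col (w i)
  lin_iff : ∀ i, lin (v i) ↔ lin (w i)

lemma SamePat.symm {M N : Type} [bipLang.Structure M] [bipLang.Structure N] {v : ι → M}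
    {w : ι → N} (h : SamePat v w) : SamePat w v :=
  ⟨fun i j => (h.eq_iff i j).symm, fun i j => (h.inc_iff i j).symm, fun i => (h.col_iff i).symm,
    fun i => (h.lin_iff i).symm⟩

lemma SamePat.trans {M N K : Type} [bipLang.Structure M] [bipLang.Structure N]
    [bipLang.Structure K] {v : ι → M} {w : ι → N} {u : ι → K} (h : SamePat v w)
    (h' : SamePat w u) : SamePat v u :=
  ⟨fun i j => (h.eq_iff i j).trans (h'.eq_iff i j), fun i j => (h.inc_iff i j).trans (h'.inc_iff i j),
    fun i => (h.col_iff i).trans (h'.col_iff i), fun i => (h.lin_iff i).trans (h'.lin_iff i)⟩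

lemma samePat_iff {M N : Type} [bipLang.Structure M] [bipLang.Structure N] (v : ι → M)
    (w : ι → N) :
    SamePat v w ↔ ∀ a, (atomFormula a).Realize v ↔ (atomFormula a).Realize w := by
  have e1 : ∀ {K : Type} [bipLang.Structure K] (u : ι → K) i j,
      (atomFormula (.inl (i, j))).Realize u ↔ u i = u j := fun u i j => by simp [atomFormula]
  have e2 : ∀ {K : Type} [bipLang.Structure K] (u : ι → K) i j,
      (atomFormula (.inr (.inl (i, j)))).Realize u ↔ inc (u i) (u j) := fun u i j =>
    Formula.realize_rel₂
  have e3 : ∀ {K : Type} [bipLang.Structure K] (u : ι → K) i,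
      (atomFormula (.inr (.inr (.inl i)))).Realize u ↔ col (u i) := fun u i =>
    Formula.realize_rel₁
  have e4 : ∀ {K : Type} [bipLang.Structure K] (u : ι → K) i,
      (atomFormula (.inr (.inr (.inr i)))).Realize u ↔ lin (u i) := fun u i =>
    Formula.realize_rel₁
  constructor
  · rintro ⟨h1, h2, h3, h4⟩ (⟨i, j⟩ | ⟨i, j⟩ | i | i)
    · rw [e1, e1]; exact h1 i j
    · rw [e2, e2]; exact h2 i j
    · rw [e3, e3]; exact h3 i
    · rw [e4, e4]; exact h4 i
  · intro h
    refine ⟨fun i j => ?_, fun i j => ?_, fun i => ?_, fun i => ?_⟩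
    · rw [← e1, ← e1]; exact h _
    · rw [← e2, ← e2]; exact h _
    · rw [← e3, ← e3]; exact h _
    · rw [← e4, ← e4]; exact h _

/-- The property `P` of tuples depends only on the atomic type. -/
def Inv (P : ∀ (M : Type) [bipLang.Structure M], (ι → M) → Prop) : Prop :=
  ∀ (M N : Type) [bipLang.Structure M] [bipLang.Structure N] (v : ι → M) (w : ι → N),
    SamePat v w → P M v → P N w

/-- A finite tuple has finitely many atoms, as there are no function symbols. The formula is the
disjunction of the atomic types realized with `P` in some structure, and it works for all structures
at once. -/
lemma exists_formula [Finite ι] {P : ∀ (M : Type) [bipLang.Structure M], (ι → M) → Prop}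
    (hP : Inv P) : ∃ φ : bipLang.Formula ι, ∀ (M : Type) [bipLang.Structure M] (v : ι → M),
      φ.Realize v ↔ P M v := by
  classical
  let Q := {q : (ι × ι) ⊕ (ι × ι) ⊕ ι ⊕ ι → Prop // ∃ (M : Type) (_ : bipLang.Structure M)
    (v : ι → M), (∀ a, (atomFormula a).Realize v ↔ q a) ∧ P M v}
  let lit (q : (ι × ι) ⊕ (ι × ι) ⊕ ι ⊕ ι → Prop) (a : (ι × ι) ⊕ (ι × ι) ⊕ ι ⊕ ι) :
    bipLang.Formula ι := if q a then atomFormula a else ∼(atomFormula a)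
  have hlit : ∀ q a (M : Type) [bipLang.Structure M] (v : ι → M),
      (lit q a).Realize v ↔ ((atomFormula a).Realize v ↔ q a) := by
    intro q a M _ v
    by_cases h : q a <;> simp [lit, h]
  refine ⟨Formula.iSup fun q : Q => Formula.iInf (lit q.1), fun M _ v => ?_⟩
  rw [Formula.realize_iSup]
  constructor
  · rintro ⟨⟨q, N, hN, w, hw, hPw⟩, h⟩
    rw [Formula.realize_iInf] at h
    refine hP N M w v ((samePat_iff _ _).2 fun a => ?_) hPw
    rw [hw a, (hlit q a M v).1 (h a)]
  · intro h
    refine ⟨⟨fun a => (atomFormula a).Realize v, M, inferInstance, v, fun _ => Iff.rfl, h⟩, ?_⟩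
    rw [Formula.realize_iInf]
    intro a
    rw [hlit]

/-- Elementary embeddings preserve and reflect `∀∃∀`-properties. -/
lemma transfer {κ β γ δ : Type} [Finite κ] [Finite β] [Finite γ] [Finite δ]
    {P : ∀ (M : Type) [bipLang.Structure M], (((κ ⊕ β) ⊕ γ) ⊕ δ → M) → Prop} (hP : Inv P)
    {M N : Type} [bipLang.Structure M] [bipLang.Structure N] (f : M ↪ₑ[bipLang] N) (c : κ → M) :
    (∀ B : β → M, ∃ g : γ → M, ∀ D : δ → M, P M (Sum.elim (Sum.elim (Sum.elim c B) g) D)) ↔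
    ∀ B : β → N, ∃ g : γ → N, ∀ D : δ → N,
      P N (Sum.elim (Sum.elim (Sum.elim (f ∘ c) B) g) D) := by
  obtain ⟨φ, hφ⟩ := exists_formula hP
  have h : ∀ (K : Type) [bipLang.Structure K] (c : κ → K),
      (((φ.iAlls δ).iExs γ).iAlls β).Realize c ↔ ∀ B : β → K, ∃ g : γ → K, ∀ D : δ → K,
        P K (Sum.elim (Sum.elim (Sum.elim c B) g) D) := by
    intro K _ c
    simp only [Formula.realize_iAlls, Formula.realize_iExs, hφ]
  rw [← h, ← h]
  exact (f.map_formula _ _).symm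

lemma SamePat.exists_map [Nonempty ι] {M N : Type} [bipLang.Structure M] [bipLang.Structure N]
    {v : ι → M} {w : ι → N} (h : SamePat v w) : ∃ e : M → N, (∀ i, e (v i) = w i) ∧
      PIso (gr M) (gr N) e (range v) := by
  classical
  let e : M → N := fun x => if hx : ∃ i, v i = x then w hx.choose else w (Classical.arbitrary ι)
  have he : ∀ i, e (v i) = w i := by
    intro i
    have hx : ∃ j, v j = v i := ⟨i, rfl⟩
    have : e (v i) = w hx.choose := dif_pos hx
    rw [this, ← h.eq_iff]
    exact hx.choose_spec
  refine ⟨e, he, ?_, ?_⟩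
  · rintro _ ⟨i, rfl⟩ _ ⟨j, rfl⟩ hij
    rw [he, he] at hij
    exact (h.eq_iff i j).2 hij
  · rintro _ ⟨i, rfl⟩ _ ⟨j, rfl⟩
    rw [he, he, gr, gr, SimpleGraph.fromRel_adj, SimpleGraph.fromRel_adj, Ne, Ne, ← h.eq_iff,
      ← h.inc_iff, ← h.inc_iff]

/-- Finite configurations of an elementary extension have copies in the given structure. -/
lemma exists_copy {M N : Type} [bipLang.Structure M] [bipLang.Structure N] [Nonempty M]
    (f : M ↪ₑ[bipLang] N) {A : Set M} (hA : A.Finite) {X : Set N} (hX : X.Finite)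
    (hAX : f '' A ⊆ X) : ∃ e : N → M, (∀ a ∈ A, e (f a) = a) ∧ PIso (gr N) (gr M) e X ∧
      ∀ x ∈ X, (col (e x) ↔ col x) := by
  classical
  have := hA.to_subtype
  have := hX.to_subtype
  let v₀ : ((A ⊕ Empty) ⊕ X) ⊕ Empty → N :=
    Sum.elim (Sum.elim (Sum.elim (f ∘ Subtype.val) Empty.elim) Subtype.val) Empty.elim
  -- Having the atomic type of the configuration is invariant. Both universal blocks are empty, so a
  -- purely existential statement is transferred, witnessed in `N` by `X` itself.
  have hP : Inv (ι := ((A ⊕ Empty) ⊕ X) ⊕ Empty) (fun M _ v => SamePat v v₀) :=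
    fun M N _ _ v w h h' => h.symm.trans h'
  have := (transfer hP f (Subtype.val : A → M)).2 (fun B => ⟨Subtype.val, fun D => by
    have e1 : B = Empty.elim := funext fun i => i.elim
    have e2 : D = Empty.elim := funext fun i => i.elim
    subst e1 e2
    exact ⟨fun _ _ => Iff.rfl, fun _ _ => Iff.rfl, fun _ => Iff.rfl, fun _ => Iff.rfl⟩⟩) Empty.elim
  obtain ⟨g, hg⟩ := this
  have hg := hg Empty.elim
  let e : N → M := fun x => if hx : x ∈ X then g ⟨x, hx⟩ else Classical.arbitrary M
  have he : ∀ x (hx : x ∈ X), e x = g ⟨x, hx⟩ := fun x hx => dif_pos hx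
  refine ⟨e, fun a ha => ?_, ⟨fun x hx y hy hxy => ?_, fun x hx y hy => ?_⟩, fun x hx => ?_⟩
  · have hx : f a ∈ X := hAX ⟨a, ha, rfl⟩
    rw [he _ hx]
    exact (hg.eq_iff (.inl (.inr ⟨f a, hx⟩)) (.inl (.inl (.inl ⟨a, ha⟩)))).2 rfl
  · rw [he x hx, he y hy] at hxy
    exact (hg.eq_iff (.inl (.inr ⟨x, hx⟩)) (.inl (.inr ⟨y, hy⟩))).1 hxy
  · rw [he x hx, he y hy, gr, gr, SimpleGraph.fromRel_adj, SimpleGraph.fromRel_adj]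
    have h1 := hg.eq_iff (.inl (.inr ⟨x, hx⟩)) (.inl (.inr ⟨y, hy⟩))
    have h2 := hg.inc_iff (.inl (.inr ⟨x, hx⟩)) (.inl (.inr ⟨y, hy⟩))
    have h3 := hg.inc_iff (.inl (.inr ⟨y, hy⟩)) (.inl (.inr ⟨x, hx⟩))
    simp only [Sum.elim_inl, Sum.elim_inr, v₀] at h1 h2 h3
    rw [Ne, h1, h2, h3]
  · rw [he x hx]
    exact hg.col_iff (.inl (.inr ⟨x, hx⟩))

end Patterns

/-! ### Open polygons under elementary extension. -/

section ElementaryExtensions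

variable {n : ℕ} {M N : Type} [bipLang.Structure M] [bipLang.Structure N]

lemma IsBip.of_elementary (h : IsBip M) (f : M ↪ₑ[bipLang] N) : IsBip N := by
  let P : ∀ (M : Type) [bipLang.Structure M], (((Empty ⊕ Fin 2) ⊕ Empty) ⊕ Empty → M) → Prop :=
    fun M _ v => (inc (v (.inl (.inl (.inr 0)))) (v (.inl (.inl (.inr 1)))) →
      inc (v (.inl (.inl (.inr 1)))) (v (.inl (.inl (.inr 0)))) ∧
      v (.inl (.inl (.inr 0))) ≠ v (.inl (.inl (.inr 1)))) ∧
      (lin (v (.inl (.inl (.inr 0)))) ↔ ¬ col (v (.inl (.inl (.inr 0)))))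
  have hP : Inv P := by
    intro M N _ _ v w h
    simp only [P, h.eq_iff, h.inc_iff, h.lin_iff, h.col_iff, Ne, imp_self]
  have := (transfer hP f (Empty.elim : Empty → M)).1 fun B => ⟨Empty.elim, fun D =>
    ⟨fun h' => ⟨h.symm _ _ h', h.ne _ _ h'⟩, h.lin_iff _⟩⟩
  have key : ∀ x y : N, (inc x y → inc y x ∧ x ≠ y) ∧ (lin x ↔ ¬ col x) := by
    intro x y
    obtain ⟨g, hg⟩ := this ![x, y]
    exact hg Empty.elim
  exact ⟨fun x y h => ((key x y).1 h).1, fun x y h => ((key x y).1 h).2, fun x => (key x x).2⟩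

/-- The structure is an open generalized `n`-gon. -/
def IsGon (n : ℕ) (M : Type) [bipLang.Structure M] : Prop := IsPoly n (gr M) (col (M := M))

lemma exists_cycle_map {V V' : Type*} {G : SimpleGraph V} {G' : SimpleGraph V'} {e : V → V'}
    {x : V} (w : G.Walk x x) (hw : w.IsCycle) (he : PIso G G' e {v | v ∈ w.support}) :
    ∃ w' : G'.Walk (e x) (e x), w'.IsCycle ∧ w'.length = w.length := by
  let φ : G.induce {v | v ∈ w.support} →g G' :=
    ⟨fun v => e v.1, fun {a b} h => (he.adj a.1 a.2 b.1 b.2).2 h⟩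
  let w₁ := w.induce {v | v ∈ w.support} (fun _ h => h)
  have h1 : w₁.map (SimpleGraph.Embedding.induce _).toHom = w := Walk.map_induce _ _
  have h2 : w₁.IsCycle := by
    rw [← h1] at hw
    exact hw.of_map
  refine ⟨w₁.map φ, ?_, ?_⟩
  · exact h2.map fun a b hab => Subtype.ext (he.inj a.2 b.2 hab)
  · have := congrArg Walk.length h1
    rw [Walk.length_map] at this
    exact (Walk.length_map _ _).trans this

/-- A failure of bipartiteness, girth or openness is a finite configuration and could be copied into
`M`. Connectedness within `n - 1` steps is a `∀∃` statement with boundedly many variables and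
transfers upwards. -/
lemma IsGon.of_elementary [Nonempty M] (h : IsGon n M) (f : M ↪ₑ[bipLang] N) : IsGon n N := by
  have hn := h.three_le
  refine ⟨hn, ?_, ?_, ?_, ?_⟩
  · intro x y hxy
    obtain ⟨e, -, he, hc⟩ := exists_copy f (A := ∅) finite_empty (X := {x, y}) (toFinite _) (by simp)
    rw [← hc x (by simp), ← hc y (by simp)]
    exact h.bip _ _ ((he.adj _ (by simp) _ (by simp)).2 hxy)
  · intro x w hw
    obtain ⟨e, -, he, -⟩ := exists_copy f (A := ∅) finite_empty (X := {v | v ∈ w.support})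
      (List.finite_toSet w.support) (by simp)
    obtain ⟨w', h1, h2⟩ := exists_cycle_map w hw he
    rw [← h2]
    exact h.girth _ w' h1
  · let P : ∀ (M : Type) [bipLang.Structure M],
        (((Empty ⊕ Fin 2) ⊕ Fin (n + 1)) ⊕ Empty → M) → Prop :=
      fun M _ v => ((col (v (.inl (.inl (.inr 0)))) ↔ col (v (.inl (.inl (.inr 1))))) ↔
        Even (n - 1)) → ∃ l ≤ n - 1, v (.inl (.inr 0)) = v (.inl (.inl (.inr 0))) ∧
          v (.inl (.inr (Fin.ofNat (n + 1) l))) = v (.inl (.inl (.inr 1))) ∧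
          ∀ i < l, (gr M).Adj (v (.inl (.inr (Fin.ofNat (n + 1) i))))
            (v (.inl (.inr (Fin.ofNat (n + 1) (i + 1)))))
    have hP : Inv P := by
      intro M N _ _ v w h
      simp only [P, gr, SimpleGraph.fromRel_adj, h.eq_iff, h.inc_iff, h.col_iff, Ne, imp_self]
    have := (transfer hP f (Empty.elim : Empty → M)).1 (by
      intro B
      by_cases hpar : (col (B 0) ↔ col (B 1)) ↔ Even (n - 1)
      · obtain ⟨w, hw⟩ := h.conn _ _ hpar
        refine ⟨fun i => w.getVert i.1, fun _ _ => ⟨w.length, hw, ?_, ?_, fun i hi => ?_⟩⟩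
        · simp
        · simp [Nat.mod_eq_of_lt (show w.length < n + 1 by omega)]
        · simp only [Sum.elim_inl, Sum.elim_inr, Fin.ofNat]
          rw [Nat.mod_eq_of_lt (show i < n + 1 by omega),
            Nat.mod_eq_of_lt (show i + 1 < n + 1 by omega)]
          exact w.adj_getVert_succ hi
      · exact ⟨fun _ => B 0, fun _ h => absurd h hpar⟩)
    intro x y hpar
    obtain ⟨g, hg⟩ := this ![x, y]
    obtain ⟨l, hl, h0, h1, h2⟩ := hg Empty.elim hpar
    obtain ⟨w, hw, -⟩ := exists_walk_of_path (G := gr N) (fun i => g (Fin.ofNat (n + 1) i)) 0 l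
      (Nat.zero_le _) (fun k _ hk => h2 k hk)
    have h0' : g (Fin.ofNat (n + 1) 0) = x := h0
    have h1' : g (Fin.ofNat (n + 1) l) = y := h1
    refine ⟨w.copy h0' h1', ?_⟩
    rw [Walk.length_copy]
    omega
  · intro C hC hne _
    rw [empty_union]
    obtain ⟨e, -, he, -⟩ := exists_copy f (A := ∅) finite_empty hC (by simp)
    rw [← he.free_image hn subset_rfl]
    have := h.isOpen (e '' C) (hC.image e) (hne.image e) (empty_disjoint _)
    rwa [empty_union] at this

/-- An open polygon is strong in each elementary extension. -/
lemma IsGon.strong_range [Nonempty M] (h : IsGon n M) (f : M ↪ₑ[bipLang] N) :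
    Strong n (gr N) (range f) := by
  classical
  have hn := h.three_le
  intro D hD hne hdis
  by_contra hfree
  obtain ⟨B, hBA, hB, hBfree, hBadj⟩ := exists_finite_not_free hD hfree
  obtain ⟨B₀, rfl⟩ : ∃ B₀ : Set M, B = f '' B₀ := ⟨f ⁻¹' B, (image_preimage_eq_of_subset hBA).symm⟩
  have hB₀ : B₀.Finite := hB.of_finite_image f.injective.injOn
  -- A copy made over `B₀ ∪ F` avoids `F`, because `D` is disjoint from the image of `M`; so copies
  -- in `M` can be chosen away from any finite set.
  refine h.isOpen.no_copies hn hB₀ fun F hF => ?_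
  obtain ⟨e, he1, he2, -⟩ := exists_copy f (hB₀.union hF) (((hB₀.union hF).image f).union hD)
    subset_union_left
  have havoid : ∀ a ∈ B₀ ∪ F, ∀ d ∈ D, e d ≠ a := by
    intro a ha d hd hda
    have := he2.inj (Or.inr hd) (Or.inl ⟨a, ha, rfl⟩) (hda.trans (he1 a ha).symm)
    exact Set.disjoint_left.1 hdis ⟨a, rfl⟩ (this ▸ hd)
  have himg : e '' (f '' B₀ ∪ D) = B₀ ∪ e '' D := by
    rw [image_union, image_image]
    congr 1
    ext x
    constructor
    · rintro ⟨a, ha, rfl⟩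
      simpa [he1 a (Or.inl ha)] using ha
    · intro hx
      exact ⟨x, hx, he1 x (Or.inl hx)⟩
  have hsub : f '' B₀ ∪ D ⊆ f '' (B₀ ∪ F) ∪ D :=
    union_subset_union_left _ (image_mono subset_union_left)
  refine ⟨e '' D, hD.image e, hne.image e, ?_, ?_, ?_, ?_⟩
  · rw [Set.disjoint_left]
    rintro a ha ⟨d, hd, hda⟩
    exact havoid a (Or.inr ha) d hd hda
  · rw [Set.disjoint_left]
    rintro a ha ⟨d, hd, hda⟩
    exact havoid a (Or.inl ha) d hd hda
  · rw [← himg, (he2.mono hsub).free_image hn subset_union_right]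
    exact hBfree
  · intro b hb
    obtain ⟨d, hd, ha⟩ := hBadj (f b) ⟨b, hb, rfl⟩
    refine ⟨e d, ⟨d, hd, rfl⟩, ?_⟩
    rw [← he1 b (Or.inl hb)]
    exact (he2.adj _ (Or.inl ⟨b, Or.inl hb, rfl⟩) _ (Or.inr hd)).2 ha

lemma map_inc (f : M ↪[bipLang] N) (x y : M) : inc (f x) (f y) ↔ inc x y := by
  have := f.map_rel (BipRel.inc : bipLang.Relations 2) ![x, y]
  rw [relMap_inc, relMap_inc] at this
  exact this

lemma map_col (f : M ↪[bipLang] N) (x : M) : col (f x) ↔ col x := by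
  have := f.map_rel (BipRel.point : bipLang.Relations 1) ![x]
  rw [relMap_point, relMap_point] at this
  exact this

lemma map_adj (f : M ↪[bipLang] N) (x y : M) : (gr N).Adj (f x) (f y) ↔ (gr M).Adj x y := by
  rw [gr, gr, SimpleGraph.fromRel_adj, SimpleGraph.fromRel_adj, map_inc, map_inc, Ne, Ne,
    f.injective.eq_iff]

lemma map_pIso (f : M ↪[bipLang] N) (X : Set M) : PIso (gr M) (gr N) f X :=
  ⟨f.injective.injOn, fun x _ y _ => map_adj f x y⟩

end ElementaryExtensions

/-! ### Ultraproducts through representatives of their elements. -/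

section Ultraproducts

/-- An ultraproduct `P` of the structures `K a`, with representatives of its elements. -/
structure UltraRep {α : Type} (U : Ultrafilter α) (K : α → Type) [∀ a, bipLang.Structure (K a)]
    (P : Type) [bipLang.Structure P] where
  rep : P → ∀ a, K a
  lim : (∀ a, K a) → P
  rep_lim : ∀ v, ∀ᶠ a in (U : Filter α), rep (lim v) a = v a
  eq_iff : ∀ x y, x = y ↔ ∀ᶠ a in (U : Filter α), rep x a = rep y a
  inc_iff : ∀ x y, inc x y ↔ ∀ᶠ a in (U : Filter α), inc (rep x a) (rep y a)
  col_iff : ∀ x, col x ↔ ∀ᶠ a in (U : Filter α), col (rep x a)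

variable {α : Type} {U : Ultrafilter α} {K : α → Type} [∀ a, bipLang.Structure (K a)]
  {M P : Type} [bipLang.Structure M] [bipLang.Structure P]

/-- The ultraproduct of elementary extensions of `M` is an elementary extension of `M`. -/
lemma exists_ultraproduct [∀ a, Nonempty (K a)] (U : Ultrafilter α)
    (ι : ∀ a, M ↪ₑ[bipLang] K a) : ∃ (P : Type) (_ : bipLang.Structure P) (R : UltraRep U K P)
      (F : M ↪ₑ[bipLang] P), ∀ m, R.lim (fun a => ι a m) = F m := by
  let mk : (∀ a, K a) → (U : Filter α).Product K := fun v => (v : (U : Filter α).Product K)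
  let rep : (U : Filter α).Product K → ∀ a, K a := fun x => Quotient.out x
  have mk_rep : ∀ x, mk (rep x) = x := fun x => Quotient.out_eq x
  have real : ∀ {β : Type} (φ : bipLang.Formula β) (x : β → (U : Filter α).Product K),
      φ.Realize x ↔ ∀ᶠ a in (U : Filter α), φ.Realize fun i => rep (x i) a := by
    intro β φ x
    rw [← Ultraproduct.realize_formula_cast]
    have : x = fun i => mk (rep (x i)) := funext fun i => (mk_rep _).symm
    conv_lhs => rw [this]
    rfl
  refine ⟨(U : Filter α).Product K, inferInstance, ⟨rep, mk, fun v => ?_, fun x y => ?_,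
    fun x y => ?_, fun x => ?_⟩, ⟨fun m => mk fun a => ι a m, fun k φ x => ?_⟩, fun m => rfl⟩
  · exact Quotient.exact (mk_rep (mk v))
  · constructor
    · rintro rfl
      exact Filter.Eventually.of_forall fun _ => rfl
    · intro h
      rw [← mk_rep x, ← mk_rep y]
      exact Quotient.sound h
  · have := real (β := Fin 2) (Relations.formula₂ (L := bipLang) BipRel.inc (Term.var 0)
      (Term.var 1)) ![x, y]
    have e : ∀ {K : Type} [bipLang.Structure K] (u : Fin 2 → K),
      (Relations.formula₂ (L := bipLang) BipRel.inc (Term.var 0) (Term.var 1)).Realize u ↔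
        inc (u 0) (u 1) := fun u => Formula.realize_rel₂
    simpa only [e] using! this
  · have := real (β := Fin 1) (Relations.formula₁ (L := bipLang) BipRel.point (Term.var 0)) ![x]
    have e : ∀ {K : Type} [bipLang.Structure K] (u : Fin 1 → K),
      (Relations.formula₁ (L := bipLang) BipRel.point (Term.var 0)).Realize u ↔ col (u 0) :=
      fun u => Formula.realize_rel₁
    simpa only [e] using! this
  · refine (Ultraproduct.realize_formula_cast φ fun i a => ι a (x i)).trans ?_
    have : ∀ a, (φ.Realize fun i => ι a (x i)) ↔ φ.Realize x := fun a => (ι a).map_formula φ x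
    simp [this]

namespace UltraRep

lemma eventually_pIso (R : UltraRep U K P) {X : Set P} (hX : X.Finite) :
    ∀ᶠ a in (U : Filter α), PIso (gr P) (gr (K a)) (fun x => R.rep x a) X := by
  have h1 : ∀ x y, ∀ᶠ a in (U : Filter α), (R.rep x a = R.rep y a ↔ x = y) := by
    intro x y
    by_cases h : x = y
    · subst h
      simp
    · have := mt (R.eq_iff x y).2 h
      rw [← Ultrafilter.eventually_not] at this
      filter_upwards [this] with a ha
      exact iff_of_false ha h
  have h2 : ∀ x y, ∀ᶠ a in (U : Filter α), (inc (R.rep x a) (R.rep y a) ↔ inc x y) := by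
    intro x y
    by_cases h : inc x y
    · filter_upwards [(R.inc_iff x y).1 h] with a ha
      exact iff_of_true ha h
    · have := mt (R.inc_iff x y).2 h
      rw [← Ultrafilter.eventually_not] at this
      filter_upwards [this] with a ha
      exact iff_of_false ha h
  have h : ∀ᶠ a in (U : Filter α), ∀ x ∈ X, ∀ y ∈ X,
      (R.rep x a = R.rep y a ↔ x = y) ∧ (inc (R.rep x a) (R.rep y a) ↔ inc x y) := by
    rw [Filter.eventually_all_finite hX]
    intro x _
    rw [Filter.eventually_all_finite hX]
    intro y _
    exact (h1 x y).and (h2 x y)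
  filter_upwards [h] with a ha
  refine ⟨fun x hx y hy hxy => (ha x hx y hy).1.1 hxy, fun x hx y hy => ?_⟩
  rw [gr, gr, SimpleGraph.fromRel_adj, SimpleGraph.fromRel_adj, Ne, Ne, (ha x hx y hy).1,
    (ha x hx y hy).2, (ha y hy x hx).2]

lemma eventually_col (R : UltraRep U K P) (x : P) :
    ∀ᶠ a in (U : Filter α), (col (R.rep x a) ↔ col x) := by
  by_cases h : col x
  · filter_upwards [(R.col_iff x).1 h] with a ha
    exact iff_of_true ha h
  · have := mt (R.col_iff x).2 h
    rw [← Ultrafilter.eventually_not] at this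
    filter_upwards [this] with a ha
    exact iff_of_false ha h

end UltraRep

end Ultraproducts

/-! ### Generic vertices: approximations in the structure and realizations above it. -/

section Generic

/-- Over `B`, the vertex `g` has exactly the neighbours `E`, and no set is made closed by `g`
unless it is closed already. -/
def GoodFor {V : Type*} (n : ℕ) (G : SimpleGraph V) (E B : Set V) (g : V) (D : Set V) : Prop :=
  g ∉ B ∧ (∀ b ∈ B, (G.Adj g b ↔ b ∈ E)) ∧ ∀ B' : Set V, E ⊆ B' → B' ⊆ B → Disjoint B' D → g ∉ D →
    Free n G (B' ∪ D) D → Free n G (insert g B' ∪ D) D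

lemma PIso.goodFor {V V' : Type*} {G : SimpleGraph V} {G' : SimpleGraph V'} {n : ℕ} (hn : 3 ≤ n)
    {e : V → V'} {E B D : Set V} {g : V} (H : PIso G G' e (insert g B ∪ D)) (hEB : E ⊆ B)
    (h : GoodFor n G E B g D) : GoodFor n G' (e '' E) (e '' B) (e g) (e '' D) := by
  obtain ⟨h1, h2, h3⟩ := h
  have hg : g ∈ insert g B ∪ D := Or.inl (Or.inl rfl)
  have hB : ∀ b ∈ B, b ∈ insert g B ∪ D := fun b hb => Or.inl (Or.inr hb)
  refine ⟨?_, ?_, ?_⟩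
  · rintro ⟨b, hb, hbg⟩
    exact h1 (H.inj (hB b hb) hg hbg ▸ hb)
  · rintro _ ⟨b, hb, rfl⟩
    rw [H.adj _ hg _ (hB b hb), h2 b hb]
    constructor
    · exact fun hE => ⟨b, hE, rfl⟩
    · rintro ⟨b', hb', hbb⟩
      rwa [← H.inj (hB b' (hEB hb')) (hB b hb) hbb]
  · intro B'' hE hB'' hdis hgD hfree
    obtain ⟨B', hB', rfl⟩ : ∃ B' ⊆ B, B'' = e '' B' := by
      refine ⟨B ∩ e ⁻¹' B'', inter_subset_left, ?_⟩
      ext x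
      constructor
      · intro hx
        obtain ⟨b, hb, rfl⟩ := hB'' hx
        exact ⟨b, ⟨hb, hx⟩, rfl⟩
      · rintro ⟨b, hb, rfl⟩
        exact hb.2
    have hsub : B' ∪ D ⊆ insert g B ∪ D :=
      union_subset_union_left _ (hB'.trans (subset_insert _ _))
    have hsub' : insert g B' ∪ D ⊆ insert g B ∪ D :=
      union_subset_union_left _ (insert_subset_insert hB')
    rw [← image_union, (H.mono hsub).free_image hn subset_union_right] at hfree
    rw [← image_insert_eq, ← image_union, (H.mono hsub').free_image hn subset_union_right]
    refine h3 B' ?_ hB' ?_ ?_ hfree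
    · intro x hx
      obtain ⟨y, hy, hxy⟩ := hE ⟨x, hx, rfl⟩
      rwa [← H.inj (hB y (hB' hy)) (hB x (hEB hx)) hxy]
    · rw [Set.disjoint_left]
      exact fun x hx hxD => Set.disjoint_left.1 hdis ⟨x, hx, rfl⟩ ⟨x, hxD, rfl⟩
    · exact fun h => hgD ⟨g, h, rfl⟩

/-- There are arbitrarily generic vertices with neighbourhood `E`. -/
def Gen (n : ℕ) (M : Type) [bipLang.Structure M] (E : Set M) (τ : Prop) : Prop :=
  ∀ B : Set M, B.Finite → E ⊆ B → ∀ r : ℕ, ∃ g : M, (col g ↔ τ) ∧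
    ∀ D : Fin r → M, GoodFor n (gr M) E B g (range D)

/-- In some elementary extension there is a vertex with neighbourhood `E` that is free over the
given structure. -/
def GenExt (n : ℕ) (M : Type) [bipLang.Structure M] (E : Set M) (τ : Prop) : Prop :=
  ∃ (N : Type) (_ : bipLang.Structure N) (f : M ↪ₑ[bipLang] N) (g : N), g ∉ range f ∧
    (col g ↔ τ) ∧ (∀ m, (gr N).Adj g (f m) ↔ m ∈ E) ∧ Strong n (gr N) (insert g (range f))

variable {M N : Type} [bipLang.Structure M] [bipLang.Structure N] {n : ℕ}

lemma exists_range_eq {M : Type*} {D : Set M} (hD : D.Finite) (hne : D.Nonempty) {r : ℕ} (hr : D.ncard ≤ r) :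
    ∃ d : Fin r → M, range d = D := by
  have := hD.to_subtype
  have := hne.to_subtype
  obtain ⟨k, ⟨e⟩⟩ := Finite.exists_equiv_fin D
  have hk : D.ncard = k := by
    rw [← Nat.card_coe_set_eq, Nat.card_congr e, Nat.card_fin]
  let i : D → Fin r := fun x => Fin.castLE (hk ▸ hr) (e x)
  have hi : Function.Injective i := fun x y hxy => e.injective (Fin.castLE_injective _ hxy)
  refine ⟨fun j => (Function.invFun i j).1, ?_⟩
  ext x
  constructor
  · rintro ⟨j, rfl⟩
    exact (Function.invFun i j).2
  · intro hx
    exact ⟨i ⟨x, hx⟩, by simp [Function.leftInverse_invFun hi ⟨x, hx⟩]⟩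

/-- Genericity as a property of tuples. -/
def GenPat (n : ℕ) (τ : Prop) {κ δ : Type} (S : Set κ) (M : Type) [bipLang.Structure M]
    (v : (κ ⊕ Unit) ⊕ δ → M) : Prop :=
  (col (v (.inl (.inr ()))) ↔ τ) ∧ GoodFor n (gr M) ((fun k => v (.inl (.inl k))) '' S)
    (range fun k => v (.inl (.inl k))) (v (.inl (.inr ()))) (range fun d => v (.inr d))

lemma inv_genPat (hn : 3 ≤ n) (τ : Prop) {κ δ : Type} (S : Set κ) :
    Inv fun M _ (v : (κ ⊕ Unit) ⊕ δ → M) => GenPat n τ S M v := by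
  rintro M N _ _ v w h ⟨h1, h2⟩
  obtain ⟨e, he, H⟩ := h.exists_map
  refine ⟨(h.col_iff _).symm.trans h1, ?_⟩
  have := PIso.goodFor hn (H.mono ?_) (image_subset_range _ _) h2
  · rw [image_image, ← range_comp, ← range_comp] at this
    simpa only [Function.comp_def, he] using this
  · rintro x ((rfl | ⟨k, rfl⟩) | ⟨d, rfl⟩)
    · exact ⟨_, rfl⟩
    · exact ⟨_, rfl⟩
    · exact ⟨_, rfl⟩

/-- For fixed sizes of `B` and of the test sets, genericity is a `∀∃∀` statement with parameters
`E`, so an elementary embedding carries it over. This is why `r` bounds the size of `D`. -/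
lemma Gen.map (hn : 3 ≤ n) {E : Set M} (hE : E.Finite) {τ : Prop} (h : Gen n M E τ)
    (f : M ↪ₑ[bipLang] N) : Gen n N (f '' E) τ := by
  intro B hB hEB r
  have := hE.to_subtype
  have := hB.to_subtype
  obtain ⟨g, hg⟩ := (transfer (κ := E) (β := B) (γ := Unit) (δ := Fin r)
    (inv_genPat hn τ (κ := E ⊕ B) {x | x.isLeft}) f Subtype.val).1 (by
      intro b
      obtain ⟨g, hg, hg'⟩ := h (E ∪ range b) (hE.union (finite_range b)) subset_union_left r
      refine ⟨fun _ => g, fun D => ⟨hg, ?_⟩⟩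
      convert hg' D using 1
      · ext x
        simp
      · ext x
        simp
      · rfl
      · rfl) Subtype.val
  refine ⟨g (), (hg fun _ => g ()).1, fun D => ?_⟩
  convert (hg D).2 using 1
  · ext x
    simp
  · ext x
    simp only [mem_range, Sum.exists, Sum.elim_inl, Sum.elim_inr, Function.comp_apply,
      Subtype.exists, exists_prop, exists_eq_right]
    constructor
    · exact Or.inr
    · rintro (⟨a, ha, rfl⟩ | hx)
      · exact hEB ⟨a, ha, rfl⟩
      · exact hx
  · rfl
  · rfl

/-- The vertex `g` of the extension witnesses the required statement there, and elementarity brings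
a witness down. -/
lemma GenExt.gen (hn : 3 ≤ n) {E : Set M} {τ : Prop} (h : GenExt n M E τ) : Gen n M E τ := by
  obtain ⟨N, _, f, g, hg, hτ, hadj, hstr⟩ := h
  intro B hB hEB r
  have := hB.to_subtype
  obtain ⟨g', hg'⟩ := (transfer (κ := B) (β := Empty) (γ := Unit) (δ := Fin r)
    (inv_genPat hn τ (κ := B ⊕ Empty) {x | ∃ y : B, x = .inl y ∧ y.1 ∈ E}) f Subtype.val).2 (by
      intro b
      refine ⟨fun _ => g, fun D => ⟨hτ, ?_⟩⟩
      have e1 : ((fun k => Sum.elim (Sum.elim (Sum.elim (f ∘ Subtype.val) b) fun _ : Unit => g) D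
          (.inl (.inl k))) '' {x : B ⊕ Empty | ∃ y : B, x = .inl y ∧ y.1 ∈ E}) = f '' E := by
        ext x
        constructor
        · rintro ⟨_, ⟨y, rfl, hy⟩, rfl⟩
          exact ⟨y, hy, rfl⟩
        · rintro ⟨y, hy, rfl⟩
          exact ⟨_, ⟨⟨y, hEB hy⟩, rfl, hy⟩, rfl⟩
      have e2 : (range fun k : B ⊕ Empty => Sum.elim (Sum.elim (Sum.elim (f ∘ Subtype.val) b)
          fun _ : Unit => g) D (.inl (.inl k))) = f '' B := by
        ext x
        constructor
        · rintro ⟨y | y, rfl⟩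
          · exact ⟨y, y.2, rfl⟩
          · exact y.elim
        · rintro ⟨y, hy, rfl⟩
          exact ⟨.inl ⟨y, hy⟩, rfl⟩
      rw [e1, e2]
      simp only [Sum.elim_inl, Sum.elim_inr]
      refine ⟨?_, ?_, ?_⟩
      · rintro ⟨b, -, hb⟩
        exact hg ⟨b, hb⟩
      · rintro _ ⟨b, -, rfl⟩
        rw [hadj, f.injective.mem_set_image]
      · intro B' hE hB' hdis hgD hfree
        by_contra hcl
        have hB'' : insert g B' ⊆ insert g (range f) :=
          insert_subset_insert (hB'.trans (image_subset_range _ _))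
        -- A set closed with `g` lies in `f(M) ∪ {g}`. As it contains neither `g` nor vertices of
        -- `E`, it is not joined to `g`, so `g` cannot have closed it.
        have hsub := hstr.subset_of_not_free hB'' (finite_range D) hcl
        refine hcl (hfree.extend ?_)
        rintro v hv x ((rfl | hx) | hx) hvx
        · rcases hsub hv with rfl | ⟨m, rfl⟩
          · exact absurd hv hgD
          · have := (hadj m).1 hvx.symm
            exact absurd hv (Set.disjoint_left.1 hdis (hE ⟨m, this, rfl⟩))
        · exact Or.inl hx
        · exact Or.inr hx) Empty.elim
  refine ⟨g' (), (hg' fun _ => g' ()).1, fun D => ?_⟩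
  convert (hg' D).2 using 1
  · ext x
    constructor
    · exact fun hx => ⟨_, ⟨⟨x, hEB hx⟩, rfl, hx⟩, rfl⟩
    · rintro ⟨_, ⟨y, rfl, hy⟩, rfl⟩
      exact hy
  · ext x
    simp
  · rfl
  · rfl

/-- The vertex is the class, in an ultrapower, of better and better approximations. A set closed
over it and `M` is closed over it and finitely many elements, but free over these elements alone by
`IsGon.strong_range`; at a suitable index this contradicts the goodness of the approximation. -/
lemma Gen.genExt [Nonempty M] (hM : IsGon n M) {E : Set M} (hE : E.Finite) {τ : Prop}
    (h : Gen n M E τ) : GenExt n M E τ := by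
  classical
  have hn := hM.three_le
  have h' : ∀ a : Finset M × ℕ, ∃ g : M, (col g ↔ τ) ∧
      ∀ D : Fin a.2 → M, GoodFor n (gr M) E (E ∪ a.1) g (range D) := fun a =>
    h (E ∪ a.1) (hE.union a.1.finite_toSet) subset_union_left a.2
  choose g hg hgood using h'
  -- Refining `atTop` makes the index eventually contain any given finite set and exceed any given
  -- size.
  let U : Ultrafilter (Finset M × ℕ) := Ultrafilter.of Filter.atTop
  have hU : ∀ b : Finset M × ℕ, ∀ᶠ a in (U : Filter (Finset M × ℕ)), b ≤ a := fun b =>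
    Ultrafilter.of_le _ (Filter.eventually_ge_atTop b)
  obtain ⟨N, _, R, f, hf⟩ := exists_ultraproduct U fun _ => ElementaryEmbedding.refl bipLang M
  have repf : ∀ m, ∀ᶠ a in (U : Filter (Finset M × ℕ)), R.rep (f m) a = m := fun m =>
    hf m ▸ R.rep_lim _
  have repg := R.rep_lim g
  have good : ∀ a (D : Set M), D.Finite → D.Nonempty → D.ncard ≤ a.2 →
      GoodFor n (gr M) E (E ∪ a.1) (g a) D := by
    intro a D hD hne hr
    obtain ⟨d, rfl⟩ := exists_range_eq hD hne hr
    exact hgood a d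
  have good0 : ∀ m, ∀ᶠ a in (U : Filter (Finset M × ℕ)), m ≠ g a ∧ ((gr M).Adj (g a) m ↔ m ∈ E) := by
    intro m
    filter_upwards [hU ({m}, 1)] with a ha
    have hm : m ∈ E ∪ a.1 := Or.inr (by simpa using ha.1)
    have := good a {m} (finite_singleton m) (singleton_nonempty m) (by simpa using ha.2)
    exact ⟨fun h => this.1 (h ▸ hm), this.2.1 m hm⟩
  have hgf : R.lim g ∉ range f := by
    rintro ⟨m, hm⟩
    obtain ⟨a, h1, h2, h3⟩ := ((repf m).and (repg.and (good0 m))).exists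
    exact h3.1 (h1.symm.trans (hm ▸ h2))
  refine ⟨N, inferInstance, f, R.lim g, hgf, ?_, fun m => ?_, ?_⟩
  · obtain ⟨a, h1, h2⟩ := (repg.and (R.eventually_col (R.lim g))).exists
    rw [← h2, h1, hg]
  · obtain ⟨a, h1, h2, h3, h4⟩ := ((repf m).and (repg.and ((good0 m).and
      (R.eventually_pIso (toFinite {R.lim g, f m}))))).exists
    rw [← h4.adj _ (by simp) _ (by simp), h1, h2, h3.2]
  · intro D hD hne hdis
    by_contra hcl
    obtain ⟨B₀, hB₀, hB₀fin, hcl, -⟩ := exists_finite_not_free hD hcl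
    let B₁ : Set M := E ∪ f ⁻¹' B₀
    have hB₁ : B₁.Finite := hE.union (hB₀fin.preimage f.injective.injOn)
    have hcl' : ¬ Free n (gr N) (insert (R.lim g) (f '' B₁) ∪ D) D := by
      refine fun h => hcl (h.mono (union_subset_union_left _ ?_) subset_rfl)
      intro x hx
      rcases hB₀ hx with rfl | ⟨m, rfl⟩
      · exact Or.inl rfl
      · exact Or.inr ⟨m, Or.inr hx, rfl⟩
    have hgD : R.lim g ∉ D := fun h => Set.disjoint_left.1 hdis (mem_insert _ _) h
    have hX : (insert (R.lim g) (f '' B₁) ∪ D).Finite := ((hB₁.image f).insert _).union hD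
    have hall : ∀ᶠ a in (U : Filter (Finset M × ℕ)), ∀ m ∈ B₁, R.rep (f m) a = m := by
      rw [Filter.eventually_all_finite hB₁]
      exact fun m _ => repf m
    obtain ⟨a, h1, h2, h3, h4⟩ := (hall.and (repg.and ((R.eventually_pIso hX).and
      (hU (hB₁.toFinset, D.ncard))))).exists
    have h4' : D.ncard ≤ a.2 := h4.2
    have hgo := good a ((fun x => R.rep x a) '' D) (hD.image _) (hne.image _)
      ((ncard_image_le hD).trans h4')
    have himg : (fun x => R.rep x a) '' (f '' B₁) = B₁ := by
      rw [image_image]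
      ext x
      constructor
      · rintro ⟨m, hm, rfl⟩
        simpa only [h1 m hm] using hm
      · exact fun hx => ⟨x, hx, h1 x hx⟩
    have hB₁D : Disjoint (f '' B₁) D := hdis.mono_left
      ((image_subset_range _ _).trans (subset_insert _ _))
    have key := hgo.2.2 B₁ subset_union_left ?_ ?_ ?_
    · rw [← himg, ← image_union, (h3.mono (union_subset_union_left _
        (subset_insert _ _))).free_image hn subset_union_right, ← h2,
        ← image_insert_eq (f := fun x => R.rep x a), ← image_union,
        h3.free_image hn subset_union_right] at key
      refine hcl' (key ?_)
      refine (hM.strong_range f D hD hne (hdis.mono_left (subset_insert _ _))).mono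
        (union_subset_union_left _ (image_subset_range _ _)) subset_rfl
    · intro x hx
      refine Or.inr ?_
      have : x ∈ hB₁.toFinset := hB₁.mem_toFinset.2 hx
      exact h4.1 this
    · rw [← himg]
      rw [Set.disjoint_left]
      rintro _ ⟨x, hx, rfl⟩ ⟨d, hd, hdx⟩
      have := h3.inj (Or.inr hd) (Or.inl (Or.inr hx)) hdx
      exact Set.disjoint_left.1 hB₁D hx (this ▸ hd)
    · rw [← h2]
      rintro ⟨d, hd, hdx⟩
      exact hgD (h3.inj (Or.inr hd) (Or.inl (Or.inl rfl)) hdx ▸ hd)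

end Generic

/-! ### Removing arcs, and passing from one end of an arc to the other. -/

section Perspectivities

variable {V V' : Type*} {G : SimpleGraph V} {G' : SimpleGraph V'} {n : ℕ}

/-- Removing the interior of a clean arc from a strong set leaves a strong set. -/
lemma Strong.of_arc {S : Set V} {q : ℕ → V} (hinj : InjOn q (Icc 1 (n - 2)))
    (hadj : ∀ i, 1 ≤ i → i + 1 ≤ n - 2 → G.Adj (q i) (q (i + 1)))
    (hout : ∀ i ∈ Icc 1 (n - 2), q i ∉ S)
    (hclean : ∀ i ∈ Icc 1 (n - 2), ∀ x ∈ S ∪ inner n q, G.Adj (q i) x → x = q (i - 1) ∨ x = q (i + 1))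
    (hS : Strong n G (S ∪ inner n q)) : Strong n G S := by
  refine hS.of_subset subset_union_left fun C _ hne hdis hC => ?_
  have hCi : C ⊆ inner n q := fun x hx => (hC hx).resolve_left fun h => Set.disjoint_left.1 hdis h hx
  have hX : S ∪ C ⊆ S ∪ inner n q := union_subset_union_right _ hCi
  by_cases hall : inner n q ⊆ C
  · refine Or.inr ⟨q, hinj, fun i hi => ⟨hall ⟨i, hi, rfl⟩, fun x hx y hy z hz ax ay az => ?_⟩, hadj⟩
    rcases hclean i hi x (hX hx) ax with rfl | rfl <;> rcases hclean i hi y (hX hy) ay with rfl | rfl <;>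
      rcases hclean i hi z (hX hz) az with rfl | rfl <;> simp
  · by_contra hfree
    -- If `C` misses part of the arc, a vertex of `C` next to a missing one is loose. Without loose
    -- vertices membership in `C` spreads along the whole arc.
    have step : ∀ k ∈ Icc 1 (n - 2), q k ∈ C →
        (k + 1 ≤ n - 2 → q (k + 1) ∈ C) ∧ (1 ≤ k - 1 → q (k - 1) ∈ C) := by
      intro k hk hkC
      have hnl : ¬ Loose G (S ∪ C) (q k) := fun h => hfree (Or.inl ⟨_, hkC, h⟩)
      constructor
      · intro hk1
        by_contra hout'
        refine hnl fun x hx y hy ax ay => ?_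
        have h : ∀ x ∈ S ∪ C, G.Adj (q k) x → x = q (k - 1) := by
          intro x hx ax
          refine (hclean k hk x (hX hx) ax).resolve_right ?_
          rintro rfl
          exact hx.elim (hout (k + 1) ⟨by omega, hk1⟩) hout'
        rw [h x hx ax, h y hy ay]
      · intro hk1
        by_contra hout'
        refine hnl fun x hx y hy ax ay => ?_
        have h : ∀ x ∈ S ∪ C, G.Adj (q k) x → x = q (k + 1) := by
          intro x hx ax
          refine (hclean k hk x (hX hx) ax).resolve_left ?_
          rintro rfl
          exact hx.elim (hout (k - 1) ⟨hk1, (Nat.sub_le _ _).trans hk.2⟩) hout'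
        rw [h x hx ax, h y hy ay]
    obtain ⟨x, hx⟩ := hne
    obtain ⟨k, hk, rfl⟩ := hCi hx
    have up : ∀ d, k + d ≤ n - 2 → q (k + d) ∈ C := by
      intro d
      induction d with
      | zero => exact fun _ => hx
      | succ d ih =>
        intro hd
        exact (step (k + d) ⟨by have := hk.1; omega, by omega⟩ (ih (by omega))).1 (by omega)
    have down : ∀ d, 1 ≤ k - d → q (k - d) ∈ C := by
      intro d
      induction d with
      | zero => exact fun _ => hx
      | succ d ih =>
        intro hd
        have hk2 := hk.2
        have := (step (k - d) ⟨by omega, by omega⟩ (ih (by omega))).2 (by omega)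
        rwa [show k - (d + 1) = k - d - 1 by omega]
    refine hall ?_
    rintro _ ⟨j, hj, rfl⟩
    have hj1 := hj.1
    rcases le_total k j with h | h
    · simpa [h] using up (j - k) (by have := hj.2; omega)
    · have := down (k - j) (by omega)
      rwa [show k - (k - j) = j by omega] at this

/-- Since `g` has at most one neighbour in `S`, the vertices `g, p 1, …, p (n - 3)` are themselves
the interior of a path clean over `S ∪ {p (n - 2)}`. Removing them trades the vertex `g` for `p (n -
2)`. -/
lemma strong_insert_last (hn : 3 ≤ n) {S : Set V} {g : V} (hg : g ∉ S)
    (hnb : ∀ x ∈ S, ∀ y ∈ S, G.Adj g x → G.Adj g y → x = y) {p : ℕ → V}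
    (hp : CleanArc n G (insert g S) p) (h0 : p 0 = g)
    (hS : Strong n G (insert g S ∪ inner n p)) :
    p (n - 2) ∉ S ∧ (∀ x ∈ S, (G.Adj (p (n - 2)) x ↔ x = p (n - 1))) ∧
      Strong n G (insert (p (n - 2)) S) := by
  classical
  have hlast : n - 2 ∈ Icc 1 (n - 2) := ⟨by omega, le_rfl⟩
  have e1 : n - 2 + 1 = n - 1 := by omega
  have e3 : n - 2 - 1 = n - 3 := by omega
  have hwS : ∀ i ≤ n - 2, p i ∉ S := by
    intro i hi
    rcases Nat.eq_zero_or_pos i with rfl | hi0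
    · rwa [h0]
    · exact fun h => hp.out i ⟨hi0, hi⟩ (Or.inr h)
  refine ⟨hwS _ le_rfl, fun x hx => ⟨fun ax => ?_, ?_⟩, ?_⟩
  · have := hp.clean _ hlast x (Or.inl (Or.inr hx)) ax
    rw [e1, e3] at this
    refine this.resolve_left ?_
    rintro rfl
    exact hwS (n - 3) (by omega) hx
  · rintro rfl
    have := hp.adj (n - 2) (by omega)
    rwa [e1] at this
  · let q : ℕ → V := fun i => if i = 0 then
      (if h : ∃ x ∈ S, G.Adj g x then h.choose else g) else p (i - 1)
    have hq : ∀ i, i ≠ 0 → q i = p (i - 1) := fun i hi => if_neg hi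
    have hq0 : ∀ x ∈ S, G.Adj g x → x = q 0 := by
      intro x hx ax
      have h : ∃ x ∈ S, G.Adj g x := ⟨x, hx, ax⟩
      have : q 0 = h.choose := (if_pos rfl).trans (dif_pos h)
      rw [this]
      exact hnb x hx _ h.choose_spec.1 ax h.choose_spec.2
    have hset : insert (p (n - 2)) S ∪ inner n q = insert g S ∪ inner n p := by
      ext x
      constructor
      · rintro ((rfl | hx) | ⟨i, hi, rfl⟩)
        · exact hp.mem (by omega)
        · exact Or.inl (Or.inr hx)
        · rw [hq i (by have := hi.1; omega)]
          exact hp.mem (by have := hi.2; omega)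
      · rintro ((rfl | hx) | ⟨i, hi, rfl⟩)
        · exact Or.inr ⟨1, ⟨le_rfl, by omega⟩, by rw [hq 1 one_ne_zero, ← h0]⟩
        · exact Or.inl (Or.inr hx)
        · by_cases h : i = n - 2
          · exact Or.inl (Or.inl (h ▸ rfl))
          · exact Or.inr ⟨i + 1, ⟨by omega, by have := hi.2; omega⟩, hq (i + 1) (by omega)⟩
    refine Strong.of_arc (q := q) ?_ ?_ ?_ ?_ (hset ▸ hS)
    · intro i hi j hj hij
      obtain ⟨hi1, hi2⟩ := hi
      obtain ⟨hj1, hj2⟩ := hj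
      rw [hq i (by omega), hq j (by omega)] at hij
      have := hp.inj _ (by omega) _ (by omega) hij
      omega
    · intro i hi hi'
      rw [hq i (by omega), hq (i + 1) (by omega)]
      have := hp.adj (i - 1) (by omega)
      rwa [show i - 1 + 1 = i + 1 - 1 by omega] at this
    · rintro i ⟨hi1, hi2⟩ h
      rw [hq i (by omega)] at h
      rcases h with h | h
      · have := hp.inj _ (by omega) _ (by omega) h
        omega
      · exact hwS _ (by omega) h
    · rintro i ⟨hi1, hi2⟩ x hx ax
      rw [hset] at hx
      rw [hq i (by omega)] at ax
      rw [hq (i + 1) (by omega), Nat.add_sub_cancel]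
      by_cases hi : i = 1
      · subst hi
        rw [Nat.sub_self] at ax ⊢
        rw [h0] at ax
        rcases hx with (rfl | hx) | ⟨k, hk, rfl⟩
        · exact absurd ax G.irrefl
        · exact Or.inl (hq0 x hx ax)
        · have := hp.clean k hk g (Or.inl (Or.inl rfl)) ax.symm
          obtain ⟨hk1, hk2⟩ := hk
          rw [← h0] at this
          right
          rcases this with h | h
          · have := hp.inj _ (by omega) _ (by omega) h
            rw [show k = 1 by omega]
          · have := hp.inj _ (by omega) _ (by omega) h
            omega
      · have := hp.clean (i - 1) ⟨by omega, by omega⟩ x hx ax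
        rw [show i - 1 + 1 = i by omega] at this
        rwa [hq (i - 1) (by omega)]

lemma PIso.exists_walk {h : V → V'} {X : Set V} (H : PIso G G' h X) {a' b' : V'}
    (w : G'.Walk a' b') (hw : ∀ x ∈ w.support, x ∈ h '' X) {a b : V} (ha : a ∈ X) (hb : b ∈ X)
    (haa : h a = a') (hbb : h b = b') :
    ∃ u : G.Walk a b, u.length = w.length ∧ ∀ x ∈ u.support, x ∈ X := by
  induction w generalizing a with
  | nil =>
    have := H.inj ha hb (haa.trans hbb.symm)
    subst this
    exact ⟨.nil, rfl, by simpa using ha⟩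
  | @cons a' c' b' hac w ih =>
    obtain ⟨c, hc, rfl⟩ := hw c' (by simp)
    obtain ⟨u, hu, hu'⟩ := ih (fun x hx => hw x (by simp [hx])) hc rfl hbb
    refine ⟨.cons ((H.adj a ha c hc).1 (haa ▸ hac)) u, by simp [hu], ?_⟩
    intro x hx
    rw [Walk.support_cons, List.mem_cons] at hx
    rcases hx with rfl | hx
    · exact ha
    · exact hu' x hx

end Perspectivities

/-! ### Rich polygons realize finite strong extensions. -/

section Rich

variable {M N : Type} [bipLang.Structure M] [bipLang.Structure N] {n : ℕ}

/-- A generic vertex over `E` is joined by an arc to each vertex `x` at distance at least `n - 1`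
from `E`, and the neighbour of `x` on this arc is generic over `x`. -/
lemma Gen.single [Nonempty M] (hM : IsGon n M) {E : Set M} (hE : E.Subsingleton) {τ : Prop}
    (h : Gen n M E τ) {x : M} (hpar : (τ ↔ col x) ↔ Even (n - 1))
    (hfar : ∀ c ∈ E, ∀ w : (gr M).Walk c x, n - 1 ≤ w.length) : Gen n M {x} (¬ col x) := by
  classical
  have hn := hM.three_le
  obtain ⟨N, _, f, g, hg, hτ, hadj, hstr⟩ := h.genExt hM hE.finite
  have hN : IsGon n N := hM.of_elementary f
  have hcol : col (f x) ↔ col x := map_col f.toEmbedding x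
  obtain ⟨p, h0, h1, hp, hS⟩ := hN.exists_cleanArc hstr (a := g) (b := f x) (Or.inl rfl)
    (Or.inr ⟨x, rfl⟩) (by rw [hτ, hcol]; exact hpar) (by
      -- A simple walk from `g` never returns to `g`, so its first step goes to some `c ∈ E` and the
      -- rest runs inside `M` from `c` to `x`, with length at least `n - 1`.
      intro w hw
      refine le_trans ?_ w.length_bypass_le_length
      have hw' : ∀ y ∈ w.bypass.support, y ∈ insert g (range f) := fun y hy =>
        hw y (w.support_bypass_subset_support hy)
      have hpath := w.bypass_isPath
      generalize w.bypass = u at hw' hpath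
      cases u with
      | nil => exact absurd ⟨x, rfl⟩ hg
      | @cons _ y _ hgy u =>
        obtain ⟨hu, hgu⟩ := (Walk.cons_isPath_iff _ _).1 hpath
        have hsup : ∀ z ∈ u.support, z ∈ f '' univ := by
          intro z hz
          rcases hw' z (by simp [hz]) with rfl | hz'
          · exact absurd hz hgu
          · rwa [image_univ]
        obtain ⟨c, -, rfl⟩ := hsup y (by simp)
        obtain ⟨u', hu', -⟩ := (map_pIso f.toEmbedding univ).exists_walk u hsup (mem_univ c)
          (mem_univ x) rfl rfl
        have := hfar c ((hadj c).1 hgy) u'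
        rw [Walk.length_cons, ← hu']
        omega)
  obtain ⟨k1, k2, k3⟩ := strong_insert_last hn hg (by
    rintro _ ⟨a, rfl⟩ _ ⟨b, rfl⟩ ha hb
    rw [hE ((hadj a).1 ha) ((hadj b).1 hb)]) hp h0 hS
  refine GenExt.gen hn ⟨N, inferInstance, f, p (n - 2), k1, ?_, fun m => ?_, k3⟩
  · have := hp.adj (n - 2) (by omega)
    rw [show n - 2 + 1 = n - 1 by omega, h1] at this
    rw [hN.bip _ _ this, hcol]
  · rw [k2 _ ⟨m, rfl⟩, h1, f.injective.eq_iff]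
    rfl

/-- Open polygons with generic isolated vertices. -/
structure Rich (n : ℕ) (M : Type) [bipLang.Structure M] : Prop where
  bip : IsBip M
  gon : IsGon n M
  gen : ∀ τ, Gen n M ∅ τ

lemma Rich.nonempty (h : Rich n M) : Nonempty M := by
  obtain ⟨g, -⟩ := h.gen True ∅ finite_empty (empty_subset _) 0
  exact ⟨g⟩

lemma Rich.of_elementary (h : Rich n M) (f : M ↪ₑ[bipLang] N) : Rich n N := by
  have := h.nonempty
  refine ⟨h.bip.of_elementary f, h.gon.of_elementary f, fun τ => ?_⟩
  have := (h.gen τ).map h.gon.three_le finite_empty f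
  rwa [image_empty] at this

/-- Isolated generic vertices suffice: over `E = ∅` the distance condition of `Gen.single` is void,
and one arc to `x` turns a generic isolated vertex into a generic neighbour of `x`. -/
lemma Rich.gen_subsingleton (h : Rich n M) {E : Set M} (hE : E.Subsingleton) {τ : Prop}
    (hτ : ∀ x ∈ E, (col x ↔ ¬ τ)) : Gen n M E τ := by
  have := h.nonempty
  rcases hE.eq_empty_or_singleton with rfl | ⟨x, rfl⟩
  · exact h.gen τ
  · have h' := (h.gen (col x ↔ Even (n - 1))).single h.gon subsingleton_empty (x := x)
      (by tauto) (by simp)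
    have e : τ = ¬ col x := by
      have := hτ x rfl
      simp only [eq_iff_iff]
      tauto
    rwa [e]

lemma CleanArc.exists_extension {V V' : Type*} {G : SimpleGraph V} {G' : SimpleGraph V'}
    {A : Set V} {h : V → V'} (H : PIso G G' h A) {p : ℕ → V} {q : ℕ → V'}
    (hp : CleanArc n G A p) (hq : CleanArc n G' (h '' A) q) (h0 : q 0 = h (p 0))
    (h1 : q (n - 1) = h (p (n - 1))) : ∃ h' : V → V', (∀ x ∈ A, h' x = h x) ∧
      (∀ i ≤ n - 1, h' (p i) = q i) ∧ PIso G G' h' (A ∪ inner n p) := by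
  classical
  let h' : V → V' := fun x => if hx : ∃ i ∈ Icc 1 (n - 2), p i = x then q hx.choose else h x
  have eA : ∀ x ∈ A, h' x = h x := by
    intro x hx
    refine dif_neg ?_
    rintro ⟨i, hi, rfl⟩
    exact hp.out i hi hx
  have eI : ∀ i ∈ Icc 1 (n - 2), h' (p i) = q i := by
    intro i hi
    have hx : ∃ j ∈ Icc 1 (n - 2), p j = p i := ⟨i, hi, rfl⟩
    have e : h' (p i) = q hx.choose := dif_pos hx
    obtain ⟨⟨k1, k2⟩, k3⟩ := hx.choose_spec
    obtain ⟨i1, i2⟩ := hi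
    rw [e, hp.inj _ (by omega) i (by omega) k3]
  have eP : ∀ i ≤ n - 1, h' (p i) = q i := by
    intro i hi
    rcases Nat.eq_zero_or_pos i with rfl | hi0
    · rw [eA _ hp.left, h0]
    · by_cases hi1 : i = n - 1
      · rw [hi1, eA _ hp.right, h1]
      · exact eI i ⟨hi0, by omega⟩
  have inj : InjOn h' (A ∪ inner n p) := by
    rintro x (hx | ⟨i, hi, rfl⟩) y (hy | ⟨j, hj, rfl⟩) hxy
    · rw [eA x hx, eA y hy] at hxy
      exact H.inj hx hy hxy
    · rw [eA x hx, eI j hj] at hxy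
      exact absurd ⟨x, hx, hxy⟩ (hq.out j hj)
    · rw [eI i hi, eA y hy] at hxy
      exact absurd ⟨y, hy, hxy.symm⟩ (hq.out i hi)
    · rw [eI i hi, eI j hj] at hxy
      obtain ⟨i1, i2⟩ := hi
      obtain ⟨j1, j2⟩ := hj
      rw [hq.inj i (by omega) j (by omega) hxy]
  have memq : ∀ x ∈ A ∪ inner n p, h' x ∈ h '' A ∪ inner n q := by
    rintro x (hx | ⟨i, hi, rfl⟩)
    · exact Or.inl (eA x hx ▸ ⟨x, hx, rfl⟩)
    · exact Or.inr (eI i hi ▸ ⟨i, hi, rfl⟩)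
  have key : ∀ i ∈ Icc 1 (n - 2), ∀ x ∈ A ∪ inner n p, (G'.Adj (h' (p i)) (h' x) ↔ G.Adj (p i) x) := by
    intro i hi x hx
    obtain ⟨i1, i2⟩ := hi
    have c1 := hp.adj (i - 1) (by omega)
    have c2 := hp.adj i (by omega)
    have d1 := hq.adj (i - 1) (by omega)
    have d2 := hq.adj i (by omega)
    rw [show i - 1 + 1 = i by omega] at c1 d1
    rw [eI i ⟨i1, i2⟩]
    constructor
    · intro ha
      rcases hq.clean i ⟨i1, i2⟩ _ (memq x hx) ha with h | h
      · rw [← eP (i - 1) (by omega)] at h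
        rw [inj hx (hp.mem (by omega)) h]
        exact c1.symm
      · rw [← eP (i + 1) (by omega)] at h
        rw [inj hx (hp.mem (by omega)) h]
        exact c2
    · intro ha
      rcases hp.clean i ⟨i1, i2⟩ _ hx ha with h | h
      · rw [h, eP (i - 1) (by omega)]
        exact d1.symm
      · rw [h, eP (i + 1) (by omega)]
        exact d2
  refine ⟨h', eA, eP, inj, ?_⟩
  rintro x (hx | ⟨i, hi, rfl⟩) y hy
  · rcases hy with hy | ⟨j, hj, rfl⟩
    · rw [eA x hx, eA y hy]
      exact H.adj x hx y hy
    · rw [G'.adj_comm, G.adj_comm]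
      exact key j hj x (Or.inl hx)
  · exact key i hi y hy

/-- A finite set inside `j(M)` is free over `j(S)` because `S` is strong in `M`; the vertex `g`
meets only `j(S)`, so it changes nothing. -/
lemma Strong.insert_image {S : Set M} (hS : Strong n (gr M) S) (j : M ↪[bipLang] N) {g : N}
    (hn : 3 ≤ n) (hg : g ∉ range j) (hadj : ∀ m, (gr N).Adj g (j m) → m ∈ S)
    (hstr : Strong n (gr N) (insert g (range j))) : Strong n (gr N) (insert g (j '' S)) := by
  refine hstr.of_subset (insert_subset_insert (image_subset_range _ _)) fun C hC hne hdis hsub => ?_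
  have hCj : C ⊆ range j := fun x hx => (hsub hx).resolve_left
    fun h => Set.disjoint_left.1 hdis (Or.inl h) hx
  obtain ⟨C, rfl⟩ : ∃ C', C = j '' C' := ⟨_, (image_preimage_eq_of_subset hCj).symm⟩
  have hdis' : Disjoint S C := by
    rw [Set.disjoint_left]
    exact fun x hx hxC => Set.disjoint_left.1 hdis (Or.inr ⟨x, hx, rfl⟩) ⟨x, hxC, rfl⟩
  have := hS C (hC.of_finite_image j.injective.injOn) (image_nonempty.1 hne) hdis'
  rw [← (map_pIso j (S ∪ C)).free_image hn subset_union_right, image_union] at this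
  refine this.extend ?_
  rintro _ ⟨c, hc, rfl⟩ x ((rfl | hx) | hx) ax
  · exact absurd hc (Set.disjoint_left.1 hdis' (hadj c ax.symm))
  · exact Or.inl hx
  · exact Or.inr hx

/-- Each finite part of a strong extension is realized strongly in an elementary extension. -/
lemma Rich.exists_realization (hM : Rich n M) (hN : IsGon n N) (f : M ↪[bipLang] N)
    (hf : Strong n (gr N) (range f)) (C : Set N) (hC : C.Finite) (hdis : Disjoint (range f) C) :
    ∃ (K : Type) (_ : bipLang.Structure K) (ι : M ↪ₑ[bipLang] K) (h : N → K),
      (∀ m, h (f m) = ι m) ∧ PIso (gr N) (gr K) h (range f ∪ C) ∧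
      (∀ x ∈ range f ∪ C, (col (h x) ↔ col x)) ∧ Strong n (gr K) (h '' (range f ∪ C)) := by
  classical
  have hn := hM.gon.three_le
  have hMne := hM.nonempty
  induction hk : C.ncard using Nat.strong_induction_on generalizing C with
  | _ k ih =>
  subst hk
  rcases C.eq_empty_or_nonempty with rfl | hne
  · have hl : ∀ m, Function.invFun f (f m) = m := Function.leftInverse_invFun f.injective
    refine ⟨M, inferInstance, ElementaryEmbedding.refl bipLang M, Function.invFun f, hl, ?_, ?_, ?_⟩
    · rw [union_empty]
      refine ⟨?_, ?_⟩
      · rintro _ ⟨x, rfl⟩ _ ⟨y, rfl⟩ h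
        rw [hl, hl] at h
        rw [h]
      · rintro _ ⟨x, rfl⟩ _ ⟨y, rfl⟩
        rw [hl, hl, map_adj]
    · rw [union_empty]
      rintro _ ⟨x, rfl⟩
      rw [hl, map_col]
    · rw [union_empty, ← range_comp]
      intro D _ hD hdis
      obtain ⟨d, hd⟩ := hD
      exact absurd hd (Set.disjoint_left.1 hdis ⟨d, hl d⟩)
  have small : ∀ C' ⊆ C, (C \ C').Nonempty → C'.Finite ∧ C'.ncard < C.ncard ∧
      Disjoint (range f) C' := fun C' h h' => ⟨hC.subset h,
    ncard_lt_ncard ⟨h, fun h2 => by obtain ⟨x, hx, hx'⟩ := h'; exact hx' (h2 hx)⟩ hC, hdis.mono_right h⟩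
  -- Induction on the size of `C`. A loose vertex is realized last, by a generic vertex in a further
  -- extension; without loose vertices the interior of a clean arc is removed, and restored by an
  -- arc of the polygon `K` already obtained.
  by_cases hl : ∃ v ∈ C, Loose (gr N) (range f ∪ C) v
  · obtain ⟨v, hv, hl⟩ := hl
    have hset : range f ∪ C = insert v (range f ∪ (C \ {v})) := by
      rw [← union_insert, insert_sdiff_singleton, insert_eq_of_mem hv]
    have hvX : v ∉ range f ∪ (C \ {v}) := by
      rintro (h | h)
      · exact Set.disjoint_left.1 hdis h hv
      · exact h.2 rfl
    obtain ⟨hf1, hf2, hf3⟩ := small (C \ {v}) sdiff_subset ⟨v, hv, fun h => h.2 rfl⟩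
    obtain ⟨K, _, ι, h, hι, H, hcol, hstr⟩ := ih _ hf2 (C \ {v}) hf1 hf3 rfl
    have hK := hM.of_elementary ι
    rw [hset] at hl ⊢
    set X := range f ∪ (C \ {v}) with hX
    let E : Set K := h '' {x ∈ X | (gr N).Adj v x}
    have hE : E.Subsingleton := by
      rintro _ ⟨x, hx, rfl⟩ _ ⟨y, hy, rfl⟩
      rw [hl x (Or.inr hx.1) y (Or.inr hy.1) hx.2 hy.2]
    have hgen : Gen n K E (col v) := by
      refine hK.gen_subsingleton hE ?_
      rintro _ ⟨x, hx, rfl⟩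
      rw [hcol x hx.1]
      exact hN.bip _ _ hx.2.symm
    have := hK.nonempty
    obtain ⟨L, _, j, g, hg, hgc, hga, hgs⟩ := hgen.genExt hK.gon hE.finite
    let h' : N → L := Function.update (j ∘ h) v g
    have hv' : h' v = g := Function.update_self ..
    have hX' : ∀ x ∈ X, h' x = j (h x) := by
      intro x hx
      refine Function.update_of_ne ?_ _ _
      rintro rfl
      exact hvX hx
    have hadj' : ∀ x ∈ X, ((gr L).Adj g (j (h x)) ↔ (gr N).Adj v x) := by
      intro x hx
      rw [hga]
      constructor
      · rintro ⟨y, hy, hxy⟩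
        rw [← H.inj hy.1 hx hxy]
        exact hy.2
      · exact fun ha => ⟨x, ⟨hx, ha⟩, rfl⟩
    refine ⟨L, inferInstance, j.comp ι, h', ?_, ⟨?_, ?_⟩, ?_, ?_⟩
    · intro m
      rw [hX' _ (Or.inl ⟨m, rfl⟩), hι]
      rfl
    · rintro x (rfl | hx) y (rfl | hy) hxy
      · rfl
      · rw [hv', hX' y hy] at hxy
        exact absurd ⟨_, hxy.symm⟩ hg
      · rw [hv', hX' x hx] at hxy
        exact absurd ⟨_, hxy⟩ hg
      · rw [hX' x hx, hX' y hy] at hxy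
        exact H.inj hx hy (j.injective hxy)
    · rintro x (rfl | hx) y (rfl | hy)
      · simp
      · rw [hv', hX' y hy, hadj' y hy]
      · rw [hv', hX' x hx, SimpleGraph.adj_comm, hadj' x hx, SimpleGraph.adj_comm]
      · rw [hX' x hx, hX' y hy]
        exact (map_adj j.toEmbedding _ _).trans (H.adj x hx y hy)
    · rintro x (rfl | hx)
      · rw [hv', hgc]
      · rw [hX' x hx]
        exact (map_col j.toEmbedding _).trans (hcol x hx)
    · have e : h' '' insert v X = insert g (j '' (h '' X)) := by
        rw [image_insert_eq, hv', image_image]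
        congr 1
        exact image_congr hX'
      rw [e]
      refine hstr.insert_image j.toEmbedding hn hg ?_ hgs
      intro m hm
      obtain ⟨x, hx, rfl⟩ := (hga m).1 hm
      exact ⟨x, hx.1, rfl⟩
  · push Not at hl
    obtain ⟨p, hpC, hp, hfar⟩ := hN.exists_cleanArc_of_free subset_union_right
      (hf C hC hne hdis) hl
    have hin : p 1 ∈ inner n p := ⟨1, ⟨le_rfl, by omega⟩, rfl⟩
    have hset : (range f ∪ C) \ inner n p = range f ∪ (C \ inner n p) := by
      rw [union_sdiff_distrib]
      congr 1
      exact (hdis.mono_right hpC).sdiff_eq_left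
    have hset' : range f ∪ C = range f ∪ (C \ inner n p) ∪ inner n p := by
      rw [union_assoc, sdiff_union_of_subset hpC]
    obtain ⟨hf1, hf2, hf3⟩ := small (C \ inner n p) sdiff_subset ⟨p 1, hpC hin, fun h => h.2 hin⟩
    obtain ⟨K, _, ι, h, hι, H, hcol, hstr⟩ := ih _ hf2 (C \ inner n p) hf1 hf3 rfl
    have hK := hM.of_elementary ι
    rw [hset] at hp hfar
    rw [hset']
    set X := range f ∪ (C \ inner n p) with hX
    obtain ⟨wp, hwp, -⟩ := exists_walk_of_path p 0 (n - 1) (Nat.zero_le _) fun k _ hk => hp.adj k hk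
    have hpar := even_length_iff hN.bip wp
    rw [hwp, Nat.sub_zero] at hpar
    -- Walks inside the realized part pull back along `h`, so the images of the ends are as far
    -- apart as the ends are in `X`.
    obtain ⟨q, hq0, hq1, hq, hqs⟩ := hK.gon.exists_cleanArc hstr (a := h (p 0)) (b := h (p (n - 1)))
      ⟨_, hp.left, rfl⟩ ⟨_, hp.right, rfl⟩ (by rwa [hcol _ hp.left, hcol _ hp.right]) (by
        intro w hw
        obtain ⟨u, hu, hu'⟩ := H.exists_walk w hw hp.left hp.right rfl rfl
        rw [← hu]
        exact hfar u hu')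
    obtain ⟨h', e1, e2, H'⟩ := CleanArc.exists_extension H hp hq hq0 hq1
    have hcolp : ∀ i ≤ n - 1, (col (h' (p i)) ↔ col (p i)) := by
      intro i hi
      induction i with
      | zero => rw [e1 _ hp.left, hcol _ hp.left]
      | succ i ih =>
        have c1 := hN.bip _ _ (hp.adj i (by omega)).symm
        have c2 := hK.gon.bip _ _ (hq.adj i (by omega)).symm
        rw [← e2 i (by omega), ← e2 (i + 1) hi] at c2
        rw [c1, c2, ih (by omega)]
    refine ⟨K, inferInstance, ι, h', ?_, H', ?_, ?_⟩
    · intro m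
      rw [e1 _ (Or.inl ⟨m, rfl⟩), hι]
    · rintro x (hx | ⟨i, hi, rfl⟩)
      · rw [e1 x hx, hcol x hx]
      · exact hcolp i (by have := hi.2; omega)
    · have e : h' '' (X ∪ inner n p) = h '' X ∪ inner n q := by
        rw [image_union, image_congr e1]
        congr 1
        rw [inner, inner, image_image]
        refine image_congr ?_
        rintro i ⟨_, hi⟩
        exact e2 i (by omega)
      rwa [e]

end Rich

/-! ### Strong embeddings of rich polygons are elementary. -/

section Elementarity

variable {M N : Type} [bipLang.Structure M] [bipLang.Structure N] {n : ℕ}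

lemma exists_embedding (hM : IsBip M) (hN : IsBip N) (g : M → N) (hg : Function.Injective g)
    (hadj : ∀ x y, (gr N).Adj (g x) (g y) ↔ (gr M).Adj x y) (hcol : ∀ x, col (g x) ↔ col x) :
    ∃ f : M ↪[bipLang] N, ∀ x, f x = g x := by
  refine ⟨{ toFun := g, inj' := hg, map_fun' := fun F => Empty.elim F, map_rel' := ?_ }, fun _ => rfl⟩
  intro k r x
  cases r with
  | point =>
    rw [relMap_point, relMap_point]
    exact hcol _
  | line =>
    rw [relMap_line, relMap_line, hM.lin_iff, hN.lin_iff]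
    exact not_congr (hcol _)
  | inc =>
    rw [relMap_inc, relMap_inc, ← hM.adj_iff, ← hN.adj_iff]
    exact hadj _ _

/-- For every finite `a ⊆ N` the set `M ∪ a` is realized strongly over `M` in an elementary
extension. In the ultraproduct of these, the realizations glue to an embedding of all of `N`, whose
strongness comes from openness of `N`. -/
lemma Rich.exists_elementary (hM : Rich n M) (hN : Rich n N) (f : M ↪[bipLang] N)
    (hf : Strong n (gr N) (range f)) : ∃ (K : Type) (_ : bipLang.Structure K) (g : N ↪[bipLang] K)
      (F : M ↪ₑ[bipLang] K), Rich n K ∧ Strong n (gr K) (range g) ∧ ∀ m, g (f m) = F m := by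
  classical
  have hn := hM.gon.three_le
  have hreal : ∀ a : Finset N, ∃ (K : Type) (_ : bipLang.Structure K) (ι : M ↪ₑ[bipLang] K)
      (h : N → K), (∀ m, h (f m) = ι m) ∧ PIso (gr N) (gr K) h (range f ∪ a) ∧
      (∀ x ∈ range f ∪ a, (col (h x) ↔ col x)) ∧ Strong n (gr K) (h '' (range f ∪ a)) := by
    intro a
    have := hM.exists_realization hN.gon f hf (a \ range f) a.finite_toSet.sdiff disjoint_sdiff_right
    rwa [union_sdiff_self] at this
  choose K hK ι h hι hP hc hS using hreal
  have hKne : ∀ a, Nonempty (K a) := fun a => (hM.of_elementary (ι a)).nonempty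
  let U : Ultrafilter (Finset N) := Ultrafilter.of Filter.atTop
  have hU : ∀ b : Finset N, ∀ᶠ a in (U : Filter (Finset N)), b ≤ a := fun b =>
    Ultrafilter.of_le _ (Filter.eventually_ge_atTop b)
  obtain ⟨L, _, R, F, hF⟩ := exists_ultraproduct U ι
  have hL := hM.of_elementary F
  let g₀ : N → L := fun x => R.lim fun a => h a x
  have rep : ∀ x, ∀ᶠ a in (U : Filter (Finset N)), R.rep (g₀ x) a = h a x := fun x => R.rep_lim _
  have repfin : ∀ X : Set N, X.Finite →
      ∀ᶠ a in (U : Filter (Finset N)), (∀ x ∈ X, R.rep (g₀ x) a = h a x) ∧ X ⊆ range f ∪ a := by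
    intro X hX
    have : ∀ᶠ a in (U : Filter (Finset N)), ∀ x ∈ X, R.rep (g₀ x) a = h a x := by
      rw [Filter.eventually_all_finite hX]
      exact fun x _ => rep x
    filter_upwards [this, hU hX.toFinset] with a h1 h2
    exact ⟨h1, fun x hx => Or.inr (h2 (hX.mem_toFinset.2 hx))⟩
  have hg : Function.Injective g₀ := by
    intro x y hxy
    obtain ⟨a, ⟨h1, h2⟩⟩ := (repfin {x, y} (toFinite _)).exists
    refine (hP a).inj (h2 (by simp)) (h2 (by simp)) ?_
    rw [← h1 x (by simp), ← h1 y (by simp), hxy]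
  obtain ⟨g, hgg⟩ := exists_embedding hN.bip hL.bip g₀ hg (by
    intro x y
    obtain ⟨a, ⟨h1, h2⟩, h3⟩ := ((repfin {x, y} (toFinite _)).and
      (R.eventually_pIso (toFinite {g₀ x, g₀ y}))).exists
    rw [← (hP a).adj _ (h2 (by simp)) _ (h2 (by simp)), ← h3.adj _ (by simp) _ (by simp),
      h1 x (by simp), h1 y (by simp)]) (by
    intro x
    obtain ⟨a, ⟨h1, h2⟩, h3⟩ := ((repfin {x} (toFinite _)).and (R.eventually_col (g₀ x))).exists
    rw [← h3, ← hc a x (h2 rfl), h1 x rfl])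
  refine ⟨L, inferInstance, g, F, hL, ?_, fun m => ?_⟩
  · intro D hD hne hdis
    by_contra hcl
    obtain ⟨B₀, hB₀, hB₀fin, hcl, hadj⟩ := exists_finite_not_free hD hcl
    obtain ⟨B, rfl⟩ : ∃ B, B₀ = g '' B := ⟨_, (image_preimage_eq_of_subset hB₀).symm⟩
    have hB : B.Finite := hB₀fin.of_finite_image g.injective.injOn
    refine hN.gon.isOpen.no_copies hn hB fun X hX => ?_
    obtain ⟨a, ⟨h1, h2⟩, h3⟩ := ((repfin (B ∪ X) (hB.union hX)).and
      (R.eventually_pIso (((hB.union hX).image g).union hD))).exists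
    have himg : (fun x => R.rep x a) '' (g '' B) = h a '' B := by
      rw [image_image]
      refine image_congr fun x hx => ?_
      rw [hgg, h1 x (Or.inl hx)]
    have hsub0 : g '' B ∪ D ⊆ g '' (B ∪ X) ∪ D :=
      union_subset_union_left _ (image_mono subset_union_left)
    have hcl' : ¬ Free n (gr (K a)) (h a '' B ∪ (fun x => R.rep x a) '' D)
        ((fun x => R.rep x a) '' D) := by
      rwa [← himg, ← image_union, (h3.mono hsub0).free_image hn subset_union_right]
    -- A set closed over `B` in the ultraproduct appears in `K a`, where it is trapped in the strong
    -- image of `M ∪ a`. Pulled back to `N` it is a closed set over `B` avoiding any prescribed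
    -- finite `X`, against `Strong.no_copies`.
    have hsub := (hS a).subset_of_not_free (image_mono (subset_union_left.trans h2)) (hD.image _) hcl'
    obtain ⟨E, hE, hED⟩ := subset_image_iff.1 hsub
    have hBE : B ∪ E ⊆ range f ∪ a := union_subset (subset_union_left.trans h2) hE
    have havoid : ∀ x ∈ B ∪ X, x ∉ E := by
      intro x hx hxE
      obtain ⟨d, hd, hdx⟩ := hED.subset (mem_image_of_mem (h a) hxE)
      have hdx' : R.rep d a = R.rep (g x) a := by
        rw [hgg, h1 x hx]
        exact hdx
      have := h3.inj (Or.inr hd) (Or.inl ⟨x, hx, rfl⟩) hdx'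
      exact Set.disjoint_left.1 hdis ⟨x, rfl⟩ (this ▸ hd)
    refine ⟨E, ?_, ?_, ?_, ?_, ?_, ?_⟩
    · exact (hED ▸ hD.image _ : (h a '' E).Finite).of_finite_image ((hP a).inj.mono hE)
    · exact image_nonempty.1 (hED ▸ hne.image _)
    · exact Set.disjoint_left.2 fun x hx => havoid x (Or.inr hx)
    · exact Set.disjoint_left.2 fun x hx => havoid x (Or.inl hx)
    · rwa [← hED, ← image_union, ((hP a).mono hBE).free_image hn subset_union_right] at hcl'
    · intro b hb
      obtain ⟨d, hd, hbd⟩ := hadj (g b) ⟨b, hb, rfl⟩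
      obtain ⟨e, he, hed⟩ := hED.symm.subset (mem_image_of_mem (fun x => R.rep x a) hd)
      refine ⟨e, he, ?_⟩
      rw [← (hP a).adj _ (hBE (Or.inl hb)) _ (hBE (Or.inr he)), hed, ← h1 b (Or.inl hb), ← hgg]
      exact (h3.adj _ (Or.inl ⟨b, Or.inl hb, rfl⟩) _ (Or.inr hd)).2 hbd
  · rw [hgg]
    have : (fun a => h a (f m)) = fun a => ι a m := funext fun a => hι a m
    exact (congrArg R.lim this).trans (hF m)

/-- Induction on `φ` for all rich pairs at once. For a quantifier over `N`, the statement lifts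
along `M ≼ K` and descends along the strong inclusion of `N` in `K` by the induction hypothesis for
the smaller formula. -/
lemma Rich.realize_iff {α : Type} {k : ℕ} (φ : bipLang.BoundedFormula α k) {M N : Type}
    [bipLang.Structure M] [bipLang.Structure N] (hM : Rich n M) (hN : Rich n N)
    (f : M ↪[bipLang] N) (hf : Strong n (gr N) (range f)) (v : α → M) (xs : Fin k → M) :
    φ.Realize (f ∘ v) (f ∘ xs) ↔ φ.Realize v xs := by
  induction φ generalizing M N with
  | falsum => exact Iff.rfl
  | equal t₁ t₂ =>
    simp only [BoundedFormula.Realize, ← Sum.comp_elim, HomClass.realize_term]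
    exact f.injective.eq_iff
  | rel R ts =>
    simp only [BoundedFormula.Realize, ← Sum.comp_elim, HomClass.realize_term]
    exact f.map_rel R _
  | imp φ ψ ih₁ ih₂ =>
    simp only [BoundedFormula.realize_imp]
    rw [ih₁ hM hN f hf, ih₂ hM hN f hf]
  | all φ ih =>
    simp only [BoundedFormula.realize_all]
    constructor
    · intro h m
      have := h (f m)
      rwa [← Fin.comp_snoc, ih hM hN f hf] at this
    · intro h y
      obtain ⟨K, _, g, F, hK, hg, hgf⟩ := hM.exists_elementary hN f hf
      have hF : φ.all.Realize (F ∘ v) (F ∘ xs) :=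
        (F.map_boundedFormula φ.all v xs).2 (BoundedFormula.realize_all.2 h)
      have e1 : (F : M → K) = g ∘ f := funext fun m => (hgf m).symm
      have := BoundedFormula.realize_all.1 hF (g y)
      rw [e1, Function.comp_assoc, Function.comp_assoc, ← Fin.comp_snoc, ih hN hK g hg] at this
      exact this

/-- A strong embedding of rich polygons is elementary. -/
lemma Rich.elementary (hM : Rich n M) (hN : Rich n N) (f : M ↪[bipLang] N)
    (hf : Strong n (gr N) (range f)) : ∃ F : M ↪ₑ[bipLang] N, ∀ m, F m = f m := by
  refine ⟨⟨f, fun k φ x => ?_⟩, fun _ => rfl⟩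
  have := hM.realize_iff φ hN f hf x default
  rw [Formula.Realize, Formula.Realize, ← this]
  exact iff_of_eq (congrArg _ (Subsingleton.elim _ _))

end Elementarity

/-! ### Strong cycles of length `2n + 2` and a vertex far from them. -/

section Cycles

variable {V : Type*} {G : SimpleGraph V} {n : ℕ} {col : V → Prop}

/-- The class of `x` is that of a vertex at distance `i` from `o`. -/
def Par (col : V → Prop) (o x : V) (i : ℕ) : Prop := col x ↔ (col o ↔ Even i)

lemma Par.path (hb : ∀ x y, G.Adj x y → (col x ↔ ¬ col y)) {o : V} {p : ℕ → V} {i m : ℕ}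
    (h : Par col o (p 0) i) (hp : ∀ k < m, G.Adj (p k) (p (k + 1))) {k : ℕ} (hk : k ≤ m) :
    Par col o (p k) (i + k) := by
  induction k with
  | zero => exact h
  | succ k ih =>
    have h1 := ih (by omega)
    have h2 := hb _ _ (hp k (by omega))
    unfold Par at *
    rw [← add_assoc, Nat.even_add_one]
    tauto

lemma Par.parity {o x y : V} {i j : ℕ} (hx : Par col o x i) (hy : Par col o y j)
    (h : (i + j) % 2 = (n - 1) % 2) : (col x ↔ col y) ↔ Even (n - 1) := by
  unfold Par at *
  rw [hx, hy, Nat.even_iff, Nat.even_iff, Nat.even_iff]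
  by_cases ho : col o
  · simp only [ho, true_iff]
    omega
  · simp only [ho, false_iff]
    omega

/-- A strong cycle of length `2n + 2`. -/
structure StrongCycle (n : ℕ) (G : SimpleGraph V) (c : ℕ → V) : Prop where
  periodic : ∀ i, c (i + (2 * n + 2)) = c i
  inj : InjOn c (Iio (2 * n + 2))
  adj : ∀ i, G.Adj (c i) (c (i + 1))
  strong : Strong n G (range c)

namespace StrongCycle

variable {c : ℕ → V}

lemma shift_mul (hc : StrongCycle n G c) (i k : ℕ) : c (i + (2 * n + 2) * k) = c i := by
  induction k with
  | zero => rfl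
  | succ k ih => rw [Nat.mul_succ, ← add_assoc, hc.periodic, ih]

lemma mod_eq (hc : StrongCycle n G c) (i : ℕ) : c (i % (2 * n + 2)) = c i := by
  rw [← hc.shift_mul _ (i / (2 * n + 2)), Nat.mod_add_div]

lemma eq_iff (hc : StrongCycle n G c) (i j : ℕ) : c i = c j ↔ i % (2 * n + 2) = j % (2 * n + 2) := by
  rw [← hc.mod_eq i, ← hc.mod_eq j]
  exact ⟨fun h => hc.inj (Nat.mod_lt _ (by omega)) (Nat.mod_lt _ (by omega)) h, fun h => by rw [h]⟩

lemma eq_of_lt (hc : StrongCycle n G c) {i j : ℕ} (h : c i = c j) (h1 : i < j + (2 * n + 2))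
    (h2 : j < i + (2 * n + 2)) : i = j := by
  rw [hc.eq_iff] at h
  rcases le_total i j with hij | hij
  · have := Nat.eq_zero_of_dvd_of_lt ((Nat.modEq_iff_dvd' hij).1 h) (by omega)
    omega
  · have := Nat.eq_zero_of_dvd_of_lt ((Nat.modEq_iff_dvd' hij).1 h.symm) (by omega)
    omega

lemma exists_lt (hc : StrongCycle n G c) {x : V} (hx : x ∈ range c) : ∃ i < 2 * n + 2, c i = x := by
  obtain ⟨i, rfl⟩ := hx
  exact ⟨i % (2 * n + 2), Nat.mod_lt _ (by omega), hc.mod_eq i⟩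

lemma range_finite (hc : StrongCycle n G c) : (range c).Finite := by
  refine ((finite_Iio (2 * n + 2)).image c).subset fun x hx => ?_
  obtain ⟨i, hi, rfl⟩ := hc.exists_lt hx
  exact ⟨i, hi, rfl⟩

lemma shift (hc : StrongCycle n G c) : StrongCycle n G fun i => c (i + 1) := by
  refine ⟨fun i => ?_, fun i hi j hj hij => ?_, fun i => hc.adj _, ?_⟩
  · show c (i + (2 * n + 2) + 1) = c (i + 1)
    rw [← hc.periodic (i + 1)]
    congr 1
    omega
  · replace hij : c (i + 1) = c (j + 1) := hij
    rw [hc.eq_iff] at hij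
    replace hi : i < 2 * n + 2 := hi
    replace hj : j < 2 * n + 2 := hj
    by_cases h1 : i + 1 = 2 * n + 2
    · by_cases h2 : j + 1 = 2 * n + 2
      · omega
      · rw [h1, Nat.mod_self, Nat.mod_eq_of_lt (by omega)] at hij
        omega
    · by_cases h2 : j + 1 = 2 * n + 2
      · rw [h2, Nat.mod_self, Nat.mod_eq_of_lt (by omega)] at hij
        omega
      · rw [Nat.mod_eq_of_lt (by omega), Nat.mod_eq_of_lt (by omega)] at hij
        omega
  · convert hc.strong using 1
    ext x
    constructor
    · rintro ⟨i, rfl⟩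
      exact ⟨i + 1, rfl⟩
    · rintro ⟨i, rfl⟩
      exact ⟨i + (2 * n + 1), hc.periodic i⟩

lemma adj_lt (hc : StrongCycle n G c) (hG : IsPoly n G col) {i j : ℕ} (hij : i < j)
    (hj : j < 2 * n + 2) (h : G.Adj (c i) (c j)) : j = i + 1 ∨ (i = 0 ∧ j = 2 * n + 1) := by
  have hn := hG.three_le
  by_cases hlen : j - i + 1 < 2 * n
  · exact Or.inl (no_chord hG.girth hij (hc.inj.mono fun k hk => lt_of_le_of_lt hk.2 hj)
      (fun k _ _ => hc.adj k) h hlen)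
  · right
    have h' : G.Adj (c j) (c (i + (2 * n + 2))) := by
      rw [hc.periodic]
      exact h.symm
    have := no_chord hG.girth (i := j) (j := i + (2 * n + 2)) (by omega) (by
      intro k hk l hl hkl
      exact hc.eq_of_lt hkl (by have := hk.2; have := hl.1; omega) (by have := hl.2; have := hk.1; omega))
      (fun k _ _ => hc.adj k) h' (by omega)
    omega

lemma exists_pot (hc : StrongCycle n G c) (hG : IsPoly n G col) (f : ℕ → ℤ)
    (h : ∀ i < 2 * n + 1, f (i + 1) ≤ f i + 1 ∧ f i ≤ f (i + 1) + 1)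
    (h0 : f 0 ≤ f (2 * n + 1) + 1 ∧ f (2 * n + 1) ≤ f 0 + 1) :
    ∃ φ : V → ℤ, (∀ i < 2 * n + 2, φ (c i) = f i) ∧ Pot G (range c) φ := by
  classical
  refine ⟨fun x => f (Function.invFunOn c (Iio (2 * n + 2)) x), ?_, ?_⟩
  · intro i hi
    have := hc.inj.leftInvOn_invFunOn (show i ∈ Iio (2 * n + 2) from hi)
    exact congrArg f this
  · have e : ∀ i < 2 * n + 2, Function.invFunOn c (Iio (2 * n + 2)) (c i) = i := fun i hi =>
      hc.inj.leftInvOn_invFunOn (show i ∈ Iio (2 * n + 2) from hi)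
    intro x hx y hy hxy
    obtain ⟨i, hi, rfl⟩ := hc.exists_lt hx
    obtain ⟨j, hj, rfl⟩ := hc.exists_lt hy
    simp only [e i hi, e j hj]
    rcases lt_trichotomy i j with hij | rfl | hij
    · rcases hc.adj_lt hG hij hj hxy with rfl | ⟨rfl, rfl⟩
      · exact (h i (by omega)).1
      · exact h0.2
    · exact absurd hxy G.irrefl
    · rcases hc.adj_lt hG hij hi hxy.symm with rfl | ⟨rfl, rfl⟩
      · exact (h j (by omega)).2
      · exact h0.1

lemma par (hc : StrongCycle n G c) (hG : IsPoly n G col) (i : ℕ) : Par col (c 0) (c i) i := by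
  have : Par col (c 0) (c 0) 0 := by simp [Par]
  simpa using this.path hG.bip (m := i) (fun k _ => hc.adj k) le_rfl

end StrongCycle

/-- Form of `IsPoly.exists_cleanArc` for explicit constructions: distance is certified by a
potential with a gap of `n`, parity by position relative to `o`, and the positions of the new
vertices are passed on. -/
lemma IsPoly.exists_arc (hG : IsPoly n G col) {A : Set V} (hA : Strong n G A) (hfin : A.Finite)
    {a b o : V} (ha : a ∈ A) (hb : b ∈ A) {i j : ℕ} (hi : Par col o a i) (hj : Par col o b j)
    (hij : (i + j) % 2 = (n - 1) % 2) (hφ : ∃ φ, Pot G A φ ∧ φ a + n ≤ φ b) :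
    ∃ p : ℕ → V, p 0 = a ∧ p (n - 1) = b ∧ CleanArc n G A p ∧ Strong n G (A ∪ inner n p) ∧
      (A ∪ inner n p).Finite ∧ ∀ k ≤ n - 1, Par col o (p k) (i + k) := by
  obtain ⟨φ, h1, h2⟩ := hφ
  obtain ⟨p, p0, p1, hp, hs⟩ := hG.exists_cleanArc hA ha hb (hi.parity hj hij) (h1.far h2)
  refine ⟨p, p0, p1, hp, hs, hfin.union (inner_finite p), fun k hk => ?_⟩
  subst p0
  exact hi.path hG.bip (fun k hk => hp.adj k hk) hk

/-- The data from which the chain of arcs starts. -/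
def FarStart (n : ℕ) (G : SimpleGraph V) (col : V → Prop) (c : ℕ → V) : Prop :=
  ∃ (F : Set V) (z : V), F.Finite ∧ Strong n G F ∧ range c ⊆ F ∧ z ∈ F ∧ z ∉ range c ∧
    ((col (c 3) ↔ col z) ↔ Even (n - 1)) ∧ Far n G F (c 3) z ∧ ¬ G.Adj z (c (3 + n))

/-- Two crossing arcs on the cycle and a third arc `e` between them produce `e (n - 3)`, on which a
potential vanishing at `c 3` takes the value `n + 1`. All integer functions below are lower bounds
for the distance from the vertex in question, extended arc by arc. -/
lemma StrongCycle.farStart_of_four_le {c : ℕ → V} (hc : StrongCycle n G c) (hG : IsPoly n G col)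
    (hn : 4 ≤ n) : FarStart n G col c := by
  have hmem : ∀ i, c i ∈ range c := fun i => ⟨i, rfl⟩
  -- the arc `p` from `c 0` to `c (n + 1)`
  obtain ⟨p, p0, p1, hp, hps, hpf, hpp⟩ := hG.exists_arc hc.strong hc.range_finite (hmem 0)
    (hmem (n + 1)) (hc.par hG 0) (hc.par hG (n + 1)) (by omega) (by
      obtain ⟨φ, hφ, hP⟩ := hc.exists_pot hG (fun i => min (i : ℤ) (2 * n + 2 - i))
        (fun i hi => by push_cast; omega) (by push_cast; omega)
      refine ⟨φ, hP, ?_⟩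
      rw [hφ 0 (by omega), hφ (n + 1) (by omega)]
      push_cast
      omega)
  have mp : ∀ i, c i ∈ range c ∪ inner n p := fun i => Or.inl (hmem i)
  -- the arc `q` from `c 2` to `c (n + 3)`
  obtain ⟨q, q0, q1, hq, hqs, hqf, hqp⟩ := hG.exists_arc hps hpf (mp 2)
    (mp (n + 3)) (hc.par hG 2) (hc.par hG (n + 3)) (by omega) (by
      obtain ⟨φ, hφ, hP⟩ := hc.exists_pot hG
        (fun i => min (max ((i : ℤ) - 2) (2 - i)) (2 * n + 4 - i))
        (fun i hi => by push_cast; omega) (by push_cast; omega)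
      obtain ⟨φ', h1, h2, hP'⟩ := hP.extend hp (fun k => max (2 : ℤ) (k : ℕ))
        (by rw [p0, hφ 0 (by omega)]; push_cast; omega)
        (by rw [p1, hφ (n + 1) (by omega)]; push_cast; omega)
        (fun k hk => abs_le.2 ⟨by push_cast; omega, by push_cast; omega⟩)
      refine ⟨φ', hP', ?_⟩
      rw [h1 _ (hmem _), h1 _ (hmem _), hφ 2 (by omega), hφ (n + 3) (by omega)]
      push_cast
      omega)
  have mq : ∀ i, c i ∈ range c ∪ inner n p ∪ inner n q := fun i => Or.inl (mp i)
  -- the arc `e` from `p 1` to `q (n - 2)`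
  obtain ⟨e, e0, e1, he, hes, hef, hep⟩ := hG.exists_arc hqs hqf
    (Or.inl (hp.mem (i := 1) (by omega))) (hq.mem (i := n - 2) (by omega)) (hpp 1 (by omega))
    (hqp (n - 2) (by omega)) (by omega) (by
      obtain ⟨φ, hφ, hP⟩ := hc.exists_pot hG
        -- A bound for the distance from `p 1`: it is one step from `c 0` and `n - 2` steps from `c
        -- (n + 1)`.
        (fun i => min (min (1 + (i : ℤ)) (2 * n + 3 - i)) (n - 2 + max ((n : ℤ) + 1 - i) (i - n - 1)))
        (fun i hi => by push_cast; omega) (by push_cast; omega)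
      obtain ⟨φ', h1, h2, hP'⟩ := hP.extend hp (fun k => max ((k : ℤ) - 1) (1 - k))
        (by rw [p0, hφ 0 (by omega)]; push_cast; omega)
        (by rw [p1, hφ (n + 1) (by omega)]; push_cast; omega)
        (fun k hk => abs_le.2 ⟨by push_cast; omega, by push_cast; omega⟩)
      obtain ⟨φ'', h3, h4, hP''⟩ := hP'.extend hq (fun k => min (3 + (k : ℤ)) (2 * n - 1 - k))
        (by rw [q0, h1 _ (hmem _), hφ 2 (by omega)]; push_cast; omega)
        (by rw [q1, h1 _ (hmem _), hφ (n + 3) (by omega)]; push_cast; omega)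
        (fun k hk => abs_le.2 ⟨by push_cast; omega, by push_cast; omega⟩)
      refine ⟨φ'', hP'', ?_⟩
      rw [h3 _ (hp.mem (by omega)), h2 1 (by omega), h4 (n - 2) (by omega)]
      push_cast
      omega)
  obtain ⟨φ, hφ, hP⟩ := hc.exists_pot hG
    (fun i => min (max ((i : ℤ) - 3) (3 - i)) (2 * n + 5 - i))
    (fun i hi => by push_cast; omega) (by push_cast; omega)
  obtain ⟨φ', h1, h2, hP'⟩ := hP.extend hp (fun k => min (3 + (k : ℤ)) (2 * n - 3 - k))
    (by rw [p0, hφ 0 (by omega)]; push_cast; omega)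
    (by rw [p1, hφ (n + 1) (by omega)]; push_cast; omega)
    (fun k hk => abs_le.2 ⟨by push_cast; omega, by push_cast; omega⟩)
  obtain ⟨φ'', h3, h4, hP''⟩ := hP'.extend hq (fun k => 1 + (k : ℤ))
    (by rw [q0, h1 _ (hmem _), hφ 2 (by omega)]; push_cast; omega)
    (by rw [q1, h1 _ (hmem _), hφ (n + 3) (by omega)]; push_cast; omega)
    (fun k hk => abs_le.2 ⟨by push_cast; omega, by push_cast; omega⟩)
  obtain ⟨φ₃, h5, h6, hP₃⟩ := hP''.extend he (fun k => min (4 + (k : ℤ)) (2 * n - 2 - k))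
    (by rw [e0, h3 _ (hp.mem (by omega)), h2 1 (by omega)]; push_cast; omega)
    (by rw [e1, h4 (n - 2) (by omega)]; omega)
    (fun k hk => abs_le.2 ⟨by push_cast; omega, by push_cast; omega⟩)
  -- This is where `4 ≤ n` is needed: for `n = 3` the vertex would be the end `p 1` of the arc
  -- instead of a new one.
  have hz : n - 3 ∈ Icc 1 (n - 2) := ⟨by omega, by omega⟩
  refine ⟨_, e (n - 3), hef, hes, fun x hx => Or.inl (Or.inl (Or.inl hx)),
    he.mem (by omega), fun h => he.out _ hz (Or.inl (Or.inl h)),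
    (hc.par hG 3).parity (hep (n - 3) (by omega)) (by omega), hP₃.far ?_, fun h => ?_⟩
  · rw [h5 _ (mq 3), h3 _ (mp 3), h1 _ (hmem 3), hφ 3 (by omega), h6 (n - 3) (by omega)]
    push_cast
    omega
  · have hc' : ∀ k, 1 ≤ k → k ≤ n - 2 → e k ≠ c (3 + n) := fun k hk hk' h =>
      he.out k ⟨hk, hk'⟩ (h ▸ mq _)
    rcases he.clean _ hz _ (Or.inl (mq _)) h with h | h
    · rcases Nat.eq_or_lt_of_le hn with rfl | hn'
      · exact hp.out 1 ⟨le_rfl, by omega⟩ (e0 ▸ h ▸ hmem _)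
      · exact hc' (n - 3 - 1) (by omega) (by omega) h.symm
    · exact hc' (n - 3 + 1) (by omega) (by omega) h.symm

/-- For projective planes the third arc is too short; a further arc `r` on the cycle and an arc `w`
from `e 1` to `r 1` give the vertex `w 1`. -/
lemma StrongCycle.farStart_three {c : ℕ → V} (hc : StrongCycle 3 G c) (hG : IsPoly 3 G col) :
    FarStart 3 G col c := by
  have hmem : ∀ i, c i ∈ range c := fun i => ⟨i, rfl⟩
  -- the arc `p` from `c 0` to `c 4`
  obtain ⟨p, p0, p1, hp, hps, hpf, hpp⟩ := hG.exists_arc hc.strong hc.range_finite (hmem 0)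
    (hmem 4) (hc.par hG 0) (hc.par hG 4) (by omega) (by
      obtain ⟨φ, hφ, hP⟩ := hc.exists_pot hG (fun i => min (i : ℤ) (8 - i))
        (fun i hi => by push_cast; omega) (by push_cast; omega)
      refine ⟨φ, hP, ?_⟩
      rw [hφ 0 (by omega), hφ 4 (by omega)]
      push_cast
      omega)
  have mp : ∀ i, c i ∈ range c ∪ inner 3 p := fun i => Or.inl (hmem i)
  -- the arc `q` from `c 2` to `c 6`
  obtain ⟨q, q0, q1, hq, hqs, hqf, hqp⟩ := hG.exists_arc hps hpf (mp 2)
    (mp 6) (hc.par hG 2) (hc.par hG 6) (by omega) (by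
      obtain ⟨φ, hφ, hP⟩ := hc.exists_pot hG
        (fun i => min (max ((i : ℤ) - 2) (2 - i)) (10 - i))
        (fun i hi => by push_cast; omega) (by push_cast; omega)
      obtain ⟨φ', h1, h2, hP'⟩ := hP.extend hp (fun k => 2)
        (by rw [p0, hφ 0 (by omega)]; push_cast; omega)
        (by rw [p1, hφ 4 (by omega)]; push_cast; omega)
        (fun k hk => abs_le.2 ⟨by omega, by omega⟩)
      refine ⟨φ', hP', ?_⟩
      rw [h1 _ (hmem _), h1 _ (hmem _), hφ 2 (by omega), hφ 6 (by omega)]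
      push_cast
      omega)
  have mq : ∀ i, c i ∈ range c ∪ inner 3 p ∪ inner 3 q := fun i => Or.inl (mp i)
  have mpq : ∀ i ≤ 2, p i ∈ range c ∪ inner 3 p ∪ inner 3 q := fun i hi => Or.inl (hp.mem hi)
  -- the arc `e` from `p 1` to `q 1`
  obtain ⟨e, e0, e1, he, hes, hef, hep⟩ := hG.exists_arc hqs hqf
    (mpq 1 (by omega)) (hq.mem (i := 1) (by omega)) (hpp 1 (by omega))
    (hqp 1 (by omega)) (by omega) (by
      obtain ⟨φ, hφ, hP⟩ := hc.exists_pot hG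
        (fun i => min (min (1 + (i : ℤ)) (9 - i)) (1 + max (4 - (i : ℤ)) (i - 4)))
        (fun i hi => by push_cast; omega) (by push_cast; omega)
      obtain ⟨φ', h1, h2, hP'⟩ := hP.extend hp (fun k => max ((k : ℤ) - 1) (1 - k))
        (by rw [p0, hφ 0 (by omega)]; push_cast; omega)
        (by rw [p1, hφ 4 (by omega)]; push_cast; omega)
        (fun k hk => abs_le.2 ⟨by push_cast; omega, by push_cast; omega⟩)
      obtain ⟨φ'', h3, h4, hP''⟩ := hP'.extend hq (fun k => min (3 + (k : ℤ)) (5 - k))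
        (by rw [q0, h1 _ (hmem _), hφ 2 (by omega)]; push_cast; omega)
        (by rw [q1, h1 _ (hmem _), hφ 6 (by omega)]; push_cast; omega)
        (fun k hk => abs_le.2 ⟨by push_cast; omega, by push_cast; omega⟩)
      refine ⟨φ'', hP'', ?_⟩
      rw [h3 _ (hp.mem (by omega)), h2 1 (by omega), h4 1 (by omega)]
      push_cast
      omega)
  have me : ∀ i, c i ∈ range c ∪ inner 3 p ∪ inner 3 q ∪ inner 3 e := fun i => Or.inl (mq i)
  -- the arc `r` from `c 1` to `c 5`
  obtain ⟨r, r0, r1, hr, hrs, hrf, hrp⟩ := hG.exists_arc hes hef (me 1) (me 5) (hc.par hG 1)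
    (hc.par hG 5) (by omega) (by
      obtain ⟨φ, hφ, hP⟩ := hc.exists_pot hG
        (fun i => min (max ((i : ℤ) - 1) (1 - i)) (9 - i))
        (fun i hi => by push_cast; omega) (by push_cast; omega)
      obtain ⟨φ', h1, h2, hP'⟩ := hP.extend hp (fun k => 1 + (k : ℤ))
        (by rw [p0, hφ 0 (by omega)]; push_cast; omega)
        (by rw [p1, hφ 4 (by omega)]; push_cast; omega)
        (fun k hk => abs_le.2 ⟨by push_cast; omega, by push_cast; omega⟩)
      obtain ⟨φ'', h3, h4, hP''⟩ := hP'.extend hq (fun k => 1 + (k : ℤ))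
        (by rw [q0, h1 _ (hmem _), hφ 2 (by omega)]; push_cast; omega)
        (by rw [q1, h1 _ (hmem _), hφ 6 (by omega)]; push_cast; omega)
        (fun k hk => abs_le.2 ⟨by push_cast; omega, by push_cast; omega⟩)
      obtain ⟨φ₃, h5, h6, hP₃⟩ := hP''.extend he (fun k => min (2 + (k : ℤ)) (4 - k))
        (by rw [e0, h3 _ (hp.mem (by omega)), h2 1 (by omega)]; push_cast; omega)
        (by rw [e1, h4 1 (by omega)]; push_cast; omega)
        (fun k hk => abs_le.2 ⟨by push_cast; omega, by push_cast; omega⟩)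
      refine ⟨φ₃, hP₃, ?_⟩
      rw [h5 _ (mq 1), h5 _ (mq 5), h3 _ (mp 1), h3 _ (mp 5), h1 _ (hmem 1), h1 _ (hmem 5),
        hφ 1 (by omega), hφ 5 (by omega)]
      push_cast
      omega)
  have mr : ∀ i, c i ∈ range c ∪ inner 3 p ∪ inner 3 q ∪ inner 3 e ∪ inner 3 r :=
    fun i => Or.inl (me i)
  -- the arc `w` from `e 1` to `r 1`
  obtain ⟨w, w0, w1, hw, hws, hwf, hwp⟩ := hG.exists_arc hrs hrf
    (Or.inl (he.mem (i := 1) (by omega))) (hr.mem (i := 1) (by omega)) (hep 1 (by omega))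
    (hrp 1 (by omega)) (by omega) (by
      -- A potential centred at `e 1`: it is `2` on even and `3` on odd cycle vertices, `0` at `e
      -- 1`, and reaches `4` at `r 1`.
      obtain ⟨φ, hφ, hP⟩ := hc.exists_pot hG (fun i => 2 + (i : ℤ) % 2)
        (fun i hi => by push_cast; omega) (by norm_num)
      obtain ⟨φ', h1, h2, hP'⟩ := hP.extend hp (fun k => max (2 - (k : ℤ)) k)
        (by rw [p0, hφ 0 (by omega)]; push_cast; omega)
        (by rw [p1, hφ 4 (by omega)]; push_cast; omega)
        (fun k hk => abs_le.2 ⟨by push_cast; omega, by push_cast; omega⟩)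
      obtain ⟨φ'', h3, h4, hP''⟩ := hP'.extend hq (fun k => max (2 - (k : ℤ)) k)
        (by rw [q0, h1 _ (hmem _), hφ 2 (by omega)]; push_cast; omega)
        (by rw [q1, h1 _ (hmem _), hφ 6 (by omega)]; push_cast; omega)
        (fun k hk => abs_le.2 ⟨by push_cast; omega, by push_cast; omega⟩)
      obtain ⟨φ₃, h5, h6, hP₃⟩ := hP''.extend he (fun k => max (1 - (k : ℤ)) (k - 1))
        (by rw [e0, h3 _ (hp.mem (by omega)), h2 1 (by omega)]; push_cast; omega)
        (by rw [e1, h4 1 (by omega)]; push_cast; omega)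
        (fun k hk => abs_le.2 ⟨by push_cast; omega, by push_cast; omega⟩)
      obtain ⟨φ₄, h7, h8, hP₄⟩ := hP₃.extend hr (fun k => min (3 + (k : ℤ)) (5 - k))
        (by rw [r0, h5 _ (mq 1), h3 _ (mp 1), h1 _ (hmem 1), hφ 1 (by omega)]; push_cast; omega)
        (by rw [r1, h5 _ (mq 5), h3 _ (mp 5), h1 _ (hmem 5), hφ 5 (by omega)]; push_cast; omega)
        (fun k hk => abs_le.2 ⟨by push_cast; omega, by push_cast; omega⟩)
      refine ⟨φ₄, hP₄, ?_⟩
      rw [h7 _ (he.mem (by omega)), h6 1 (by omega), h8 1 (by omega)]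
      push_cast
      omega)
  obtain ⟨φ, hφ, hP⟩ := hc.exists_pot hG
    (fun i => min (max ((i : ℤ) - 3) (3 - i)) (11 - i))
    (fun i hi => by push_cast; omega) (by push_cast; omega)
  obtain ⟨φ', h1, h2, hP'⟩ := hP.extend hp (fun k => 3 - (k : ℤ))
    (by rw [p0, hφ 0 (by omega)]; push_cast; omega)
    (by rw [p1, hφ 4 (by omega)]; push_cast; omega)
    (fun k hk => abs_le.2 ⟨by push_cast; omega, by push_cast; omega⟩)
  obtain ⟨φ'', h3, h4, hP''⟩ := hP'.extend hq (fun k => 1 + (k : ℤ))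
    (by rw [q0, h1 _ (hmem _), hφ 2 (by omega)]; push_cast; omega)
    (by rw [q1, h1 _ (hmem _), hφ 6 (by omega)]; push_cast; omega)
    (fun k hk => abs_le.2 ⟨by push_cast; omega, by push_cast; omega⟩)
  obtain ⟨φ₃, h5, h6, hP₃⟩ := hP''.extend he (fun k => min (2 + (k : ℤ)) (4 - k))
    (by rw [e0, h3 _ (hp.mem (by omega)), h2 1 (by omega)]; push_cast; omega)
    (by rw [e1, h4 1 (by omega)]; push_cast; omega)
    (fun k hk => abs_le.2 ⟨by push_cast; omega, by push_cast; omega⟩)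
  obtain ⟨φ₄, h7, h8, hP₄⟩ := hP₃.extend hr (fun k => min (2 + (k : ℤ)) (4 - k))
    (by rw [r0, h5 _ (mq 1), h3 _ (mp 1), h1 _ (hmem 1), hφ 1 (by omega)]; push_cast; omega)
    (by rw [r1, h5 _ (mq 5), h3 _ (mp 5), h1 _ (hmem 5), hφ 5 (by omega)]; push_cast; omega)
    (fun k hk => abs_le.2 ⟨by push_cast; omega, by push_cast; omega⟩)
  obtain ⟨φ₅, h9, h10, hP₅⟩ := hP₄.extend hw (fun k => min (3 + (k : ℤ)) (5 - k))
    (by rw [w0, h7 _ (he.mem (by omega)), h6 1 (by omega)]; push_cast; omega)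
    (by rw [w1, h8 1 (by omega)]; push_cast; omega)
    (fun k hk => abs_le.2 ⟨by push_cast; omega, by push_cast; omega⟩)
  have hone : 1 ∈ Icc 1 (3 - 2) := ⟨le_rfl, by omega⟩
  refine ⟨_, w 1, hwf, hws, fun x hx => Or.inl (Or.inl (Or.inl (Or.inl (Or.inl hx)))),
    hw.mem (by omega), fun h => hw.out _ hone (Or.inl (Or.inl (Or.inl (Or.inl h)))),
    (hc.par hG 3).parity (hwp 1 (by omega)) (by omega), hP₅.far ?_, fun h => ?_⟩
  · rw [h9 _ (mr 3), h7 _ (me 3), h5 _ (mq 3), h3 _ (mp 3), h1 _ (hmem 3), hφ 3 (by omega),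
      h10 1 (by omega)]
    push_cast
    omega
  · rcases hw.clean _ hone _ (Or.inl (mr _)) h with h | h
    · rw [Nat.sub_self, w0] at h
      exact he.out 1 hone (h ▸ mq _)
    · replace h : c (3 + 3) = w (3 - 1) := h
      rw [w1] at h
      exact hr.out 1 hone (h ▸ me _)

lemma StrongCycle.farStart {c : ℕ → V} (hc : StrongCycle n G c) (hG : IsPoly n G col) :
    FarStart n G col c := by
  rcases hG.three_le.eq_or_lt with rfl | hn
  · exact hc.farStart_three hG
  · exact hc.farStart_of_four_le hG hn

end Cycles

/-! ### Infinite sequences of arcs and generic neighbours of cycle vertices. -/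

section Chains

variable {V : Type*} {G : SimpleGraph V} {n : ℕ} {col : V → Prop}

/-- The set obtained from `H` by adding the first `i` arcs. -/
def tower (n : ℕ) (H : Set V) (q : ℕ → ℕ → V) : ℕ → Set V
  | 0 => H
  | i + 1 => tower n H q i ∪ inner n (q i)

/-- A sequence of arcs, each going from a vertex of `H` to the first vertex of the arc before. -/
structure ArcChain (n : ℕ) (G : SimpleGraph V) (H : Set V) (q : ℕ → ℕ → V) : Prop where
  arc : ∀ i, CleanArc n G (tower n H q i) (q i)
  left : ∀ i, q i 0 ∈ H
  right : ∀ i, q (i + 1) (n - 1) = q i 1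
  strong : ∀ i, Strong n G (tower n H q i)

lemma mem_tower {H : Set V} {q : ℕ → ℕ → V} {i : ℕ} {x : V} :
    x ∈ tower n H q i ↔ x ∈ H ∨ ∃ j < i, x ∈ inner n (q j) := by
  induction i with
  | zero => simp [tower]
  | succ i ih =>
    rw [tower, mem_union, ih]
    constructor
    · rintro ((h | ⟨j, hj, h⟩) | h)
      · exact Or.inl h
      · exact Or.inr ⟨j, by omega, h⟩
      · exact Or.inr ⟨i, by omega, h⟩
    · rintro (h | ⟨j, hj, h⟩)
      · exact Or.inl (Or.inl h)
      · rcases Nat.lt_succ_iff_lt_or_eq.1 hj with hj | rfl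
        · exact Or.inl (Or.inr ⟨j, hj, h⟩)
        · exact Or.inr h

lemma tower_mono {H : Set V} {q : ℕ → ℕ → V} {i j : ℕ} (h : i ≤ j) :
    tower n H q i ⊆ tower n H q j := by
  intro x hx
  rw [mem_tower] at hx ⊢
  exact hx.imp_right fun ⟨k, hk, hx⟩ => ⟨k, hk.trans_le h, hx⟩

lemma tower_add {H : Set V} {q : ℕ → ℕ → V} (t i : ℕ) :
    tower n (tower n H q t) (fun j => q (t + j)) i = tower n H q (t + i) := by
  induction i with
  | zero => rfl
  | succ i ih => rw [tower, ih, ← add_assoc, tower]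

namespace ArcChain

variable {H : Set V} {q : ℕ → ℕ → V}

lemma not_mem (h : ArcChain n G H q) {i k : ℕ} (hk : k ∈ Icc 1 (n - 2)) : q i k ∉ H := fun hH =>
  (h.arc i).out k hk (mem_tower.2 (Or.inl hH))

lemma inj (h : ArcChain n G H q) {i j k l : ℕ} (hk : k ∈ Icc 1 (n - 2)) (hl : l ∈ Icc 1 (n - 2))
    (he : q i k = q j l) : i = j ∧ k = l := by
  rcases lt_trichotomy i j with hij | rfl | hij
  · exact absurd (mem_tower.2 (Or.inr ⟨i, hij, k, hk, he⟩)) ((h.arc j).out l hl)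
  · obtain ⟨k1, k2⟩ := hk
    obtain ⟨l1, l2⟩ := hl
    exact ⟨rfl, (h.arc i).inj k (by omega) l (by omega) he⟩
  · exact absurd (mem_tower.2 (Or.inr ⟨j, hij, l, hl, he.symm⟩)) ((h.arc i).out k hk)

/-- Cleanness of the own arc covers everything present when it is added. Of the later arcs only the
next one touches an earlier interior vertex, namely the first one, by its right end. -/
lemma nbr (h : ArcChain n G H q) {i s k : ℕ} (hk : k ∈ Icc 1 (n - 2)) {x : V}
    (hx : x ∈ tower n H q s) (ha : G.Adj (q i k) x) :
    x = q i (k - 1) ∨ x = q i (k + 1) ∨ (k = 1 ∧ i + 1 < s ∧ x = q (i + 1) (n - 2)) := by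
  by_cases hxi : x ∈ tower n H q (i + 1)
  · exact ((h.arc i).clean k hk x hxi ha).imp_right Or.inl
  · rw [mem_tower] at hx hxi
    push Not at hxi
    obtain ⟨j, hj, l, hl, rfl⟩ := hx.resolve_left hxi.1
    have hij : i + 1 ≤ j := by
      by_contra hlt
      exact hxi.2 j (by omega) ⟨l, hl, rfl⟩
    have hm : q i k ∈ tower n H q j := mem_tower.2 (Or.inr ⟨i, by omega, k, hk, rfl⟩)
    obtain ⟨l1, l2⟩ := hl
    rcases (h.arc j).clean l ⟨l1, l2⟩ _ (Or.inl hm) ha.symm with he | he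
    · by_cases h0 : l - 1 = 0
      · rw [h0] at he
        exact absurd (he ▸ h.left j) (h.not_mem hk)
      · exact absurd (he ▸ hm) ((h.arc j).out (l - 1) ⟨by omega, by omega⟩)
    · by_cases h0 : l + 1 = n - 1
      · obtain ⟨j, rfl⟩ : ∃ j', j = j' + 1 := ⟨j - 1, by omega⟩
        rw [h0, h.right j] at he
        obtain ⟨rfl, rfl⟩ := h.inj hk ⟨le_rfl, by omega⟩ he
        exact Or.inr (Or.inr ⟨rfl, hj, by rw [show l = n - 2 by omega]⟩)
      · exact absurd (he ▸ hm) ((h.arc j).out (l + 1) ⟨by omega, by omega⟩)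

/-- A set `D` with fewer vertices than there are arcs misses an arc `j`. If `D` meets a later arc,
it contains a loose vertex or a clean arc near the first such arc. If not, `D` is confined below arc
`j` and joined to `q s 1` only through its base vertex, so `q s 1` has no influence. -/
lemma goodFor (hn : 3 ≤ n) (h : ArcChain n G H q) {B D : Set V} {r s : ℕ} (hrs : r < s)
    (hBH : B ⊆ H) (hD : D.Finite) (hDr : D.ncard ≤ r) :
    GoodFor n G {q s 0} B (q s 1) D := by
  classical
  have hone : 1 ∈ Icc 1 (n - 2) := ⟨le_rfl, by omega⟩
  -- For `n = 3` the second neighbour of `q (i + 1) 1` is no interior vertex but the right end,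
  -- which is the first vertex of the arc before.
  have htop : ∀ i, q (i + 1) 2 ∉ tower n H q i ∧ (n = 3 → q (i + 1) 2 = q i 1) := by
    intro i
    rcases hn.eq_or_lt with rfl | hn'
    · have : q (i + 1) 2 = q i 1 := h.right i
      exact ⟨this ▸ (h.arc i).out 1 hone, fun _ => this⟩
    · exact ⟨fun hm => (h.arc (i + 1)).out 2 ⟨by omega, by omega⟩ (tower_mono (by omega) hm),
        fun h => by omega⟩
  obtain ⟨s, rfl⟩ : ∃ s', s = s' + 1 := ⟨s - 1, by omega⟩
  have hH : ∀ i, H ⊆ tower n H q i := fun i x hx => mem_tower.2 (Or.inl hx)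
  refine ⟨fun hB => h.not_mem hone (hBH hB), fun b hb => ?_, ?_⟩
  · rw [mem_singleton_iff]
    constructor
    · intro ha
      refine ((h.arc (s + 1)).clean 1 hone b (Or.inl (hH _ (hBH hb))) ha).resolve_right ?_
      rintro rfl
      exact (htop s).1 (hH _ (hBH hb))
    · rintro rfl
      exact ((h.arc (s + 1)).adj 0 (by omega)).symm
  intro B' hE hB' hdis hgD hfree
  by_contra hcl
  set g := q (s + 1) 1 with hg
  have hB'H : B' ⊆ H := hB'.trans hBH
  have hsub1 : insert g B' ⊆ tower n H q (s + 2) := by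
    rintro x (rfl | hx)
    · exact mem_tower.2 (Or.inr ⟨s + 1, by omega, 1, hone, rfl⟩)
    · exact hH _ (hB'H hx)
  have hDT := (h.strong (s + 2)).subset_of_not_free hsub1 hD hcl
  -- Pigeonhole: `D` has at most `r < s + 1` elements and the interiors are disjoint.
  obtain ⟨j, hj, hjD⟩ : ∃ j < s + 1, ∀ k ∈ Icc 1 (n - 2), q j k ∉ D := by
    by_contra hcon
    push Not at hcon
    choose! k hk hkD using hcon
    have hcard : ((Finset.range (s + 1)).image fun j => q j (k j)).card = s + 1 := by
      rw [Finset.card_image_of_injOn, Finset.card_range]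
      intro i hi j hj hij
      exact (h.inj (hk i (by simpa using hi)) (hk j (by simpa using hj)) hij).1
    have : ((Finset.range (s + 1)).image fun j => q j (k j)).card ≤ D.ncard := by
      rw [← ncard_coe_finset]
      refine ncard_le_ncard ?_ hD
      intro x hx
      obtain ⟨j, hj, rfl⟩ := Finset.mem_image.1 (Finset.mem_coe.1 hx)
      exact hkD j (by simpa using hj)
    omega
  set X := insert g B' ∪ D with hX
  have hXT : X ⊆ tower n H q (s + 2) := union_subset hsub1 hDT
  have hXmem : ∀ i k, k ∈ Icc 1 (n - 2) → q i k ∈ X → q i k ∈ D ∨ (i = s + 1 ∧ k = 1) := by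
    rintro i k hk ((he | hB) | hD)
    · exact Or.inr (h.inj hk hone he)
    · exact absurd (hB'H hB) (h.not_mem hk)
    · exact Or.inl hD
  by_cases hex : ∃ i, j < i ∧ i < s + 2 ∧ ∃ k ∈ Icc 1 (n - 2), q i k ∈ D
  · obtain ⟨hji, his, k₀, hk₀, hk₀D⟩ := Nat.find_spec hex
    have hmin := fun m => Nat.find_min hex (m := m)
    obtain ⟨i, hi⟩ : ∃ i, Nat.find hex = i + 1 := ⟨Nat.find hex - 1, by omega⟩
    rw [hi] at hji his hk₀D hmin
    have hprev : ∀ k ∈ Icc 1 (n - 2), q i k ∉ D := by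
      intro k hk hkD
      rcases Nat.lt_or_ge j i with hji' | hji'
      · exact hmin i (by omega) ⟨hji', by omega, k, hk, hkD⟩
      · obtain rfl : i = j := by omega
        exact hjD k hk hkD
    -- On the first arc met after a missed one, take the last vertex in `D`. Its successor is not
    -- present, so it is loose when `k ≥ 2`.
    obtain ⟨k, ⟨hk, hkD⟩, hkmax⟩ : ∃ k, (k ∈ Icc 1 (n - 2) ∧ q (i + 1) k ∈ D) ∧
        ∀ l ∈ Icc 1 (n - 2), q (i + 1) l ∈ D → l ≤ k := by
      have hb := Nat.findGreatest_spec (P := fun k => k ∈ Icc 1 (n - 2) ∧ q (i + 1) k ∈ D) hk₀.2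
        ⟨hk₀, hk₀D⟩
      exact ⟨_, hb, fun l hl hlD => Nat.le_findGreatest hl.2 ⟨hl, hlD⟩⟩
    obtain ⟨hk1, hk2⟩ := hk
    have hup : q (i + 1) (k + 1) ∉ X := by
      intro hm
      by_cases hkn : k + 1 ≤ n - 2
      · rcases hXmem _ _ ⟨by omega, hkn⟩ hm with hm | ⟨-, hm⟩
        · have := hkmax _ ⟨by omega, hkn⟩ hm
          omega
        · omega
      · rw [show k + 1 = n - 1 by omega, h.right] at hm
        rcases hXmem _ _ hone hm with hm | ⟨hm, -⟩
        · exact hprev 1 hone hm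
        · omega
    by_cases hk3 : 2 ≤ k
    · refine hcl (Or.inl ⟨_, hkD, fun x hx y hy ax ay => ?_⟩)
      have : ∀ x ∈ X, G.Adj (q (i + 1) k) x → x = q (i + 1) (k - 1) := by
        intro x hx ax
        rcases h.nbr ⟨hk1, hk2⟩ (hXT hx) ax with hx' | rfl | ⟨hx', -⟩
        · exact hx'
        · exact absurd hx hup
        · omega
      rw [this x hx ax, this y hy ay]
    · obtain rfl : k = 1 := by omega
      -- If this were the last arc, the vertex would be `q (s + 1) 1`, which is not in `D`.
      have his' : i + 2 < s + 2 := by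
        by_contra hcon
        obtain rfl : i = s := by omega
        exact hgD hkD
      -- When `k = 1`, continue backwards along the next arc, starting at its right end `q (i + 1)
      -- 1`. Each of these vertices has at most two neighbours present; so either one of them is
      -- loose or all `n - 2` form a clean arc in `D`.
      let P : ℕ → V := fun a => q (i + 2) (n - a)
      have hP1 : P 1 = q (i + 1) 1 := h.right (i + 1)
      have hPX : ∀ a, 2 ≤ a → a ≤ n - 2 → P a ∈ X → P a ∈ D := by
        intro a ha ha' hm
        exact (hXmem _ _ ⟨by omega, by omega⟩ hm).resolve_right fun hc => by omega
      have hPn : ∀ a, 1 ≤ a → a ≤ n - 2 → ∀ x ∈ X, G.Adj (P a) x →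
          x = P (a + 1) ∨ x = if a = 1 then q (i + 1) 0 else P (a - 1) := by
        intro a ha ha' x hx ax
        by_cases ha1 : a = 1
        · subst ha1
          rw [hP1] at ax
          rw [if_pos rfl]
          rcases h.nbr hone (hXT hx) ax with hx' | rfl | ⟨-, -, hx'⟩
          · exact Or.inr hx'
          · exact absurd hx hup
          · exact Or.inl hx'
        · rw [if_neg ha1]
          rcases h.nbr ⟨by omega, by omega⟩ (hXT hx) ax with hx' | hx' | ⟨hx', -⟩
          · exact Or.inl hx'
          · right
            rw [hx']
            show _ = q (i + 2) (n - (a - 1))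
            congr 1
            omega
          · omega
      have hPD : ∀ a, 1 ≤ a → a ≤ n - 2 → P a ∈ D := by
        intro a ha
        induction a, ha using Nat.le_induction with
        | base => exact fun _ => hP1 ▸ hkD
        | succ a ha ih =>
          intro ha'
          by_contra hout
          have hout' : P (a + 1) ∉ X := fun hm => hout (hPX _ (by omega) ha' hm)
          refine hcl (Or.inl ⟨_, ih (by omega), fun x hx y hy ax ay => ?_⟩)
          have hx' := (hPn a ha (by omega) x hx ax).resolve_left fun he => hout' (he ▸ hx)
          have hy' := (hPn a ha (by omega) y hy ay).resolve_left fun he => hout' (he ▸ hy)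
          rw [hx', hy']
      refine hcl (Or.inr ⟨P, ?_, fun a ha => ⟨hPD a ha.1 ha.2, ?_⟩, ?_⟩)
      · rintro a ⟨ha1, ha2⟩ b ⟨hb1, hb2⟩ hab
        have := (h.arc (i + 2)).inj _ (by omega) _ (by omega) hab
        omega
      · intro x hx y hy z hz ax ay az
        rcases hPn a ha.1 ha.2 x hx ax with hx | hx <;> rcases hPn a ha.1 ha.2 y hy ay with hy | hy <;>
          rcases hPn a ha.1 ha.2 z hz az with hz | hz <;> simp [hx, hy, hz]
      · intro a ha ha'
        have := (h.arc (i + 2)).adj (n - (a + 1)) (by omega)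
        rw [show n - (a + 1) + 1 = n - a by omega] at this
        exact this.symm
  · push Not at hex
    have hDs : D ⊆ tower n H q s := by
      intro x hx
      rcases mem_tower.1 (hDT hx) with hx' | ⟨i, hi, k, hk, rfl⟩
      · exact hH _ hx'
      · have hij : i ≤ j := by
          by_contra hcon
          exact hex i (by omega) hi k hk hx
        have : i ≠ j := by
          rintro rfl
          exact hjD k hk hx
        exact mem_tower.2 (Or.inr ⟨i, by omega, k, hk, rfl⟩)
    refine hcl (hfree.extend ?_)
    rintro v hv x ((rfl | hx) | hx) ax
    · rcases (h.arc (s + 1)).clean 1 hone v (Or.inl (tower_mono (by omega) (hDs hv))) ax.symm with rfl | rfl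
      · exact absurd hv (Set.disjoint_left.1 hdis (hE rfl))
      · exact absurd (hDs hv) (htop s).1
    · exact Or.inl hx
    · exact Or.inr hx

/-- The chain can be continued over every larger finite strong set. -/
lemma exists_over (hn : 3 ≤ n) (h : ArcChain n G H q) {H' : Set V} (hH' : H'.Finite)
    (hs : Strong n G H') (hHH : H ⊆ H') (h0 : q 0 (n - 1) ∈ H) :
    ∃ t, H' ⊆ tower n H' q t ∧ ArcChain n G (tower n H' q t) fun i => q (t + i) := by
  classical
  have hone : 1 ∈ Icc 1 (n - 2) := ⟨le_rfl, by omega⟩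
  have hright : ∀ i, q i (n - 1) ∈ tower n H' q i := by
    intro i
    cases i with
    | zero => exact hHH h0
    | succ i => exact mem_tower.2 (Or.inr ⟨i, by omega, 1, hone, (h.right i).symm⟩)
  have hleft : ∀ i, q i 0 ∈ tower n H' q i := fun i => mem_tower.2 (Or.inl (hHH (h.left i)))
  have hstr : ∀ i, Strong n G (tower n H' q i) := by
    intro i
    induction i with
    | zero => exact hs
    | succ i ih =>
      by_cases hout : ∃ k ∈ Icc 1 (n - 2), q i k ∉ tower n H' q i
      · exact (ih.cleanArc hn (h.arc i).toArcPath (hleft i) (hright i) hout).2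
      · push Not at hout
        rw [tower, union_eq_self_of_subset_right]
        · exact ih
        · rintro _ ⟨k, hk, rfl⟩
          exact hout k hk
  -- First vertices of different arcs are distinct, so only finitely many lie in the finite set
  -- `H'`. Earlier arcs may lie inside `H'` or be absorbed; later ones leave it and are clean.
  have hout : ∃ t, ∀ i ≥ t, q i 1 ∉ H' := by
    have hfin : {i | q i 1 ∈ H'}.Finite := by
      refine Set.Finite.of_finite_image (f := fun i => q i 1) (hH'.subset ?_) ?_
      · rintro _ ⟨i, hi, rfl⟩
        exact hi
      · intro i _ j _ hij
        exact (h.inj hone hone hij).1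
    obtain ⟨t, ht⟩ := hfin.bddAbove
    refine ⟨t + 1, fun i hi hm => ?_⟩
    have := ht hm
    omega
  obtain ⟨t, ht⟩ := hout
  have harc : ∀ i ≥ t, CleanArc n G (tower n H' q i) (q i) := by
    intro i hi
    refine ((hstr i).cleanArc hn (h.arc i).toArcPath (hleft i) (hright i) ⟨1, hone, ?_⟩).1
    intro hm
    rcases mem_tower.1 hm with hm | ⟨j, hj, k, hk, he⟩
    · exact ht i hi hm
    · have := (h.inj hk hone he).1
      omega
  refine ⟨t, fun x hx => mem_tower.2 (Or.inl hx), fun i => ?_, fun i => ?_, fun i => ?_, fun i => ?_⟩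
  · rw [tower_add]
    exact harc _ (by omega)
  · exact mem_tower.2 (Or.inl (hHH (h.left _)))
  · exact h.right _
  · rw [tower_add]
    exact hstr _

end ArcChain

lemma exists_isPath_of_injOn {p : ℕ → V} {i j : ℕ} (hij : i ≤ j) (hinj : InjOn p (Icc i j))
    (h : ∀ k, i ≤ k → k < j → G.Adj (p k) (p (k + 1))) :
    ∃ w : G.Walk (p i) (p j), w.length = j - i ∧ w.IsPath ∧
      ∀ x ∈ w.support, ∃ k, i ≤ k ∧ k ≤ j ∧ x = p k := by
  induction j, hij using Nat.le_induction with
  | base => exact ⟨.nil, by simp, .nil, fun x hx => ⟨i, le_rfl, le_rfl, by simpa using hx⟩⟩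
  | succ j hij ih =>
    obtain ⟨w, h1, h2, h3⟩ := ih (hinj.mono (Icc_subset_Icc_right (by omega)))
      fun k hk hk' => h k hk (by omega)
    have ha := h j hij (by omega)
    refine ⟨w.concat ha, by rw [Walk.length_concat]; omega, h2.concat (fun hm => ?_) ha, ?_⟩
    · obtain ⟨k, hk1, hk2, hk⟩ := h3 _ hm
      have := hinj ⟨by omega, le_rfl⟩ ⟨hk1, by omega⟩ hk
      omega
    · intro x hx
      rw [Walk.support_concat, List.mem_append] at hx
      rcases hx with hx | hx
      · obtain ⟨k, hk1, hk2, hk⟩ := h3 _ hx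
        exact ⟨k, hk1, by omega, hk⟩
      · exact ⟨j + 1, by omega, le_rfl, by simpa using hx⟩

namespace StrongCycle

variable {c : ℕ → V}

/-- The invariant of the construction of the chain. -/
structure ChainInv (n : ℕ) (G : SimpleGraph V) (col : V → Prop) (c : ℕ → V) (j : ℕ)
    (F : Set V) (z : V) : Prop where
  sub : range c ⊆ F
  strong : Strong n G F
  mem : z ∈ F
  notMem : z ∉ range c
  parity : (col (c (3 + j * n)) ↔ col z) ↔ Even (n - 1)
  far : Far n G F (c (3 + j * n)) z
  not_adj : ¬ G.Adj z (c (3 + (j + 1) * n))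

/-- The arc from `c (3 + j * n)` to `z` is added and its first vertex becomes the new target. The
next cycle vertex is `n` steps further, so the new target is again far from it. -/
lemma chain_step (hc : StrongCycle n G c) (hG : IsPoly n G col) {j : ℕ} {F : Set V} {z : V}
    (h : ChainInv n G col c j F z) : ∃ q : ℕ → V, CleanArc n G F q ∧ q 0 = c (3 + j * n) ∧
      q (n - 1) = z ∧ ChainInv n G col c (j + 1) (F ∪ inner n q) (q 1) := by
  have hn := hG.three_le
  have hm : ∀ i, c i ∈ F := fun i => h.sub ⟨i, rfl⟩
  obtain ⟨q, q0, q1, hq, hs⟩ := hG.exists_cleanArc h.strong (hm _) h.mem h.parity h.far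
  have hone : 1 ∈ Icc 1 (n - 2) := ⟨le_rfl, by omega⟩
  have e1 : 3 + (j + 1) * n = 3 + j * n + n := by ring
  have hadj := hq.adj 0 (by omega)
  rw [q0] at hadj
  refine ⟨q, hq, q0, q1, fun x hx => Or.inl (h.sub hx), hs, hq.mem (by omega),
    fun hx => hq.out 1 hone (h.sub hx), ?_, ?_, ?_⟩
  · have p1 := hc.par hG (3 + j * n)
    have p2 := hc.par hG (3 + (j + 1) * n)
    have p3 := Par.path hG.bip (p := q) (m := n - 1) (by rw [q0]; exact p1) (fun k hk => hq.adj k hk)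
      (k := 1) (by omega)
    exact p2.parity p3 (by omega)
  · -- the distance from `c (3 + (j + 1) * n)`
    obtain ⟨φ, hP, hφ0, hφT, hφw⟩ := FreePolygon.exists_pot (G := G) F (hm (3 + (j + 1) * n)) (n + 1)
    obtain ⟨P, hP1, hP2, hPF⟩ := exists_isPath_of_injOn (G := G) (p := c) (i := 3 + j * n)
      (j := 3 + (j + 1) * n) (by omega)
      (fun k hk l hl hkl => hc.eq_of_lt hkl (by have := hk.2; have := hl.1; omega)
        (by have := hk.1; have := hl.2; omega)) fun k _ _ => hc.adj k
    have hlen : P.length = n := by omega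
    have h1 : (n : ℤ) ≤ φ (c (3 + j * n)) := by
      refine hφw _ n (by omega) fun w _ => ?_
      by_contra hlt
      have := not_lt_of_isPath hG.girth P hP2 w.reverse (by rw [Walk.length_reverse]; omega)
      rw [Walk.length_reverse] at this
      omega
    have h2 : φ (c (3 + j * n)) ≤ n := by
      have := hP.walk P.reverse fun x hx => by
        rw [Walk.support_reverse, List.mem_reverse] at hx
        obtain ⟨k, -, -, rfl⟩ := hPF x hx
        exact hm k
      rwa [hφ0, Walk.length_reverse, hlen, zero_add] at this
    have h3 : (2 : ℤ) ≤ φ z := by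
      refine hφw _ 2 (by omega) fun w _ => ?_
      by_contra hlt
      cases w with
      | nil => exact h.notMem ⟨_, rfl⟩
      | cons ha w =>
        cases w with
        | nil => exact h.not_adj ha.symm
        | cons ha' w =>
          rw [Walk.length_cons, Walk.length_cons] at hlt
          omega
    have h4 := (hφT z).2
    push_cast at h4
    obtain ⟨φ', e1', e2, hP'⟩ := hP.extend hq
      -- Here `φ` is the distance from the next cycle vertex, cut off at `n + 1`; it is `n` at the
      -- left end and at least `2` at `z`. Truncated subtraction keeps the value `n` at both `i = 0`
      -- and `i = 1`; the value then moves to `φ z` in the remaining `n - 2` steps.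
      (fun i => max (min (φ z) (n + (i - 1 : ℕ))) (n - (i - 1 : ℕ)))
      (by rw [q0]; push_cast; omega) (by rw [q1]; omega)
      (fun k hk => abs_le.2 ⟨by push_cast; omega, by push_cast; omega⟩)
    refine hP'.far ?_
    rw [e1' _ (hm _), hφ0, e2 1 (by omega)]
    push_cast
    omega
  · intro ha
    have e2 : 3 + (j + 1 + 1) * n = 3 + j * n + 2 * n := by ring
    rw [e2] at ha
    rcases hq.clean 1 hone _ (Or.inl (hm _)) ha with he | he
    · rw [Nat.sub_self, q0] at he
      -- The two cycle vertices are `2n` places apart, and the cycle has length `2n + 2`.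
      have := hc.eq_of_lt he (by omega) (by omega)
      omega
    · by_cases hn3 : n = 3
      · subst hn3
        exact h.notMem ⟨_, he.trans q1⟩
      · exact hq.out 2 ⟨by omega, by omega⟩ (he ▸ hm _)

lemma exists_chain (hc : StrongCycle n G c) (hG : IsPoly n G col) :
    ∃ (F : Set V) (q : ℕ → ℕ → V), F.Finite ∧ q 0 (n - 1) ∈ F ∧ ArcChain n G F q ∧ range c ⊆ F ∧
      ∀ i, q i 0 = c (3 + i * n) := by
  obtain ⟨F, z, hF, hs, hsub, hz, hzc, hpar, hfar, hadj⟩ := hc.farStart hG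
  have h0 : ChainInv n G col c 0 F z :=
    ⟨hsub, hs, hz, hzc, by simpa using hpar, by simpa using hfar, by simpa using hadj⟩
  have hstep : ∀ (j : ℕ) (s : Set V × V), ∃ q : ℕ → V, ChainInv n G col c j s.1 s.2 →
      CleanArc n G s.1 q ∧ q 0 = c (3 + j * n) ∧ q (n - 1) = s.2 ∧
        ChainInv n G col c (j + 1) (s.1 ∪ inner n q) (q 1) := by
    intro j s
    by_cases h : ChainInv n G col c j s.1 s.2
    · obtain ⟨q, hq⟩ := hc.chain_step hG h
      exact ⟨q, fun _ => hq⟩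
    · exact ⟨c, fun h' => absurd h' h⟩
  choose Q hQ using hstep
  let s : ℕ → Set V × V := fun j =>
    Nat.rec (F, z) (fun j s => (s.1 ∪ inner n (Q j s), Q j s 1)) j
  have hs' : ∀ j, ChainInv n G col c j (s j).1 (s j).2 := by
    intro j
    induction j with
    | zero => exact h0
    | succ j ih => exact (hQ j (s j) ih).2.2.2
  have htower : ∀ j, tower n F (fun j => Q j (s j)) j = (s j).1 := by
    intro j
    induction j with
    | zero => rfl
    | succ j ih => rw [tower, ih]
  refine ⟨F, fun j => Q j (s j), hF, ?_, ⟨fun i => ?_, fun i => ?_, fun i => ?_, fun i => ?_⟩, hsub,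
    fun i => (hQ i (s i) (hs' i)).2.1⟩
  · exact (congrArg (· ∈ F) (hQ 0 (s 0) (hs' 0)).2.2.1).mpr hz
  · rw [htower]
    exact (hQ i (s i) (hs' i)).1
  · exact (congrArg (· ∈ F) (hQ i (s i) (hs' i)).2.1).mpr (hsub ⟨_, rfl⟩)
  · exact (hQ (i + 1) (s (i + 1)) (hs' (i + 1))).2.2.1
  · rw [htower]
    exact (hs' i).strong

/-- The chain is resumed over a finite strong set containing `B`. Arcs start at `c (3 + i * n)`, so
they return to `c 3` periodically, and one late enough for `r` is taken. -/
lemma exists_goodFor (hc : StrongCycle n G c) (hG : IsPoly n G col)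
    (hfin : ∀ A : Set V, A.Finite → ∃ H, A ⊆ H ∧ H.Finite ∧ Strong n G H) {B : Set V}
    (hB : B.Finite) (r : ℕ) : ∃ g, G.Adj g (c 3) ∧ ∀ D : Set V, D.Finite → D.ncard ≤ r →
      GoodFor n G {c 3} B g D := by
  have hn := hG.three_le
  obtain ⟨F, q, hF, hq0, hq, -, hqc⟩ := hc.exists_chain hG
  obtain ⟨H, hH, hHfin, hHs⟩ := hfin (F ∪ B) (hF.union hB)
  obtain ⟨t, ht, hchain⟩ := hq.exists_over hn hHfin hHs (subset_union_left.trans hH) hq0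
  -- The index equals `(2n + 2)(t + r + 1)`, a multiple of the length of the cycle, and beyond `t`
  -- it exceeds `r`.
  have e : q (t + ((2 * n + 1) * t + (2 * n + 2) * (r + 1))) 0 = c 3 := by
    rw [hqc, ← hc.shift_mul 3 ((t + (r + 1)) * n)]
    congr 1
    ring
  refine ⟨_, ?_, fun D hD hDr => e ▸ hchain.goodFor hn (s := (2 * n + 1) * t + (2 * n + 2) * (r + 1))
    (r := r) ?_ ((subset_union_right.trans hH).trans ht) hD hDr⟩
  · have := (hq.arc (t + ((2 * n + 1) * t + (2 * n + 2) * (r + 1)))).adj 0 (by omega)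
    rw [e] at this
    exact this.symm
  · nlinarith

end StrongCycle

end Chains

/-! ### From generic neighbours to generic isolated vertices. -/

section LooseEnds

variable {M : Type} [bipLang.Structure M] {n : ℕ} {c : ℕ → M}

lemma StrongCycle.shift_add {V : Type*} {G : SimpleGraph V} {c : ℕ → V} (hc : StrongCycle n G c)
    (a : ℕ) : StrongCycle n G fun i => c (i + a) := by
  induction a with
  | zero => exact hc
  | succ a ih =>
    have := ih.shift
    simpa only [add_right_comm, add_assoc] using this

lemma StrongCycle.gen (hM : IsGon n M) (hc : StrongCycle n (gr M) c)
    (hfin : ∀ A : Set M, A.Finite → ∃ H, A ⊆ H ∧ H.Finite ∧ Strong n (gr M) H) (i : ℕ) :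
    Gen n M {c i} (¬ col (c i)) := by
  intro B hB _ r
  have hn := hM.three_le
  -- The cycle is rotated so that `c i` takes the place of `c 3`; the extra turn keeps the
  -- subtraction honest.
  have e : c (3 + (i + (2 * n + 2) * 1 - 3)) = c i := by
    rw [← hc.shift_mul i 1]
    congr 1
    omega
  obtain ⟨g, hg, hgood⟩ := (hc.shift_add (i + (2 * n + 2) * 1 - 3)).exists_goodFor hM hfin hB r
  simp only [e] at hg hgood
  refine ⟨g, hM.bip _ _ hg, fun D => hgood _ (finite_range D) ?_⟩
  rw [← image_univ]
  refine (ncard_image_le finite_univ).trans ?_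
  simp

/-- A path of generic vertices that starts at `u` and has length `j`. -/
def LoosePath (n : ℕ) (M : Type) [bipLang.Structure M] (u : M) (j : ℕ) : Prop :=
  ∃ (N : Type) (_ : bipLang.Structure N) (f : M ↪ₑ[bipLang] N) (z : ℕ → N), z 0 = f u ∧
    InjOn z (Icc 0 j) ∧ (∀ i < j, (gr N).Adj (z i) (z (i + 1))) ∧
    (∀ i ∈ Icc 1 j, z i ∉ range f) ∧ Strong n (gr N) (range f ∪ z '' Icc 1 j) ∧
    ∀ i ∈ Icc 1 j, ∀ x ∈ range f ∪ z '' Icc 1 j, (gr N).Adj (z i) x →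
      x = z (i - 1) ∨ (i + 1 ≤ j ∧ x = z (i + 1))

lemma LoosePath.zero (u : M) : LoosePath n M u 0 := by
  refine ⟨M, inferInstance, ElementaryEmbedding.refl bipLang M, fun _ => u, rfl, ?_, ?_, ?_, ?_, ?_⟩
  · intro i hi j hj _
    have := hi.2
    have := hj.2
    omega
  · intro i hi
    omega
  · intro i hi
    have := hi.1
    have := hi.2
    omega
  · intro C _ ⟨x, hx⟩ hdis
    exact absurd hx (Set.disjoint_left.1 hdis (Or.inl ⟨x, rfl⟩))
  · intro i hi
    have := hi.1
    have := hi.2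
    omega

/-- Walking back `n - j` places on the cycle from `c i` gives a path of length `n` from some `c k`
to the end `z j`. By the girth the two are at distance at least `n - 1`, so `Gen.single` moves
genericity from neighbours of `c k` to neighbours of `z j`. -/
lemma LoosePath.succ (hM : IsGon n M) (hc : StrongCycle n (gr M) c)
    (hfin : ∀ A : Set M, A.Finite → ∃ H, A ⊆ H ∧ H.Finite ∧ Strong n (gr M) H) {i j : ℕ}
    (hj : j < n) (h : LoosePath n M (c i) j) : LoosePath n M (c i) (j + 1) := by
  classical
  have hn := hM.three_le
  obtain ⟨N, _, f, z, z0, zinj, zadj, zout, zs, zclean⟩ := h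
  have : Nonempty M := ⟨c 0⟩
  have : Nonempty N := ⟨z 0⟩
  have hN := hM.of_elementary f
  set k := i + (2 * n + 2) - (n - j) with hk
  have ek : c (k + (n - j)) = c i := by
    rw [← hc.periodic i]
    congr 1
    omega
  -- the path from `f (c k)` to `z j`
  let p : ℕ → N := fun l => if l < n - j then f (c (k + l)) else z (l - (n - j))
  have pz : ∀ l, n - j ≤ l → p l = z (l - (n - j)) := fun l hl => if_neg (by omega)
  have pc : ∀ l ≤ n - j, p l = f (c (k + l)) := by
    intro l hl
    rcases hl.lt_or_eq with hl | rfl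
    · exact if_pos hl
    · rw [pz _ le_rfl, Nat.sub_self, z0, ek]
  have pinj : InjOn p (Icc 0 n) := by
    have aux : ∀ l ≤ n - j, ∀ m, n - j < m → m ≤ n → p l ≠ p m := by
      intro l hl m hm hm' he
      rw [pc l hl, pz m hm.le] at he
      exact zout (m - (n - j)) ⟨by omega, by omega⟩ ⟨_, he⟩
    intro l hl m hm he
    rcases Nat.lt_or_ge (n - j) l with h1 | h1 <;> rcases Nat.lt_or_ge (n - j) m with h2 | h2
    · rw [pz l h1.le, pz m h2.le] at he
      have := zinj ⟨by omega, by have := hl.2; omega⟩ ⟨by omega, by have := hm.2; omega⟩ he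
      omega
    · exact absurd he.symm (aux m h2 l h1 hl.2)
    · exact absurd he (aux l h1 m h2 hm.2)
    · rw [pc l h1, pc m h2] at he
      have := hc.eq_of_lt (f.injective he) (by omega) (by omega)
      omega
  have padj : ∀ l < n, (gr N).Adj (p l) (p (l + 1)) := by
    intro l hl
    rcases Nat.lt_or_ge l (n - j) with h1 | h1
    · rw [pc l h1.le, pc (l + 1) h1]
      exact (map_adj f.toEmbedding _ _).2 (hc.adj _)
    · rw [pz l h1, pz (l + 1) (by omega)]
      have := zadj (l - (n - j)) (by omega)
      rwa [show l + 1 - (n - j) = l - (n - j) + 1 by omega]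
  have p0 : p 0 = f (c k) := pc 0 (by omega)
  have pn : p n = z j := by
    rw [pz n (by omega)]
    congr 1
    omega
  have hgen : Gen n N {z j} (¬ col (z j)) := by
    have h1 := (hc.gen hM hfin k).map hn (finite_singleton _) f
    rw [image_singleton] at h1
    refine h1.single hN subsingleton_singleton ?_ ?_
    · have h3 : Par col (p 0) (p 0) 0 := by simp [Par]
      have h4 := h3.path hN.bip padj le_rfl
      have h5 : col (f (c k)) ↔ col (c k) := map_col f.toEmbedding _
      rw [Par, pn, p0, h5, zero_add] at h4
      have h6 : Even n ↔ ¬ Even (n - 1) := by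
        rw [← Nat.even_add_one, Nat.sub_add_cancel (by omega)]
      rw [h4]
      tauto
    · rintro _ rfl w
      by_contra hlt
      obtain ⟨P, hP1, hP2, -⟩ := exists_isPath_of_injOn (G := gr N) (Nat.zero_le n) pinj
        fun l _ hl => padj l hl
      have := not_lt_of_isPath hN.girth P hP2 (w.copy p0.symm pn.symm) (by
        rw [Walk.length_copy]; omega)
      rw [Walk.length_copy] at this
      omega
  obtain ⟨L, _, f', g, hg, -, hga, hgs⟩ := hgen.genExt hN (finite_singleton _)
  let z' : ℕ → L := fun l => if l ≤ j then f' (z l) else g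
  have zl : ∀ l ≤ j, z' l = f' (z l) := fun l hl => if_pos hl
  have zg : z' (j + 1) = g := if_neg (by omega)
  have hset : range (f'.comp f) ∪ z' '' Icc 1 (j + 1) =
      insert g (f' '' (range f ∪ z '' Icc 1 j)) := by
    ext x
    constructor
    · rintro (⟨m, rfl⟩ | ⟨l, ⟨l1, l2⟩, rfl⟩)
      · exact Or.inr ⟨_, Or.inl ⟨m, rfl⟩, rfl⟩
      · rcases l2.lt_or_eq with l2 | rfl
        · exact Or.inr ⟨_, Or.inr ⟨l, ⟨l1, by omega⟩, rfl⟩, (zl l (by omega)).symm⟩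
        · exact Or.inl zg
    · rintro (rfl | ⟨_, ⟨m, rfl⟩ | ⟨l, ⟨l1, l2⟩, rfl⟩, rfl⟩)
      · exact Or.inr ⟨j + 1, ⟨by omega, le_rfl⟩, zg⟩
      · exact Or.inl ⟨m, rfl⟩
      · exact Or.inr ⟨l, ⟨l1, by omega⟩, zl l l2⟩
  refine ⟨L, inferInstance, f'.comp f, z', ?_, ?_, ?_, ?_, ?_, ?_⟩
  · rw [zl 0 (Nat.zero_le _), z0]
    rfl
  · rintro l ⟨-, hl⟩ m ⟨-, hm⟩ he
    rcases hl.lt_or_eq with hl | rfl <;> rcases hm.lt_or_eq with hm | rfl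
    · rw [zl l (by omega), zl m (by omega)] at he
      exact zinj ⟨by omega, by omega⟩ ⟨by omega, by omega⟩ (f'.injective he)
    · rw [zl l (by omega), zg] at he
      exact absurd ⟨_, he⟩ hg
    · rw [zl m (by omega), zg] at he
      exact absurd ⟨_, he.symm⟩ hg
    · rfl
  · intro l hl
    rcases (Nat.lt_succ_iff.1 hl).lt_or_eq with hl | rfl
    · rw [zl l hl.le, zl (l + 1) hl]
      exact (map_adj f'.toEmbedding _ _).2 (zadj l hl)
    · rw [zg, zl l le_rfl]
      exact ((hga _).2 rfl).symm
  · rintro l ⟨l1, l2⟩ ⟨m, hm⟩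
    rcases l2.lt_or_eq with l2 | rfl
    · rw [zl l (by omega)] at hm
      exact zout l ⟨l1, by omega⟩ ⟨m, f'.injective hm⟩
    · exact hg ⟨f m, hm.trans zg⟩
  · rw [hset]
    refine zs.insert_image f'.toEmbedding hn hg (fun m hm => ?_) hgs
    have := (hga m).1 hm
    rw [mem_singleton_iff] at this
    subst this
    rcases Nat.eq_zero_or_pos j with rfl | hj0
    · exact Or.inl ⟨_, z0.symm⟩
    · exact Or.inr ⟨j, ⟨hj0, le_rfl⟩, rfl⟩
  · rintro l ⟨l1, l2⟩ x hx ax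
    rw [hset] at hx
    rcases l2.lt_or_eq with l2 | rfl
    · rw [zl l (by omega)] at ax
      rw [zl (l - 1) (by omega)]
      rcases hx with rfl | ⟨y, hy, rfl⟩
      · have := (hga _).1 ax.symm
        have := zinj ⟨by omega, by omega⟩ ⟨by omega, le_rfl⟩ this
        subst this
        exact Or.inr ⟨le_rfl, zg.symm⟩
      · rcases zclean l ⟨l1, by omega⟩ y hy ((map_adj f'.toEmbedding _ _).1 ax) with rfl | ⟨h1, rfl⟩
        · exact Or.inl rfl
        · exact Or.inr ⟨by omega, (zl (l + 1) h1).symm⟩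
    · rw [zg] at ax
      rcases hx with rfl | ⟨y, hy, rfl⟩
      · exact absurd ax (gr L).irrefl
      · left
        have : y = z j := (hga _).1 ax
        rw [this, Nat.add_sub_cancel, zl j le_rfl]

/-- A polygon with a strong cycle of length `2n + 2` has generic isolated vertices. -/
lemma StrongCycle.rich (hb : IsBip M) (hM : IsGon n M) (hc : StrongCycle n (gr M) c)
    (hfin : ∀ A : Set M, A.Finite → ∃ H, A ⊆ H ∧ H.Finite ∧ Strong n (gr M) H) : Rich n M := by
  have hn := hM.three_le
  refine ⟨hb, hM, fun τ => ?_⟩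
  -- The starting point is chosen on the cycle so that the end of a path of length `n - 1` has
  -- colour `τ`; two consecutive vertices offer both colours.
  obtain ⟨i, hi⟩ : ∃ i, (col (c i) ↔ Even (n - 1)) ↔ τ := by
    have := hM.bip _ _ (hc.adj 0)
    by_cases h : (col (c 0) ↔ Even (n - 1)) ↔ τ
    · exact ⟨0, h⟩
    · refine ⟨1, ?_⟩
      rw [zero_add] at this
      tauto
  have hall : ∀ j ≤ n, LoosePath n M (c i) j := by
    intro j hj
    induction j with
    | zero => exact LoosePath.zero _
    | succ j ih => exact (ih (by omega)).succ hM hc hfin (by omega)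
  obtain ⟨N, _, f, z, z0, zinj, zadj, zout, zs, zclean⟩ := hall (n - 1) (by omega)
  have : Nonempty M := ⟨c 0⟩
  have hN := hM.of_elementary f
  have hset : insert (z (n - 1)) (range f) ∪ inner n z = range f ∪ z '' Icc 1 (n - 1) := by
    ext x
    constructor
    · rintro ((rfl | hx) | ⟨l, ⟨l1, l2⟩, rfl⟩)
      · exact Or.inr ⟨n - 1, ⟨by omega, le_rfl⟩, rfl⟩
      · exact Or.inl hx
      · exact Or.inr ⟨l, ⟨l1, by omega⟩, rfl⟩
    · rintro (hx | ⟨l, ⟨l1, l2⟩, rfl⟩)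
      · exact Or.inl (Or.inr hx)
      · rcases l2.lt_or_eq with l2 | rfl
        · exact Or.inr ⟨l, ⟨l1, by omega⟩, rfl⟩
        · exact Or.inl (Or.inl rfl)
  refine GenExt.gen hn ⟨N, inferInstance, f, z (n - 1), zout _ ⟨by omega, le_rfl⟩, ?_, ?_, ?_⟩
  · have h3 : Par col (z 0) (z 0) 0 := by simp [Par]
    have h4 := h3.path hN.bip zadj le_rfl
    have h5 : col (f (c i)) ↔ col (c i) := map_col f.toEmbedding _
    rw [Par, z0, h5, zero_add] at h4
    rw [h4, hi]
  · intro m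
    simp only [mem_empty_iff_false, iff_false]
    intro ha
    rcases zclean _ ⟨by omega, le_rfl⟩ _ (Or.inl ⟨m, rfl⟩) ha with h | ⟨h, -⟩
    · exact zout _ ⟨by omega, by omega⟩ ⟨m, h⟩
    · omega
  · refine Strong.of_arc (q := z) ?_ ?_ ?_ ?_ (hset ▸ zs)
    · exact zinj.mono (Icc_subset_Icc (by omega) (by omega))
    · exact fun l _ hl => zadj l (by omega)
    · rintro l ⟨l1, l2⟩ (h | h)
      · have := zinj ⟨by omega, by omega⟩ ⟨by omega, le_rfl⟩ h
        omega
      · exact zout l ⟨l1, by omega⟩ h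
    · rintro l ⟨l1, l2⟩ x hx ax
      rw [hset] at hx
      exact (zclean l ⟨l1, by omega⟩ x hx ax).imp_right And.right

end LooseEnds

/-! ### Adjacency between names of arc vertices. -/

section Terms

variable {n : ℕ} {V : Type*} {H : SimpleGraph V}

/-- The vertices of the arc put in between `a` and `b`, including its ends. -/
def arcPt (a b : ArcTerm n V) (m : ℕ) : ArcTerm n V :=
  if m = 0 then a else if h : m - 1 < n - 2 then .arc a b ⟨m - 1, h⟩ else b

@[simp] lemma arcPt_zero (a b : ArcTerm n V) : arcPt a b 0 = a := if_pos rfl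

lemma arcPt_succ (a b : ArcTerm n V) (j : Fin (n - 2)) : arcPt a b (j.1 + 1) = .arc a b j := by
  rw [arcPt, if_neg (by omega), dif_pos (by simp)]
  rfl

lemma arcPt_of_mem {a b : ArcTerm n V} {m : ℕ} (h1 : 1 ≤ m) (h2 : m ≤ n - 2) :
    arcPt a b m = .arc a b ⟨m - 1, by omega⟩ := by
  rw [arcPt, if_neg (by omega), dif_pos (by omega)]

lemma arcPt_last (hn : 3 ≤ n) (a b : ArcTerm n V) : arcPt a b (n - 1) = b := by
  rw [arcPt, if_neg (by omega), dif_neg (by omega)]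

/-- The depth of the construction of a name. -/
def rank : ArcTerm n V → ℕ
  | .base _ => 0
  | .arc a b _ => max (rank a) (rank b) + 1

lemma Joined.ne {x y : ArcTerm n V} (h : Joined H x y) : x ≠ y := by
  intro he
  cases h with
  | base h => exact h.ne (by injection he)
  | first a b j h =>
    have := congrArg rank he
    simp only [rank] at this
    omega
  | step a b i j h =>
    injection he with _ _ he
    subst he
    omega
  | last a b j h =>
    have := congrArg rank he
    simp only [rank] at this
    omega

lemma Joined.adj {x y : ArcTerm n V} (h : Joined H x y) : (termGraph n H).Adj x y := by
  rw [termGraph, SimpleGraph.fromRel_adj]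
  exact ⟨h.ne, Or.inl h⟩

lemma arcPt_joined (hn : 3 ≤ n) (a b : ArcTerm n V) {m : ℕ} (hm : m < n - 1) :
    Joined H (arcPt a b m) (arcPt a b (m + 1)) := by
  by_cases h0 : m = 0
  · subst h0
    rw [arcPt_zero, zero_add, arcPt_of_mem le_rfl (by omega)]
    exact .first _ _ _ rfl
  · by_cases h1 : m = n - 2
    · subst h1
      rw [show n - 2 + 1 = n - 1 by omega, arcPt_last hn, arcPt_of_mem (by omega) le_rfl]
      exact .last _ _ _ (by simp only; omega)
    · rw [arcPt_of_mem (by omega) (by omega), arcPt_of_mem (by omega) (by omega)]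
      exact .step _ _ _ _ (by simp only; omega)

lemma arcPt_adj (hn : 3 ≤ n) (a b : ArcTerm n V) {m : ℕ} (hm : m < n - 1) :
    (termGraph n H).Adj (arcPt a b m) (arcPt a b (m + 1)) := (arcPt_joined hn a b hm).adj

lemma Joined.cases (hn : 3 ≤ n) {x y : ArcTerm n V} (h : Joined H x y) :
    (∃ u v, H.Adj u v ∧ x = .base u ∧ y = .base v) ∨
      ∃ a b m, m < n - 1 ∧ x = arcPt a b m ∧ y = arcPt a b (m + 1) := by
  cases h with
  | base h => exact Or.inl ⟨_, _, h, rfl, rfl⟩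
  | first a b j h =>
    exact Or.inr ⟨_, _, 0, by omega, (arcPt_zero _ _).symm, by rw [← arcPt_succ, h]⟩
  | step a b i j h =>
    refine Or.inr ⟨a, b, i.1 + 1, by omega, (arcPt_succ _ _ _).symm, ?_⟩
    rw [← arcPt_succ, ← h]
  | last a b j h =>
    refine Or.inr ⟨_, _, j.1 + 1, by omega, (arcPt_succ _ _ _).symm, ?_⟩
    rw [show j.1 + 1 + 1 = n - 1 by omega, arcPt_last hn]

/-- A neighbour of an interior vertex of an arc is its neighbour on the arc, or has greater rank
and is attached to this vertex. -/
lemma adj_arc {a b y : ArcTerm n V} (hn : 3 ≤ n) {m : ℕ} (h1 : 1 ≤ m) (h2 : m ≤ n - 2)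
    (h : (termGraph n H).Adj (arcPt a b m) y) :
    y = arcPt a b (m - 1) ∨ y = arcPt a b (m + 1) ∨
      ∃ c d j, y = .arc c d j ∧ (c = arcPt a b m ∨ d = arcPt a b m) := by
  have harc := arcPt_of_mem (a := a) (b := b) h1 h2
  rw [termGraph, SimpleGraph.fromRel_adj] at h
  have key : ∀ (c d : ArcTerm n V) (l : ℕ), 1 ≤ l → l ≤ n - 2 → arcPt a b m = arcPt c d l →
      a = c ∧ b = d ∧ m = l := by
    intro c d l l1 l2 he
    rw [harc, arcPt_of_mem l1 l2] at he
    injection he with e1 e2 e3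
    refine ⟨e1, e2, ?_⟩
    have := congrArg Fin.val e3
    simp only at this
    omega
  rcases h.2 with h | h
  · rcases h.cases hn with ⟨u, v, -, hu, -⟩ | ⟨c, d, l, hl, hx, hy⟩
    · rw [harc] at hu
      cases hu
    · by_cases l0 : l = 0
      · subst l0
        rw [arcPt_zero] at hx
        rw [arcPt_of_mem (by omega) (by omega)] at hy
        exact Or.inr (Or.inr ⟨c, d, _, hy, Or.inl hx.symm⟩)
      · obtain ⟨rfl, rfl, rfl⟩ := key c d l (by omega) (by omega) hx
        exact Or.inr (Or.inl hy)
  · rcases h.cases hn with ⟨u, v, -, -, hu⟩ | ⟨c, d, l, hl, hy, hx⟩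
    · rw [harc] at hu
      cases hu
    · by_cases l0 : l = n - 2
      · subst l0
        rw [show n - 2 + 1 = n - 1 by omega, arcPt_last hn] at hx
        rw [arcPt_of_mem (by omega) (by omega)] at hy
        exact Or.inr (Or.inr ⟨c, d, _, hy, Or.inr hx.symm⟩)
      · obtain ⟨rfl, rfl, rfl⟩ := key c d (l + 1) (by omega) (by omega) hx
        exact Or.inl hy

lemma adj_base {u : V} {y : ArcTerm n V} (h : (termGraph n H).Adj (.base u) y) :
    (∃ v, H.Adj u v ∧ y = .base v) ∨ ∃ c d j, y = .arc c d j ∧ (c = .base u ∨ d = .base u) := by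
  rw [termGraph, SimpleGraph.fromRel_adj] at h
  rcases h with ⟨-, h | h⟩
  · cases h with
    | base h => exact Or.inl ⟨_, h, rfl⟩
    | first _ b j h => exact Or.inr ⟨_, _, _, rfl, Or.inl rfl⟩
  · cases h with
    | base h => exact Or.inl ⟨_, h.symm, rfl⟩
    | last a b j h => exact Or.inr ⟨_, _, _, rfl, Or.inr rfl⟩

lemma rank_arcPt {a b : ArcTerm n V} {m : ℕ} (h1 : 1 ≤ m) (h2 : m ≤ n - 2) :
    rank (arcPt a b m) = max (rank a) (rank b) + 1 := by
  rw [arcPt_of_mem h1 h2, rank]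

/-- With the interior of an arc, the set contains one vertex of it only if it contains all of it
and the ends. -/
structure ArcClosed (A : Set (ArcTerm n V)) : Prop where
  left : ∀ a b j, ArcTerm.arc a b j ∈ A → a ∈ A
  right : ∀ a b j, ArcTerm.arc a b j ∈ A → b ∈ A
  all : ∀ a b j j', ArcTerm.arc a b j ∈ A → ArcTerm.arc a b j' ∈ A

lemma ArcClosed.arcPt_mem {A : Set (ArcTerm n V)} (h : ArcClosed A) {a b : ArcTerm n V}
    {j : Fin (n - 2)} (hj : ArcTerm.arc a b j ∈ A) (m : ℕ) : arcPt a b m ∈ A := by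
  rw [arcPt]
  split_ifs
  · exact h.left _ _ _ hj
  · exact h.all _ _ _ _ hj
  · exact h.right _ _ _ hj

end Terms

/-! ### Sets of names closed under ingredients are strong. -/

section DownSets

variable {n : ℕ}

/-- A set of names that is closed under the ingredients of its elements. -/
structure DownSet (A : Set (ArcTerm n ℕ)) : Prop extends ArcClosed A where
  base : ∀ x, ArcTerm.base (x + 1) ∈ A → ArcTerm.base x ∈ A

/-- A name of greatest rank in `C` has nothing attached to it in `A ∪ C`. If it lies on an arc,
either the whole arc is in `C` and is clean, or some vertex at a gap is loose. If all of `C`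
consists of original vertices, the last one has at most its predecessor as neighbour. -/
lemma DownSet.strong (hn : 3 ≤ n) {A : Set (ArcTerm n ℕ)} (hA : DownSet A) :
    Strong n (termGraph n (hasse ℕ)) A := by
  classical
  intro C hC hne hdis
  obtain ⟨x, hx, hmax⟩ := exists_max_image C rank hC hne
  have hxA : ∀ y ∈ C, y ∉ A := fun y hy h => Set.disjoint_left.1 hdis h hy
  cases x with
  | arc a b j =>
    have hout : ∀ m, 1 ≤ m → m ≤ n - 2 → arcPt a b m ∉ A := by
      intro m h1 h2 hm
      rw [arcPt_of_mem h1 h2] at hm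
      exact hxA _ hx (hA.all _ _ _ _ hm)
    have hnbr : ∀ m, 1 ≤ m → m ≤ n - 2 → ∀ y ∈ A ∪ C, (termGraph n (hasse ℕ)).Adj (arcPt a b m) y →
        y = arcPt a b (m - 1) ∨ y = arcPt a b (m + 1) := by
      intro m h1 h2 y hy ha
      rcases adj_arc hn h1 h2 ha with h | h | ⟨c, d, l, rfl, h⟩
      · exact Or.inl h
      · exact Or.inr h
      · exfalso
        rcases hy with hy | hy
        · rcases h with rfl | rfl
          · exact hout m h1 h2 (hA.left _ _ _ hy)
          · exact hout m h1 h2 (hA.right _ _ _ hy)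
        · have h3 := hmax _ hy
          have h4 := rank_arcPt (a := a) (b := b) h1 h2
          simp only [rank] at h3
          rcases h with rfl | rfl <;> omega
    by_contra hfree
    have step : ∀ m, 1 ≤ m → m ≤ n - 2 → arcPt a b m ∈ C →
        (m + 1 ≤ n - 2 → arcPt a b (m + 1) ∈ C) ∧ (1 ≤ m - 1 → arcPt a b (m - 1) ∈ C) := by
      intro m h1 h2 hm
      have hnl := fun h => hfree (Or.inl ⟨_, hm, h⟩)
      constructor
      · intro h3
        by_contra hout'
        refine hnl fun y hy z hz ay az => ?_
        have h : ∀ y ∈ A ∪ C, (termGraph n (hasse ℕ)).Adj (arcPt a b m) y →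
            y = arcPt a b (m - 1) := by
          intro y hy ay
          refine (hnbr m h1 h2 y hy ay).resolve_right ?_
          rintro rfl
          exact hy.elim (hout _ (by omega) h3) hout'
        rw [h y hy ay, h z hz az]
      · intro h3
        by_contra hout'
        refine hnl fun y hy z hz ay az => ?_
        have h : ∀ y ∈ A ∪ C, (termGraph n (hasse ℕ)).Adj (arcPt a b m) y →
            y = arcPt a b (m + 1) := by
          intro y hy ay
          refine (hnbr m h1 h2 y hy ay).resolve_left ?_
          rintro rfl
          exact hy.elim (hout _ h3 (by omega)) hout'
        rw [h y hy ay, h z hz az]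
    have hj : arcPt a b (j.1 + 1) ∈ C := (arcPt_succ a b j).symm ▸ hx
    have hj2 := j.2
    have up : ∀ d, j.1 + 1 + d ≤ n - 2 → arcPt a b (j.1 + 1 + d) ∈ C := by
      intro d
      induction d with
      | zero => exact fun _ => hj
      | succ d ih => exact fun hd => (step _ (by omega) (by omega) (ih (by omega))).1 hd
    have down : ∀ d, 1 ≤ j.1 + 1 - d → arcPt a b (j.1 + 1 - d) ∈ C := by
      intro d
      induction d with
      | zero => exact fun _ => hj
      | succ d ih =>
        intro hd
        have := (step _ (by omega) (by omega) (ih (by omega))).2 (by omega)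
        rwa [show j.1 + 1 - (d + 1) = j.1 + 1 - d - 1 by omega]
    refine hfree (Or.inr ⟨arcPt a b, ?_, fun m ⟨h1, h2⟩ => ⟨?_, ?_⟩, fun m h1 h2 =>
      arcPt_adj hn a b (by omega)⟩)
    · rintro m ⟨m1, m2⟩ l ⟨l1, l2⟩ he
      rw [arcPt_of_mem m1 m2, arcPt_of_mem l1 l2] at he
      injection he with _ _ he
      have := congrArg Fin.val he
      simp only at this
      omega
    · rcases le_total (j.1 + 1) m with h | h
      · simpa [h] using up (m - (j.1 + 1)) (by omega)
      · have := down (j.1 + 1 - m) (by omega)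
        rwa [show j.1 + 1 - (j.1 + 1 - m) = m by omega] at this
    · intro y hy z hz w hw ay az aw
      rcases hnbr m h1 h2 y hy ay with rfl | rfl <;> rcases hnbr m h1 h2 z hz az with rfl | rfl <;>
        rcases hnbr m h1 h2 w hw aw with rfl | rfl <;> simp
  | base u =>
    have hC0 : ∀ y ∈ C, ∃ v, y = .base v := by
      intro y hy
      cases y with
      | base v => exact ⟨v, rfl⟩
      | arc c d l =>
        have := hmax _ hy
        simp only [rank] at this
        omega
    have hvC : ∃ v, ArcTerm.base v ∈ C ∧ ∀ w, ArcTerm.base w ∈ C → w ≤ v := by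
      have hfin : {v | (ArcTerm.base v : ArcTerm n ℕ) ∈ C}.Finite :=
        hC.preimage fun x _ y _ h => by injection h
      obtain ⟨v, hv, hv'⟩ := exists_max_image _ id hfin ⟨u, hx⟩
      exact ⟨v, hv, hv'⟩
    obtain ⟨v, hv, hvmax⟩ := hvC
    have hnbr : ∀ y ∈ A ∪ C, (termGraph n (hasse ℕ)).Adj (.base v) y → ∃ w, w + 1 = v ∧ y = .base w := by
      intro y hy ay
      rcases adj_base ay with ⟨w, hw, rfl⟩ | ⟨c, d, l, rfl, h⟩
      · rw [hasse_adj, Nat.covBy_iff_add_one_eq, Nat.covBy_iff_add_one_eq] at hw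
        rcases hw with hw | hw
        · exfalso
          subst hw
          rcases hy with hy | hy
          · exact hxA _ hv (hA.base _ hy)
          · have := hvmax _ hy
            omega
        · exact ⟨w, hw, rfl⟩
      · exfalso
        rcases hy with hy | hy
        · rcases h with rfl | rfl
          · exact hxA _ hv (hA.left _ _ _ hy)
          · exact hxA _ hv (hA.right _ _ _ hy)
        · obtain ⟨w, hw⟩ := hC0 _ hy
          cases hw
    refine Or.inl ⟨_, hv, fun y hy z hz ay az => ?_⟩
    obtain ⟨w, hw, rfl⟩ := hnbr y hy ay
    obtain ⟨w', hw', rfl⟩ := hnbr z hz az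
    rw [show w = w' by omega]

/-- The names from which a name is built. -/
def ingredients : ArcTerm n ℕ → Set (ArcTerm n ℕ)
  | .base x => .base '' Iic x
  | .arc a b _ => ingredients a ∪ ingredients b ∪ range (ArcTerm.arc a b)

lemma mem_ingredients (x : ArcTerm n ℕ) : x ∈ ingredients x := by
  cases x with
  | base x => exact ⟨x, mem_Iic.2 le_rfl, rfl⟩
  | arc a b j => exact Or.inr ⟨j, rfl⟩

lemma ingredients_finite (x : ArcTerm n ℕ) : (ingredients x).Finite := by
  induction x with
  | base x => exact (finite_Iic x).image _
  | arc a b j ha hb => exact (ha.union hb).union (finite_range _)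

lemma DownSet.ingredients_subset {A : Set (ArcTerm n ℕ)} (hA : DownSet A) {x : ArcTerm n ℕ}
    (hx : x ∈ A) : ingredients x ⊆ A := by
  induction x with
  | base x =>
    rintro _ ⟨y, hy, rfl⟩
    obtain ⟨d, rfl⟩ := Nat.exists_eq_add_of_le (show y ≤ x from hy)
    clear hy
    induction d with
    | zero => exact hx
    | succ d ih => exact ih (hA.base _ hx)
  | arc a b j ha hb =>
    rintro y ((hy | hy) | ⟨l, rfl⟩)
    · exact ha (hA.left _ _ _ hx) hy
    · exact hb (hA.right _ _ _ hx) hy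
    · exact hA.all _ _ _ _ hx

lemma ingredients_downSet (x : ArcTerm n ℕ) : DownSet (ingredients x) := by
  induction x with
  | base x =>
    refine ⟨⟨?_, ?_, ?_⟩, ?_⟩
    · rintro a b j ⟨y, -, hy⟩
      cases hy
    · rintro a b j ⟨y, -, hy⟩
      cases hy
    · rintro a b j j' ⟨y, -, hy⟩
      cases hy
    · rintro y ⟨z, hz, hy⟩
      injection hy with hy
      subst hy
      exact ⟨y, (Nat.le_succ y).trans hz, rfl⟩
  | arc a b j ha hb =>
    refine ⟨⟨?_, ?_, ?_⟩, ?_⟩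
    · rintro c d l ((h | h) | ⟨l', h⟩)
      · exact Or.inl (Or.inl (ha.left _ _ _ h))
      · exact Or.inl (Or.inr (hb.left _ _ _ h))
      · injection h with h1 h2
        exact Or.inl (Or.inl (h1 ▸ mem_ingredients _))
    · rintro c d l ((h | h) | ⟨l', h⟩)
      · exact Or.inl (Or.inl (ha.right _ _ _ h))
      · exact Or.inl (Or.inr (hb.right _ _ _ h))
      · injection h with h1 h2
        exact Or.inl (Or.inr (h2 ▸ mem_ingredients _))
    · rintro c d l l₂ ((h | h) | ⟨l', h⟩)
      · exact Or.inl (Or.inl (ha.all _ _ _ _ h))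
      · exact Or.inl (Or.inr (hb.all _ _ _ _ h))
      · injection h with h1 h2
        subst h1 h2
        exact Or.inr ⟨l₂, rfl⟩
    · rintro y ((h | h) | ⟨l', h⟩)
      · exact Or.inl (Or.inl (ha.base _ h))
      · exact Or.inl (Or.inr (hb.base _ h))
      · cases h

lemma DownSet.biUnion {ι : Type*} {s : Set ι} {A : ι → Set (ArcTerm n ℕ)}
    (h : ∀ i ∈ s, DownSet (A i)) : DownSet (⋃ i ∈ s, A i) := by
  refine ⟨⟨?_, ?_, ?_⟩, ?_⟩
  · intro a b j hx
    obtain ⟨i, hi, hx⟩ := mem_iUnion₂.1 hx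
    exact mem_iUnion₂.2 ⟨i, hi, (h i hi).left _ _ _ hx⟩
  · intro a b j hx
    obtain ⟨i, hi, hx⟩ := mem_iUnion₂.1 hx
    exact mem_iUnion₂.2 ⟨i, hi, (h i hi).right _ _ _ hx⟩
  · intro a b j j' hx
    obtain ⟨i, hi, hx⟩ := mem_iUnion₂.1 hx
    exact mem_iUnion₂.2 ⟨i, hi, (h i hi).all _ _ _ _ hx⟩
  · intro x hx
    obtain ⟨i, hi, hx⟩ := mem_iUnion₂.1 hx
    exact mem_iUnion₂.2 ⟨i, hi, (h i hi).base _ hx⟩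

/-- Every finite subset of a downset is contained in a finite downset. -/
lemma DownSet.exists_finite {A F : Set (ArcTerm n ℕ)} (hA : DownSet A) (hF : F.Finite)
    (hFA : F ⊆ A) : ∃ B, F ⊆ B ∧ B ⊆ A ∧ B.Finite ∧ DownSet B :=
  ⟨⋃ x ∈ F, ingredients x, fun x hx => mem_iUnion₂.2 ⟨x, hx, mem_ingredients x⟩,
    iUnion₂_subset fun _ hx => hA.ingredients_subset (hFA hx),
    hF.biUnion fun _ _ => ingredients_finite _, DownSet.biUnion fun _ _ => ingredients_downSet _⟩

end DownSets

/-! ### Stages of the free completion: connectedness and parity. -/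

section Stages

/-- The vertices of the `i`-th step of the construction of `Γ^k`. -/
abbrev st (n : ℕ) (k : ℕ∞) (i : ℕ) : Set (ArcTerm n ℕ) :=
  stage n (hasse ℕ) {x : ℕ | (x : ℕ∞) ≤ k} i

/-- The graph on all names over the infinite path. -/
abbrev tg (n : ℕ) : SimpleGraph (ArcTerm n ℕ) := termGraph n (hasse ℕ)

/-- The `i`-th step of the construction of `Γ^k`. -/
abbrev sg (n : ℕ) (k : ℕ∞) (i : ℕ) : SimpleGraph (st n k i) := (tg n).induce (st n k i)

/-- The arc between `a` and `b` is put in at step `i + 1`. -/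
def NewArc (n : ℕ) (k : ℕ∞) (i : ℕ) (a b : ArcTerm n ℕ) : Prop :=
  WellOrderingRel a b ∧ ∃ (ha : a ∈ st n k i) (hb : b ∈ st n k i),
    (sg n k i).dist ⟨a, ha⟩ ⟨b, hb⟩ = n + 1

variable {n : ℕ} {k : ℕ∞} {i : ℕ}

lemma mem_st_zero {x : ArcTerm n ℕ} : x ∈ st n k 0 ↔ ∃ u : ℕ, (u : ℕ∞) ≤ k ∧ x = .base u := by
  constructor
  · rintro ⟨u, hu, rfl⟩
    exact ⟨u, hu, rfl⟩
  · rintro ⟨u, hu, rfl⟩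
    exact ⟨u, hu, rfl⟩

lemma mem_st_succ {x : ArcTerm n ℕ} : x ∈ st n k (i + 1) ↔
    x ∈ st n k i ∨ ∃ a b j, x = .arc a b j ∧ NewArc n k i a b := by
  rfl

lemma st_mono : Monotone (st n k) :=
  monotone_nat_of_le_succ fun _ _ hx => Or.inl hx

lemma base_mem_st {u : ℕ} : (ArcTerm.base u : ArcTerm n ℕ) ∈ st n k i ↔ (u : ℕ∞) ≤ k := by
  induction i with
  | zero =>
    rw [mem_st_zero]
    constructor
    · rintro ⟨v, hv, h⟩
      injection h with h
      rwa [h]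
    · exact fun h => ⟨u, h, rfl⟩
  | succ i ih =>
    rw [mem_st_succ, ih]
    constructor
    · rintro (h | ⟨a, b, j, h, -⟩)
      · exact h
      · cases h
    · exact Or.inl

lemma st_downSet : DownSet (st n k i) := by
  induction i with
  | zero =>
    refine ⟨⟨?_, ?_, ?_⟩, ?_⟩
    · rintro a b j ⟨y, -, hy⟩
      cases hy
    · rintro a b j ⟨y, -, hy⟩
      cases hy
    · rintro a b j j' ⟨y, -, hy⟩
      cases hy
    · intro x hx
      rw [base_mem_st] at hx ⊢
      exact le_trans (by exact_mod_cast Nat.le_succ x) hx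
  | succ i ih =>
    refine ⟨⟨?_, ?_, ?_⟩, ?_⟩
    · rintro a b j (h | ⟨a', b', j', h, -, ha, hb, -⟩)
      · exact Or.inl (ih.left _ _ _ h)
      · injection h with h1 h2
        exact Or.inl (h1 ▸ ha)
    · rintro a b j (h | ⟨a', b', j', h, -, ha, hb, -⟩)
      · exact Or.inl (ih.right _ _ _ h)
      · injection h with h1 h2
        exact Or.inl (h2 ▸ hb)
    · rintro a b j l (h | ⟨a', b', j', h, h'⟩)
      · exact Or.inl (ih.all _ _ _ _ h)
      · injection h with h1 h2
        subst h1 h2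
        exact Or.inr ⟨_, _, l, rfl, h'⟩
    · intro x hx
      rw [base_mem_st] at hx ⊢
      exact le_trans (by exact_mod_cast Nat.le_succ x) hx

lemma exists_arc_walk (hn : 3 ≤ n) {A : Set (ArcTerm n ℕ)} (hA : ArcClosed A) {a b : ArcTerm n ℕ}
    {j : Fin (n - 2)} (hj : ArcTerm.arc a b j ∈ A) (ha : a ∈ A) (hb : b ∈ A) :
    ∃ w : ((tg n).induce A).Walk ⟨a, ha⟩ ⟨b, hb⟩, w.length = n - 1 := by
  obtain ⟨w, hw, -⟩ := exists_walk_of_path (G := (tg n).induce A)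
    (fun m => ⟨arcPt a b m, hA.arcPt_mem hj m⟩) 0 (n - 1) (Nat.zero_le _)
    (fun m _ hm => arcPt_adj hn a b hm)
  refine ⟨w.copy (Subtype.ext (arcPt_zero a b)) (Subtype.ext (arcPt_last hn a b)), ?_⟩
  rw [Walk.length_copy, hw, Nat.sub_zero]

/-- An arc already present would put its ends at distance at most `n - 1`. -/
lemma NewArc.notMem (hn : 3 ≤ n) {a b : ArcTerm n ℕ} (h : NewArc n k i a b) (j : Fin (n - 2)) :
    ArcTerm.arc a b j ∉ st n k i := by
  obtain ⟨-, ha, hb, hd⟩ := h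
  intro hm
  obtain ⟨w, hw⟩ := exists_arc_walk hn st_downSet.toArcClosed hm ha hb
  have : n + 1 ≤ n - 1 := hd.ge.trans ((dist_le w).trans_eq hw)
  omega

lemma NewArc.mem_succ {a b : ArcTerm n ℕ} (h : NewArc n k i a b) (m : ℕ) :
    arcPt a b m ∈ st n k (i + 1) := by
  obtain ⟨h1, ha, hb, hd⟩ := h
  rw [arcPt]
  split_ifs
  · exact Or.inl ha
  · exact Or.inr ⟨a, b, _, rfl, h1, ha, hb, hd⟩
  · exact Or.inl hb

lemma adj_cases (hn : 3 ≤ n) {x y : ArcTerm n ℕ} (hx : x ∈ st n k (i + 1))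
    (hy : y ∈ st n k (i + 1)) (h : (tg n).Adj x y) : (x ∈ st n k i ∧ y ∈ st n k i) ∨
      ∃ a b, NewArc n k i a b ∧ ∃ m < n - 1, (x = arcPt a b m ∧ y = arcPt a b (m + 1)) ∨
        (x = arcPt a b (m + 1) ∧ y = arcPt a b m) := by
  have key : ∀ x y : ArcTerm n ℕ, x ∈ st n k (i + 1) → y ∈ st n k (i + 1) →
      Joined (hasse ℕ) x y → (x ∈ st n k i ∧ y ∈ st n k i) ∨
      ∃ a b, NewArc n k i a b ∧ ∃ m < n - 1, x = arcPt a b m ∧ y = arcPt a b (m + 1) := by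
    intro x y hx hy h
    rcases h.cases hn with ⟨u, v, -, rfl, rfl⟩ | ⟨a, b, m, hm, rfl, rfl⟩
    · rw [base_mem_st] at hx hy
      exact Or.inl ⟨base_mem_st.2 hx, base_mem_st.2 hy⟩
    · have harc : ∃ j, ArcTerm.arc a b j ∈ st n k (i + 1) := by
        by_cases hm0 : m = 0
        · subst hm0
          rw [arcPt_of_mem (by omega) (by omega)] at hy
          exact ⟨_, hy⟩
        · rw [arcPt_of_mem (by omega) (by omega)] at hx
          exact ⟨_, hx⟩
      obtain ⟨j, hj⟩ := harc
      rcases mem_st_succ.1 hj with hj | ⟨a', b', j', h, h'⟩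
      · exact Or.inl ⟨st_downSet.arcPt_mem hj m, st_downSet.arcPt_mem hj (m + 1)⟩
      · injection h with h1 h2
        subst h1 h2
        exact Or.inr ⟨_, _, h', m, hm, rfl, rfl⟩
  rw [tg, termGraph, SimpleGraph.fromRel_adj] at h
  rcases h.2 with h | h
  · rcases key x y hx hy h with h | ⟨a, b, h, m, hm, h'⟩
    · exact Or.inl h
    · exact Or.inr ⟨a, b, h, m, hm, Or.inl h'⟩
  · rcases key y x hy hx h with h | ⟨a, b, h, m, hm, h'⟩
    · exact Or.inl h.symm
    · exact Or.inr ⟨a, b, h, m, hm, Or.inr h'.symm⟩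

/-- The inclusion of one step in a larger one. -/
abbrev stHom {A B : Set (ArcTerm n ℕ)} (h : A ⊆ B) : (tg n).induce A →g (tg n).induce B :=
  (SimpleGraph.induceHomOfLE (tg n) h).toHom

lemma sg_connected (hn : 3 ≤ n) : (sg n k i).Connected := by
  have : Nonempty (st n k i) := ⟨⟨.base 0, base_mem_st.2 (by simp)⟩⟩
  refine ⟨?_⟩
  induction i with
  | zero =>
    have h0 : ∀ u : ℕ, ∀ hu : (u : ℕ∞) ≤ k, (sg n k 0).Reachable ⟨.base 0, base_mem_st.2 (by simp)⟩
        ⟨.base u, base_mem_st.2 hu⟩ := by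
      intro u
      induction u with
      | zero => exact fun _ => Reachable.refl _
      | succ u ih =>
        intro hu
        have hu' : (u : ℕ∞) ≤ k := le_trans (by exact_mod_cast Nat.le_succ u) hu
        refine (ih hu').trans (Adj.reachable ?_)
        exact (Joined.base (by simp [hasse_adj, Nat.covBy_iff_add_one_eq])).adj
    rintro ⟨x, hx⟩ ⟨y, hy⟩
    obtain ⟨u, hu, rfl⟩ := mem_st_zero.1 hx
    obtain ⟨v, hv, rfl⟩ := mem_st_zero.1 hy
    exact (h0 u hu).symm.trans (h0 v hv)
  | succ i ih =>
    have hsub : st n k i ⊆ st n k (i + 1) := st_mono (Nat.le_succ i)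
    have ih := ih ⟨⟨.base 0, base_mem_st.2 (by simp)⟩⟩
    have h1 : ∀ x : st n k (i + 1), ∃ y : st n k i, (sg n k (i + 1)).Reachable x ⟨y.1, hsub y.2⟩ := by
      rintro ⟨x, hx⟩
      rcases mem_st_succ.1 hx with hx' | ⟨a, b, j, rfl, h⟩
      · exact ⟨⟨x, hx'⟩, Reachable.refl _⟩
      · have ha : a ∈ st n k i := h.2.1
        refine ⟨⟨a, ha⟩, Reachable.symm ?_⟩
        obtain ⟨w, -⟩ := exists_walk_of_path (G := sg n k (i + 1))
          (fun m => ⟨arcPt a b m, h.mem_succ m⟩) 0 (j.1 + 1) (Nat.zero_le _)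
          (fun m _ hm => arcPt_adj hn a b (by omega))
        exact ⟨w.copy (Subtype.ext (arcPt_zero a b)) (Subtype.ext (arcPt_succ a b j))⟩
    intro x y
    obtain ⟨x', hx⟩ := h1 x
    obtain ⟨y', hy⟩ := h1 y
    exact hx.trans (((ih x' y').map (stHom hsub)).trans hy.symm)

/-- The first class of the bipartition. -/
def tcol (x : ArcTerm n ℕ) : Prop := colour (fun i : ℕ => decide (Even i)) x = true

lemma tcol_arcPt {a b : ArcTerm n ℕ} {m : ℕ} (hm : m ≤ n - 2) :
    Par tcol a (arcPt a b m) m := by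
  rcases Nat.eq_zero_or_pos m with rfl | h
  · simp [Par]
  · rw [Par, arcPt_of_mem h hm, tcol, tcol, colour, Nat.sub_add_cancel h, ← Nat.not_odd_iff_even]
    by_cases ho : Odd m <;> cases colour (fun i : ℕ => decide (Even i)) a <;> simp [ho]

/-- Colours alternate along an arc by definition from its left end; they fit at the right end
because the ends are at distance `n + 1` in the stage before, which has the parity of `n - 1`. -/
lemma sg_bip (hn : 3 ≤ n) {x y : ArcTerm n ℕ} (hx : x ∈ st n k i)
    (hy : y ∈ st n k i) (h : (tg n).Adj x y) : tcol x ↔ ¬ tcol y := by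
  induction i generalizing x y with
  | zero =>
    obtain ⟨u, hu, rfl⟩ := mem_st_zero.1 hx
    obtain ⟨v, hv, rfl⟩ := mem_st_zero.1 hy
    rcases adj_base h with ⟨w, hw, he⟩ | ⟨c, d, j, he, -⟩
    · injection he with he
      subst he
      rw [hasse_adj, Nat.covBy_iff_add_one_eq, Nat.covBy_iff_add_one_eq] at hw
      simp only [tcol, colour, decide_eq_true_eq]
      rcases hw with rfl | rfl
      · rw [Nat.even_add_one, not_not]
      · rw [Nat.even_add_one]
    · cases he
  | succ i ih =>
    rcases adj_cases hn hx hy h with ⟨hx', hy'⟩ | ⟨a, b, hab, m, hm, h'⟩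
    · exact ih hx' hy' h
    · have key : ∀ l ≤ n - 1, Par tcol a (arcPt a b l) l := by
        intro l hl
        rcases hl.lt_or_eq with hl | rfl
        · exact tcol_arcPt (by omega)
        · obtain ⟨-, ha, hb, hd⟩ := hab
          obtain ⟨w, hw⟩ := (sg_connected hn (k := k) (i := i)).exists_walk_length_eq_dist ⟨a, ha⟩ ⟨b, hb⟩
          have := even_length_iff (col := fun z : st n k i => tcol z.1)
            (fun x y hxy => ih x.2 y.2 hxy) w
          rw [hw, hd] at this
          rw [Par, arcPt_last hn]
          have e : Even (n + 1) ↔ Even (n - 1) := by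
            rw [Nat.even_iff, Nat.even_iff]
            omega
          rw [← e]
          tauto
      have h1 := key m (by omega)
      have h2 := key (m + 1) (by omega)
      rw [Par, Nat.even_add_one] at h2
      rw [Par] at h1
      rcases h' with ⟨rfl, rfl⟩ | ⟨rfl, rfl⟩ <;> tauto

lemma sg_even_iff (hn : 3 ≤ n) {x y : st n k i} (w : (sg n k i).Walk x y) :
    (tcol x.1 ↔ tcol y.1) ↔ Even w.length :=
  even_length_iff (col := fun z : st n k i => tcol z.1) (fun x y hxy => sg_bip hn x.2 y.2 hxy) w

lemma exists_walk_succ_of_dist (hn : 3 ≤ n) {x y : st n k i} (hdist : (sg n k i).dist x y = n + 1)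
    (hsub : st n k i ⊆ st n k (i + 1)) :
    ∃ u : (sg n k (i + 1)).Walk ⟨x.1, hsub x.2⟩ ⟨y.1, hsub y.2⟩, u.length = n - 1 := by
  have hne : x.1 ≠ y.1 := by
    intro he
    rw [show x = y from Subtype.ext he, SimpleGraph.dist_self] at hdist
    omega
  rcases trichotomous_of WellOrderingRel x.1 y.1 with hr | hr | hr
  · exact exists_arc_walk hn (st_downSet (k := k) (i := i + 1)).toArcClosed
      (a := x.1) (b := y.1) (j := ⟨0, by omega⟩)
      (Or.inr ⟨_, _, _, rfl, hr, x.2, y.2, hdist⟩) (hsub x.2) (hsub y.2)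
  · exact absurd hr hne
  · obtain ⟨u, hu⟩ := exists_arc_walk hn (st_downSet (k := k) (i := i + 1)).toArcClosed
      (a := y.1) (b := x.1) (j := ⟨0, by omega⟩)
      (Or.inr ⟨_, _, _, rfl, hr, y.2, x.2, SimpleGraph.dist_comm.trans hdist⟩) (hsub y.2) (hsub x.2)
    exact ⟨u.reverse, by rw [Walk.length_reverse, hu]⟩

/-- Induction on the length of a walk: by parity it is at most `n - 1` or at least `n + 1`. In the
latter case its initial segment of length `n + 1` is either not shortest or is bypassed at the next
stage by an arc of length `n - 1`. -/
lemma exists_short_walk (hn : 3 ≤ n) {x y : st n k i}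
    (h : (tcol x.1 ↔ tcol y.1) ↔ Even (n - 1)) : ∃ (l : ℕ) (hl : st n k i ⊆ st n k l)
      (w : (sg n k l).Walk ⟨x.1, hl x.2⟩ ⟨y.1, hl y.2⟩), w.length ≤ n - 1 := by
  obtain ⟨w₀⟩ := (sg_connected hn (k := k) (i := i)) x y
  obtain ⟨d, hd⟩ : ∃ d, w₀.length = d := ⟨_, rfl⟩
  induction d using Nat.strong_induction_on generalizing i x y with
  | _ d ih =>
  subst hd
  have hpar := sg_even_iff hn w₀
  by_cases hlen : w₀.length ≤ n - 1
  · exact ⟨i, subset_rfl, w₀, hlen⟩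
  have hlen' : n + 1 ≤ w₀.length := by
    have : w₀.length ≠ n := by
      intro he
      rw [h, he, Nat.even_iff, Nat.even_iff] at hpar
      omega
    omega
  let m := w₀.getVert (n + 1)
  have e1 : (w₀.take (n + 1)).length = n + 1 := by
    rw [Walk.take_length]
    omega
  have e2 : (w₀.drop (n + 1)).length = w₀.length - (n + 1) := Walk.drop_length ..
  by_cases hdist : (sg n k i).dist x m = n + 1
  · have hsub : st n k i ⊆ st n k (i + 1) := st_mono (Nat.le_succ i)
    obtain ⟨u, hu⟩ := exists_walk_succ_of_dist hn hdist hsub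
    let v : (sg n k (i + 1)).Walk ⟨x.1, hsub x.2⟩ ⟨y.1, hsub y.2⟩ :=
      u.append ((w₀.drop (n + 1)).map (stHom hsub))
    have hv : v.length = n - 1 + (w₀.length - (n + 1)) :=
      (Walk.length_append _ _).trans (congrArg₂ _ hu ((Walk.length_map _ _).trans e2))
    obtain ⟨l, hl, w, hw⟩ := ih v.length (by omega) (x := ⟨x.1, hsub x.2⟩) (y := ⟨y.1, hsub y.2⟩) h v rfl
    exact ⟨l, hsub.trans hl, w, hw⟩
  · obtain ⟨u, hu⟩ := (sg_connected hn (k := k) (i := i)).exists_walk_length_eq_dist x m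
    have := dist_le (w₀.take (n + 1))
    rw [e1] at this
    have hv : (u.append (w₀.drop (n + 1))).length < w₀.length := by
      rw [Walk.length_append, hu, e2]
      have : (sg n k i).dist x m ≤ n + 1 := this
      omega
    exact ih _ hv h (u.append (w₀.drop (n + 1))) rfl

end Stages

/-! ### The girth of the stages, by functions that jump across one edge. -/

section Girth

/-- If the function jumps by `t` across the edge `e` only, going around `e` takes at least `t`
steps. This bounds the cycles through `e`. -/
lemma le_length_of_cut {V : Type*} {G : SimpleGraph V} {e : Sym2 V} {ψ : V → ℤ}
    (h : ∀ x y, G.Adj x y → s(x, y) ≠ e → ψ y ≤ ψ x + 1) {x y : V} (w : G.Walk x y)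
    (hw : e ∉ w.edges) : ψ y ≤ ψ x + w.length := by
  induction w with
  | nil => simp
  | cons ha w ih =>
    rw [Walk.edges_cons, List.mem_cons, not_or] at hw
    have h1 := h _ _ ha (Ne.symm hw.1)
    have h2 := ih hw.2
    rw [Walk.length_cons]
    push_cast
    omega

lemma iff_iff_iff_comm_of_iff {A B C D E : Prop} (h : (A ↔ B) ↔ E) (h' : (C ↔ D) ↔ E) :
    (A ↔ C) ↔ (B ↔ D) := by
  by_cases A <;> by_cases B <;> by_cases C <;> by_cases D <;> simp_all

variable {n : ℕ} {k : ℕ∞} {i : ℕ}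

/-- A function that grows from one end of a new arc to the other end. -/
lemma exists_level (hn : 3 ≤ n) {a b : ArcTerm n ℕ} (hab : NewArc n k i a b) :
    ∃ ψ : ArcTerm n ℕ → ℤ, ψ a = 0 ∧ ψ b = n + 1 ∧
      (∀ x ∈ st n k i, ∀ y ∈ st n k i, (tg n).Adj x y → ψ y ≤ ψ x + 1) ∧
      ∀ c d, NewArc n k i c d → ¬ (c = a ∧ d = b) → ψ c ≤ ψ d + (n - 1) ∧ ψ d ≤ ψ c + (n - 1) := by
  classical
  obtain ⟨hr, ha, hb, hd⟩ := hab
  have hconn := sg_connected hn (k := k) (i := i)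
  let D : st n k i → ArcTerm n ℕ → ℕ := fun x y =>
    if h : y ∈ st n k i then (sg n k i).dist x ⟨y, h⟩ else 0
  have hD : ∀ x : st n k i, ∀ y (hy : y ∈ st n k i), D x y = (sg n k i).dist x ⟨y, hy⟩ :=
    fun x y hy => dif_pos hy
  clear_value D
  have hadj : ∀ x : st n k i, ∀ y ∈ st n k i, ∀ z ∈ st n k i, (tg n).Adj y z → D x z ≤ D x y + 1 := by
    intro x y hy z hz hyz
    rw [hD x y hy, hD x z hz]
    refine (hconn.dist_triangle (v := ⟨y, hy⟩)).trans (Nat.add_le_add_left ?_ _)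
    exact (SimpleGraph.dist_eq_one_iff_adj.2 (show (sg n k i).Adj ⟨y, hy⟩ ⟨z, hz⟩ from hyz)).le
  have hpar : ∀ x : st n k i, ∀ y, y ∈ st n k i → ((tcol x.1 ↔ tcol y) ↔ Even (D x y)) := by
    intro x y hy
    obtain ⟨w, hw⟩ := hconn.exists_walk_length_eq_dist x ⟨y, hy⟩
    rw [hD x y hy, ← hw]
    exact sg_even_iff hn w
  have h0 : ∀ x : st n k i, ∀ y, y ∈ st n k i → D x y = 0 → y = x.1 := by
    intro x y hy h
    rw [hD x y hy] at h
    have := hconn.dist_eq_zero_iff.1 h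
    rw [this]
  have hself : ∀ x : st n k i, D x x.1 = 0 := by
    intro x
    rw [hD x _ x.2]
    exact SimpleGraph.dist_self
  have hDab : D ⟨a, ha⟩ b = n + 1 := (hD _ _ hb).trans hd
  have hDba : D ⟨b, hb⟩ a = n + 1 := (hD _ _ ha).trans (SimpleGraph.dist_comm.trans hd)
  -- Distance from `a` capped at `n - 1`, raised near `b` to `n + 1` minus the distance from `b`. A
  -- variation above `n - 1` between `c` and `d` requires them to be close to `a` and `b` with total
  -- distance at most one.
  refine ⟨fun y => max (min (D ⟨a, ha⟩ y : ℤ) (n - 1)) (n + 1 - D ⟨b, hb⟩ y), ?_, ?_, ?_, ?_⟩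
  · simp only [hself ⟨a, ha⟩, hDba]
    push_cast
    omega
  · simp only [hself ⟨b, hb⟩, hDab]
    push_cast
    omega
  · intro x hx y hy hxy
    have h1 := hadj ⟨a, ha⟩ x hx y hy hxy
    have h2 := hadj ⟨b, hb⟩ y hy x hx hxy.symm
    simp only
    omega
  · have key : ∀ c ∈ st n k i, ∀ d ∈ st n k i, ((tcol c ↔ tcol d) ↔ Even (n + 1)) →
        ¬ (c = a ∧ d = b) → D ⟨a, ha⟩ c + D ⟨b, hb⟩ d ≤ 1 → False := by
      intro c hc d hd' hcd hne hle
      have h1 := hpar ⟨a, ha⟩ c hc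
      have h2 := hpar ⟨b, hb⟩ d hd'
      have h3 := hpar ⟨a, ha⟩ b hb
      rw [hDab] at h3
      have h4 : ¬ (D ⟨a, ha⟩ c = 0 ∧ D ⟨b, hb⟩ d = 0) := fun h =>
        hne ⟨h0 ⟨a, ha⟩ c hc h.1, h0 ⟨b, hb⟩ d hd' h.2⟩
      have h5 : (Even (D ⟨a, ha⟩ c) ↔ Even (D ⟨b, hb⟩ d)) := by
        rw [← h1, ← h2]
        exact iff_iff_iff_comm_of_iff h3 hcd
      rw [Nat.even_iff, Nat.even_iff] at h5
      generalize D ⟨a, ha⟩ c = α at *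
      generalize D ⟨b, hb⟩ d = β at *
      clear h1 h2 h3 hcd hne
      omega
    intro c d hcd hne
    obtain ⟨hr', hc, hd', hdist⟩ := hcd
    have hDcd : D ⟨c, hc⟩ d = n + 1 := (hD _ _ hd').trans hdist
    have hp := hpar ⟨c, hc⟩ d hd'
    rw [hDcd] at hp
    have k1 := key c hc d hd' hp hne
    have k2 := key d hd' c hc (by rw [← hp]; exact Iff.comm) (by
      rintro ⟨rfl, rfl⟩
      exact asymm_of WellOrderingRel hr hr')
    simp only
    generalize D ⟨a, ha⟩ c = α, D ⟨b, hb⟩ d = β, D ⟨a, ha⟩ d = α', D ⟨b, hb⟩ c = β' at k1 k2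
    constructor
    · by_contra hcon
      exact k2 (by omega)
    · by_contra hcon
      exact k1 (by omega)

lemma exists_cut (hn : 3 ≤ n) {a b : ArcTerm n ℕ} (hab : NewArc n k i a b) {m : ℕ}
    (hm : m < n - 1) : ∃ ψ : ArcTerm n ℕ → ℤ,
      ψ (arcPt a b (m + 1)) = ψ (arcPt a b m) + (2 * n - 1) ∧
      ∀ x ∈ st n k (i + 1), ∀ y ∈ st n k (i + 1), (tg n).Adj x y →
        s(x, y) ≠ s(arcPt a b m, arcPt a b (m + 1)) → ψ y ≤ ψ x + 1 := by
  classical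
  obtain ⟨φ, φa, φb, hφ, hφ'⟩ := exists_level hn hab
  -- On the cut arc the values are `0, -1, …, -m` and then `2n - m - 1, …, n + 1`, matching the
  -- ends. On any other arc, whose end values differ by at most `n - 1`, the values interpolate.
  let f : ArcTerm n ℕ → ArcTerm n ℕ → ℕ → ℤ := fun c d l =>
    if c = a ∧ d = b then (if l ≤ m then -(l : ℤ) else 2 * n - l)
    else min (φ c + l) (φ d + (n - 1 - l))
  let ψ : ArcTerm n ℕ → ℤ := fun y => if y ∈ st n k i then φ y else
    match y with
    | .base u => φ (.base u)
    | .arc c d j => f c d (j.1 + 1)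
  have e1 : ∀ y ∈ st n k i, ψ y = φ y := fun y hy => if_pos hy
  have e2 : ∀ c d, NewArc n k i c d → ∀ l ≤ n - 1, ψ (arcPt c d l) = f c d l := by
    intro c d hcd l hl
    obtain ⟨-, hc, hd, -⟩ := id hcd
    rcases Nat.eq_zero_or_pos l with rfl | h0
    · rw [arcPt_zero, e1 c hc]
      simp only [f]
      split_ifs with h
      · rw [h.1, φa]
        simp
      · omega
      · have := hφ' c d hcd h
        push_cast
        omega
    · rcases hl.lt_or_eq with hl | rfl
      · rw [arcPt_of_mem (by omega) (by omega)]
        refine (if_neg (hcd.notMem hn _)).trans ?_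
        show f c d (l - 1 + 1) = _
        rw [Nat.sub_add_cancel h0]
      · rw [arcPt_last hn, e1 d hd]
        simp only [f]
        split_ifs with h h'
        · omega
        · rw [h.2, φb]
          omega
        · have := hφ' c d hcd h
          omega
  refine ⟨ψ, ?_, ?_⟩
  · rw [e2 a b hab _ (by omega), e2 a b hab _ (by omega)]
    simp only [f, and_self, if_true, le_refl]
    rw [if_neg (by omega)]
    push_cast
    ring
  · intro x hx y hy hxy hne
    rcases adj_cases hn hx hy hxy with ⟨hx', hy'⟩ | ⟨c, d, hcd, l, hl, h⟩
    · rw [e1 x hx', e1 y hy']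
      exact hφ x hx' y hy' hxy
    · have hl' : c = a ∧ d = b → l ≠ m := by
        rintro ⟨rfl, rfl⟩ rfl
        rcases h with ⟨rfl, rfl⟩ | ⟨rfl, rfl⟩
        · exact hne rfl
        · exact hne Sym2.eq_swap
      have key : |f c d (l + 1) - f c d l| ≤ 1 := by
        rw [abs_le]
        simp only [f]
        by_cases hc : c = a ∧ d = b
        · have := hl' hc
          rw [if_pos hc, if_pos hc]
          push_cast
          split_ifs <;> omega
        · rw [if_neg hc, if_neg hc]
          push_cast
          omega
      rw [abs_le] at key
      rcases h with ⟨rfl, rfl⟩ | ⟨rfl, rfl⟩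
      · rw [e2 c d hcd _ (by omega), e2 c d hcd _ (by omega)]
        omega
      · rw [e2 c d hcd _ (by omega), e2 c d hcd _ (by omega)]
        omega

lemma sg_girth (hn : 3 ≤ n) (x : st n k i) (w : (sg n k i).Walk x x) (hw : w.IsCycle) :
    2 * n ≤ w.length := by
  classical
  induction i with
  | zero =>
    exfalso
    have hadj : ∀ x y : st n k 0, (sg n k 0).Adj x y → ∃ u : ℕ,
        (x.1 = .base u ∧ y.1 = .base (u + 1)) ∨ (x.1 = .base (u + 1) ∧ y.1 = .base u) := by
      rintro ⟨x, hx⟩ ⟨y, hy⟩ h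
      obtain ⟨u, hu, rfl⟩ := mem_st_zero.1 hx
      obtain ⟨v, hv, rfl⟩ := mem_st_zero.1 hy
      rcases adj_base h with ⟨w, hw, he⟩ | ⟨c, d, j, he, -⟩
      · injection he with he
        subst he
        rw [hasse_adj, Nat.covBy_iff_add_one_eq, Nat.covBy_iff_add_one_eq] at hw
        rcases hw with rfl | rfl
        · exact ⟨u, Or.inl ⟨rfl, rfl⟩⟩
        · exact ⟨v, Or.inr ⟨rfl, rfl⟩⟩
      · cases he
    cases w with
    | nil => exact hw.ne_nil rfl
    | @cons _ y _ hxy p =>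
      obtain ⟨-, hp⟩ := (Walk.cons_isCycle_iff _ _).1 hw
      obtain ⟨u, hu⟩ := hadj _ _ hxy
      -- Removing one edge disconnects a path, so a jump larger than the length of `p` is allowed.
      let ψ : st n k 0 → ℤ := fun z => match z.1 with
        | .base v => if v ≤ u then 0 else (p.length + 1 : ℤ)
        | .arc _ _ _ => 0
      have hψ : ∀ z z' : st n k 0, (sg n k 0).Adj z z' → s(z, z') ≠ s(x, y) → ψ z' ≤ ψ z + 1 ∧
          ψ z ≤ ψ z' + 1 := by
        intro z z' hz hne
        obtain ⟨v, hv⟩ := hadj _ _ hz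
        have hvu : v ≠ u := by
          rintro rfl
          apply hne
          rw [Sym2.eq_iff]
          rcases hu with ⟨h1, h2⟩ | ⟨h1, h2⟩ <;> rcases hv with ⟨h3, h4⟩ | ⟨h3, h4⟩
          · exact Or.inl ⟨Subtype.ext (h3.trans h1.symm), Subtype.ext (h4.trans h2.symm)⟩
          · exact Or.inr ⟨Subtype.ext (h3.trans h2.symm), Subtype.ext (h4.trans h1.symm)⟩
          · exact Or.inr ⟨Subtype.ext (h3.trans h2.symm), Subtype.ext (h4.trans h1.symm)⟩
          · exact Or.inl ⟨Subtype.ext (h3.trans h1.symm), Subtype.ext (h4.trans h2.symm)⟩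
        rcases hv with ⟨h3, h4⟩ | ⟨h3, h4⟩ <;> simp only [ψ, h3, h4] <;> split_ifs <;> omega
      rcases hu with ⟨h1, h2⟩ | ⟨h1, h2⟩
      · have := le_length_of_cut (fun z z' hz hne => (hψ z z' hz hne).1) p.reverse
          (by rwa [Walk.edges_reverse, List.mem_reverse])
        rw [Walk.length_reverse] at this
        simp only [ψ, h1, h2] at this
        split_ifs at this <;> omega
      · have := le_length_of_cut (fun z z' hz hne => (hψ z z' hz hne).1) p hp
        simp only [ψ, h1, h2] at this
        split_ifs at this <;> omega
  | succ i ih =>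
    by_cases hall : ∀ v ∈ w.support, v.1 ∈ st n k i
    · let h : st n k (i + 1) → st n k i := fun v =>
        if hv : v.1 ∈ st n k i then ⟨v.1, hv⟩ else ⟨.base 0, base_mem_st.2 (by simp)⟩
      have hval : ∀ v ∈ w.support, (h v).1 = v.1 := by
        intro v hv
        simp only [h, dif_pos (hall v hv)]
      obtain ⟨w', h1, h2⟩ := exists_cycle_map w hw (e := h) (G' := sg n k i)
        ⟨fun u hu v hv huv => Subtype.ext (by rw [← hval u hu, ← hval v hv, huv]),
          fun u hu v hv => by
            show (tg n).Adj (h u).1 (h v).1 ↔ (tg n).Adj u.1 v.1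
            rw [hval u hu, hval v hv]⟩
      rw [← h2]
      exact ih _ w' h1
    · push Not at hall
      -- The cycle is rotated to start at a vertex that is new at this stage; its first edge then
      -- lies on a new arc.
      obtain ⟨v, hv, hvi⟩ := hall
      have hrot := hw.rotate hv
      have hlen : (w.rotate v hv).length = w.length := Walk.length_rotate ..
      rw [← hlen]
      generalize w.rotate v hv = c at hrot
      cases c with
      | nil => exact absurd rfl hrot.ne_nil
      | @cons _ u _ hvu p =>
        obtain ⟨-, hp⟩ := (Walk.cons_isCycle_iff _ _).1 hrot
        rcases adj_cases hn v.2 u.2 hvu with ⟨h, -⟩ | ⟨a, b, hab, m, hm, h⟩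
        · exact absurd h hvi
        · obtain ⟨ψ, h1, h2⟩ := exists_cut hn hab hm
          have hcut : ∀ x y : st n k (i + 1), (sg n k (i + 1)).Adj x y → s(x, y) ≠ s(v, u) →
              ψ y.1 ≤ ψ x.1 + 1 := by
            intro x y hxy hne
            refine h2 x.1 x.2 y.1 y.2 hxy fun he => hne ?_
            rw [Sym2.eq_iff] at he ⊢
            rcases h with ⟨h3, h4⟩ | ⟨h3, h4⟩ <;> rw [← h3, ← h4] at he
            · exact he.imp (fun h => ⟨Subtype.ext h.1, Subtype.ext h.2⟩)
                fun h => ⟨Subtype.ext h.1, Subtype.ext h.2⟩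
            · exact he.symm.imp (fun h => ⟨Subtype.ext h.1, Subtype.ext h.2⟩)
                fun h => ⟨Subtype.ext h.1, Subtype.ext h.2⟩
          rw [Walk.length_cons]
          rcases h with ⟨h3, h4⟩ | ⟨h3, h4⟩ <;> rw [← h3, ← h4] at h1
          · have := le_length_of_cut (ψ := fun x => ψ x.1) hcut p.reverse
              (by rwa [Walk.edges_reverse, List.mem_reverse])
            rw [Walk.length_reverse] at this
            omega
          · have := le_length_of_cut (ψ := fun x => ψ x.1) hcut p hp
            omega

end Girth

/-! ### Longer paths fold back: monotonicity of the construction. -/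

section Retractions

lemma exists_walk_add {V : Type*} {G : SimpleGraph V} {x y v : V} (h : G.Adj x v)
    (w : G.Walk x y) (t : ℕ) : ∃ w' : G.Walk x y, w'.length = w.length + 2 * t := by
  induction t with
  | zero => exact ⟨w, rfl⟩
  | succ t ih =>
    obtain ⟨w', hw⟩ := ih
    exact ⟨.cons h (.cons h.symm w'), by rw [Walk.length_cons, Walk.length_cons, hw]; ring⟩

variable {n : ℕ} {k m : ℕ∞} {i : ℕ}

/-- If the ends are at distance `n + 1` an arc joins them. Otherwise, by parity, they are at
distance at most `n - 1`, and moving back and forth on an edge pads the walk to length exactly `n -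
1`. -/
lemma exists_walk_succ (hn : 3 ≤ n) {x y : st n k i} (w : (sg n k i).Walk x y)
    (hw : w.length = n + 1) (hsub : st n k i ⊆ st n k (i + 1)) :
    ∃ u : (sg n k (i + 1)).Walk ⟨x.1, hsub x.2⟩ ⟨y.1, hsub y.2⟩, u.length = n - 1 := by
  by_cases hdist : (sg n k i).dist x y = n + 1
  · exact exists_walk_succ_of_dist hn hdist hsub
  · obtain ⟨u, hu⟩ := (sg_connected hn (k := k) (i := i)).exists_walk_length_eq_dist x y
    have h1 := dist_le w
    have h2 := sg_even_iff hn w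
    have h3 := sg_even_iff hn u
    have h4 : Even u.length ↔ Even w.length := h3.symm.trans h2
    have h5 : u.length ≠ n + 1 := fun h => hdist (hu.symm.trans h)
    have h6 : u.length ≤ n + 1 := hu.le.trans (h1.trans hw.le)
    rw [hw, Nat.even_iff, Nat.even_iff] at h4
    cases w with
    | nil => simp at hw
    | cons ha w' =>
      obtain ⟨u', hu'⟩ := exists_walk_add ha u ((n - 1 - u.length) / 2)
      refine ⟨u'.map (stHom hsub), (Walk.length_map _ _).trans ?_⟩
      omega

/-- The construction over the longer path retracts onto the construction over the shorter path. -/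
def Retract (n : ℕ) (k m : ℕ∞) (i : ℕ) : Prop :=
  st n k i ⊆ st n m i ∧ ∃ ρ : ArcTerm n ℕ → ArcTerm n ℕ, (∀ x ∈ st n m i, ρ x ∈ st n k i) ∧
    (∀ x ∈ st n k i, ρ x = x) ∧
    ∀ x ∈ st n m i, ∀ y ∈ st n m i, (tg n).Adj x y → (tg n).Adj (ρ x) (ρ y)

lemma retract_zero (h1 : 1 ≤ k) (hkm : k ≤ m) : Retract n k m 0 := by
  refine ⟨?_, ?_⟩
  · intro x hx
    obtain ⟨u, hu, rfl⟩ := mem_st_zero.1 hx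
    exact mem_st_zero.2 ⟨u, hu.trans hkm, rfl⟩
  induction k using ENat.recTopCoe with
  | top =>
    obtain rfl : m = ⊤ := top_le_iff.1 hkm
    exact ⟨id, fun _ h => h, fun _ _ => rfl, fun _ _ _ _ h => h⟩
  | coe K =>
    have hK : 1 ≤ K := by exact_mod_cast h1
    -- Beyond `K` the path oscillates between `K` and `K - 1`.
    let fold : ℕ → ℕ := fun u => if u ≤ K then u else K - (u - K) % 2
    have hfold : ∀ u, fold u ≤ K := by
      intro u
      simp only [fold]
      split_ifs <;> omega
    have hadj : ∀ u, (hasse ℕ).Adj (fold u) (fold (u + 1)) := by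
      intro u
      rw [hasse_adj, Nat.covBy_iff_add_one_eq, Nat.covBy_iff_add_one_eq]
      simp only [fold]
      split_ifs <;> omega
    let ρ : ArcTerm n ℕ → ArcTerm n ℕ := fun x => match x with
      | .base u => .base (fold u)
      | .arc a b j => .arc a b j
    refine ⟨ρ, ?_, ?_, ?_⟩
    · intro x hx
      obtain ⟨u, -, rfl⟩ := mem_st_zero.1 hx
      exact base_mem_st.2 (by exact_mod_cast hfold u)
    · intro x hx
      obtain ⟨u, hu, rfl⟩ := mem_st_zero.1 hx
      have : u ≤ K := by exact_mod_cast hu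
      show ArcTerm.base (fold u) = _
      rw [show fold u = u from if_pos this]
    · intro x hx y hy h
      obtain ⟨u, -, rfl⟩ := mem_st_zero.1 hx
      obtain ⟨v, -, rfl⟩ := mem_st_zero.1 hy
      rcases adj_base h with ⟨w, hw, he⟩ | ⟨c, d, j, he, -⟩
      · injection he with he
        subst he
        rw [hasse_adj, Nat.covBy_iff_add_one_eq, Nat.covBy_iff_add_one_eq] at hw
        rcases hw with rfl | rfl
        · exact (Joined.base (hadj u)).adj
        · exact (Joined.base (hadj v)).adj.symm
      · cases he

/-- The inclusion cannot lengthen distances and the retraction cannot shorten them, so pairs at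
distance `n + 1` remain so over the longer path. -/
lemma Retract.newArc (hn : 3 ≤ n) (h : Retract n k m i) {a b : ArcTerm n ℕ}
    (hab : NewArc n k i a b) : NewArc n m i a b := by
  obtain ⟨hsub, ρ, h1, h2, h3⟩ := h
  obtain ⟨hr, ha, hb, hd⟩ := hab
  refine ⟨hr, hsub ha, hsub hb, ?_⟩
  apply le_antisymm
  · obtain ⟨w, hw⟩ := (sg_connected hn (k := k) (i := i)).exists_walk_length_eq_dist ⟨a, ha⟩ ⟨b, hb⟩
    exact (dist_le (w.map (stHom hsub))).trans_eq ((Walk.length_map _ _).trans (hw.trans hd))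
  · obtain ⟨w, hw⟩ := (sg_connected hn (k := m) (i := i)).exists_walk_length_eq_dist
      ⟨a, hsub ha⟩ ⟨b, hsub hb⟩
    let φ : sg n m i →g sg n k i :=
      ⟨fun x => ⟨ρ x.1, h1 x.1 x.2⟩, fun {x y} hxy => h3 x.1 x.2 y.1 y.2 hxy⟩
    have ea : φ ⟨a, hsub ha⟩ = ⟨a, ha⟩ := Subtype.ext (h2 a ha)
    have eb : φ ⟨b, hsub hb⟩ = ⟨b, hb⟩ := Subtype.ext (h2 b hb)
    have := dist_le ((w.map φ).copy ea eb)
    rw [Walk.length_copy, Walk.length_map] at this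
    exact hd.ge.trans (this.trans_eq hw)

/-- A new arc over the longer path joins vertices at distance `n + 1`, whose images are joined by a
walk of that length, hence at the next stage by one of length `n - 1`. The arc is sent to this walk,
and to itself if it is already an arc over the shorter path. -/
lemma Retract.succ (hn : 3 ≤ n) (h : Retract n k m i) : Retract n k m (i + 1) := by
  classical
  have hnew := fun {a b} => h.newArc hn (a := a) (b := b)
  obtain ⟨hsub, ρ, h1, h2, h3⟩ := h
  have hk : st n k i ⊆ st n k (i + 1) := st_mono (Nat.le_succ i)
  have hW : ∀ c d, ∃ W : ℕ → ArcTerm n ℕ, NewArc n m i c d → (W 0 = ρ c ∧ W (n - 1) = ρ d ∧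
      (∀ l < n - 1, (tg n).Adj (W l) (W (l + 1))) ∧ (∀ l, W l ∈ st n k (i + 1)) ∧
      (NewArc n k i c d → W = arcPt c d)) := by
    intro c d
    by_cases hcd : NewArc n k i c d
    · refine ⟨arcPt c d, fun _ => ⟨?_, ?_, fun l hl => arcPt_adj hn c d hl, hcd.mem_succ, fun _ => rfl⟩⟩
      · rw [arcPt_zero, h2 c hcd.2.1]
      · rw [arcPt_last hn, h2 d hcd.2.2.1]
    by_cases hcd' : NewArc n m i c d
    · obtain ⟨-, hc, hd, hdist⟩ := hcd'
      obtain ⟨w, hw⟩ := (sg_connected hn (k := m) (i := i)).exists_walk_length_eq_dist ⟨c, hc⟩ ⟨d, hd⟩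
      let φ : sg n m i →g sg n k i :=
        ⟨fun x => ⟨ρ x.1, h1 x.1 x.2⟩, fun {x y} hxy => h3 x.1 x.2 y.1 y.2 hxy⟩
      obtain ⟨u, hu⟩ := exists_walk_succ hn (w.map φ) ((Walk.length_map _ _).trans (hw.trans hdist)) hk
      refine ⟨fun l => (u.getVert l).1, fun _ => ⟨?_, ?_, fun l hl => ?_, fun l => (u.getVert l).2,
        fun h => absurd h hcd⟩⟩
      · exact congrArg Subtype.val u.getVert_zero
      · exact congrArg Subtype.val ((congrArg u.getVert hu.symm).trans u.getVert_length)
      · exact u.adj_getVert_succ (hl.trans_eq hu.symm)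
    · exact ⟨fun _ => c, fun h => absurd h hcd'⟩
  choose W hW using hW
  let ρ' : ArcTerm n ℕ → ArcTerm n ℕ := fun y => if y ∈ st n m i then ρ y else
    match y with
    | .base u => .base u
    | .arc c d j => W c d (j.1 + 1)
  have e1 : ∀ y ∈ st n m i, ρ' y = ρ y := fun y hy => if_pos hy
  have e2 : ∀ c d, NewArc n m i c d → ∀ l ≤ n - 1, ρ' (arcPt c d l) = W c d l := by
    intro c d hcd l hl
    obtain ⟨hW0, hW1, -⟩ := hW c d hcd
    rcases Nat.eq_zero_or_pos l with rfl | h0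
    · rw [arcPt_zero, e1 c hcd.2.1, hW0]
    · rcases hl.lt_or_eq with hl | rfl
      · rw [arcPt_of_mem (by omega) (by omega)]
        refine (if_neg (hcd.notMem hn _)).trans ?_
        show W c d (l - 1 + 1) = _
        rw [Nat.sub_add_cancel h0]
      · rw [arcPt_last hn, e1 d hcd.2.2.1, hW1]
  have hsub' : st n k (i + 1) ⊆ st n m (i + 1) := by
    rintro x (hx | ⟨a, b, j, rfl, hab⟩)
    · exact Or.inl (hsub hx)
    · exact mem_st_succ.2 (Or.inr ⟨a, b, j, rfl, hnew hab⟩)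
  refine ⟨hsub', ρ', ?_, ?_, ?_⟩
  · intro x hx
    rcases mem_st_succ.1 hx with hx | ⟨a, b, j, rfl, hab⟩
    · rw [e1 x hx]
      exact hk (h1 x hx)
    · have := j.2
      rw [← arcPt_succ, e2 a b hab _ (by omega)]
      exact (hW a b hab).2.2.2.1 _
  · intro x hx
    rcases mem_st_succ.1 hx with hx | ⟨a, b, j, rfl, hab⟩
    · rw [e1 x (hsub hx), h2 x hx]
    · have := j.2
      rw [← arcPt_succ, e2 a b (hnew hab) _ (by omega), (hW a b (hnew hab)).2.2.2.2 hab]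
  · intro x hx y hy hxy
    rcases adj_cases hn hx hy hxy with ⟨hx', hy'⟩ | ⟨c, d, hcd, l, hl, h⟩
    · rw [e1 x hx', e1 y hy']
      exact h3 x hx' y hy' hxy
    · have hadj := (hW c d hcd).2.2.1 l hl
      rcases h with ⟨rfl, rfl⟩ | ⟨rfl, rfl⟩
      · rw [e2 c d hcd _ (by omega), e2 c d hcd _ (by omega)]
        exact hadj
      · rw [e2 c d hcd _ (by omega), e2 c d hcd _ (by omega)]
        exact hadj.symm

lemma retract (hn : 3 ≤ n) (h1 : 1 ≤ k) (hkm : k ≤ m) (i : ℕ) : Retract n k m i := by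
  induction i with
  | zero => exact retract_zero h1 hkm
  | succ i ih => exact ih.succ hn

lemma mem_gammaSet {x : ArcTerm n ℕ} : x ∈ gammaSet n k ↔ ∃ i, x ∈ st n k i := mem_iUnion

lemma gammaSet_mono (hn : 3 ≤ n) (h1 : 1 ≤ k) (hkm : k ≤ m) : gammaSet n k ⊆ gammaSet n m := by
  intro x hx
  obtain ⟨i, hi⟩ := mem_gammaSet.1 hx
  exact mem_gammaSet.2 ⟨i, (retract hn h1 hkm i).1 hi⟩

lemma gammaSet_downSet : DownSet (gammaSet n k) := by
  refine ⟨⟨?_, ?_, ?_⟩, ?_⟩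
  · intro a b j hx
    obtain ⟨i, hx⟩ := mem_gammaSet.1 hx
    exact mem_gammaSet.2 ⟨i, st_downSet.left _ _ _ hx⟩
  · intro a b j hx
    obtain ⟨i, hx⟩ := mem_gammaSet.1 hx
    exact mem_gammaSet.2 ⟨i, st_downSet.right _ _ _ hx⟩
  · intro a b j j' hx
    obtain ⟨i, hx⟩ := mem_gammaSet.1 hx
    exact mem_gammaSet.2 ⟨i, st_downSet.all _ _ _ _ hx⟩
  · intro x hx
    obtain ⟨i, hx⟩ := mem_gammaSet.1 hx
    exact mem_gammaSet.2 ⟨i, st_downSet.base _ hx⟩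

lemma base_mem_gammaSet {u : ℕ} : (ArcTerm.base u : ArcTerm n ℕ) ∈ gammaSet n k ↔ (u : ℕ∞) ≤ k := by
  rw [mem_gammaSet]
  constructor
  · rintro ⟨i, hi⟩
    exact base_mem_st.1 hi
  · exact fun h => ⟨0, base_mem_st.2 h⟩

end Retractions

/-! ### Pulling back strong sets; periodic parametrization of cycles. -/

section Comap

variable {V V' : Type*} {G : SimpleGraph V} {G' : SimpleGraph V'} {n : ℕ}

lemma Strong.preimage (hn : 3 ≤ n) {h : V → V'} (H : PIso G G' h univ) {B : Set V'}
    (hB : Strong n G' B) : Strong n G (h ⁻¹' B) := by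
  intro C hC hne hdis
  have h1 : Disjoint B (h '' C) := by
    rw [Set.disjoint_left]
    rintro _ hx ⟨y, hy, rfl⟩
    exact Set.disjoint_left.1 hdis hx hy
  have h2 := (hB _ (hC.image h) (hne.image h) h1).mono (X := h '' (h ⁻¹' B ∪ C)) ?_ subset_rfl
  · exact ((H.mono (subset_univ _)).free_image hn subset_union_right).1 h2
  · rintro _ ⟨x, hx | hx, rfl⟩
    · exact Or.inl hx
    · exact Or.inr ⟨x, hx, rfl⟩

/-- A closed walk of length `2n + 2` without repetitions yields a strong cycle. -/
lemma StrongCycle.of_mod {d : ℕ → V} (hn : 3 ≤ n) (h0 : d (2 * n + 2) = d 0)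
    (hinj : InjOn d (Iio (2 * n + 2))) (hadj : ∀ i < 2 * n + 2, G.Adj (d i) (d (i + 1)))
    (hs : Strong n G (d '' Iio (2 * n + 2))) : StrongCycle n G fun i => d (i % (2 * n + 2)) := by
  refine ⟨fun i => by simp only [Nat.add_mod_right], ?_, fun i => ?_, ?_⟩
  · intro i hi j hj h
    simp only [Nat.mod_eq_of_lt (mem_Iio.1 hi), Nat.mod_eq_of_lt (mem_Iio.1 hj)] at h
    exact hinj hi hj h
  · have hlt : i % (2 * n + 2) < 2 * n + 2 := Nat.mod_lt _ (by omega)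
    have h := hadj _ hlt
    by_cases hi : i % (2 * n + 2) + 1 = 2 * n + 2
    · have e : (i + 1) % (2 * n + 2) = 0 := by
        rw [Nat.add_mod, Nat.mod_eq_of_lt (show 1 < 2 * n + 2 by omega), hi, Nat.mod_self]
      rw [hi, h0] at h
      simp only [e]
      exact h
    · have e : (i + 1) % (2 * n + 2) = i % (2 * n + 2) + 1 := by
        rw [Nat.add_mod, Nat.mod_eq_of_lt (show 1 < 2 * n + 2 by omega),
          Nat.mod_eq_of_lt (by omega)]
      simp only [e]
      exact h
  · convert hs using 1
    ext x
    constructor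
    · rintro ⟨i, rfl⟩
      exact ⟨_, Nat.mod_lt _ (by omega), rfl⟩
    · rintro ⟨i, hi, rfl⟩
      exact ⟨i, congrArg d (Nat.mod_eq_of_lt hi)⟩

end Comap

/-! ### The structures `Γ^k` are rich polygons, and inclusions are elementary. -/

section GammaStructure

variable {n : ℕ} {k m : ℕ∞}

lemma gamma_inc {x y : Gamma n k} : inc x y ↔ (tg n).Adj x.1 y.1 := Iff.rfl

lemma gamma_col {x : Gamma n k} : col x ↔ tcol x.1 := Iff.rfl

lemma gamma_isBip : IsBip (Gamma n k) := by
  refine ⟨fun x y h => (gamma_inc.1 h).symm, ?_, ?_⟩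
  · rintro x _ h rfl
    exact (tg n).loopless.irrefl _ (gamma_inc.1 h)
  · intro x
    rw [gamma_col, tcol, Bool.not_eq_true]
    exact Iff.rfl

lemma gamma_adj {x y : Gamma n k} : (gr (Gamma n k)).Adj x y ↔ (tg n).Adj x.1 y.1 :=
  gamma_isBip.adj_iff

lemma gamma_pIso : PIso (gr (Gamma n k)) (tg n) (fun x => x.1) univ :=
  ⟨fun _ _ _ _ h => Subtype.ext h, fun _ _ _ _ => gamma_adj.symm⟩

lemma DownSet.strong_gamma (hn : 3 ≤ n) {A : Set (ArcTerm n ℕ)} (hA : DownSet A) :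
    Strong n (gr (Gamma n k)) ((fun x => x.1) ⁻¹' A) :=
  (hA.strong hn).preimage hn gamma_pIso

lemma exists_stage {F : Set (Gamma n k)} (hF : F.Finite) : ∃ i, ∀ x ∈ F, x.1 ∈ st n k i := by
  have h : ∀ x : Gamma n k, ∃ i, x.1 ∈ st n k i := fun x => mem_gammaSet.1 x.2
  choose l hl using h
  obtain ⟨i, hi⟩ := (hF.image l).bddAbove
  exact ⟨i, fun x hx => st_mono (hi ⟨x, hx, rfl⟩) (hl x)⟩

lemma downSet_empty : DownSet (∅ : Set (ArcTerm n ℕ)) :=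
  ⟨⟨fun _ _ _ h => h, fun _ _ _ h => h, fun _ _ _ _ h => h⟩, fun _ h => h⟩

/-- Colours and girth concern finitely many vertices and so a single stage; short walks appear at a
later stage; openness is the strongness of the empty set of names. -/
lemma gamma_isGon (hn : 3 ≤ n) : IsGon n (Gamma n k) := by
  classical
  refine ⟨hn, ?_, ?_, ?_, ?_⟩
  · intro x y h
    obtain ⟨i, hi⟩ := exists_stage (F := {x, y}) (toFinite _)
    exact sg_bip hn (hi x (by simp)) (hi y (by simp)) (gamma_adj.1 h)
  · intro x w hw
    obtain ⟨i, hi⟩ := exists_stage (F := {v | v ∈ w.support}) (List.finite_toSet _)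
    let e : Gamma n k → st n k i := fun v => if h : v.1 ∈ st n k i then ⟨v.1, h⟩ else
      ⟨.base 0, base_mem_st.2 (by simp)⟩
    have he : ∀ v ∈ w.support, (e v).1 = v.1 := fun v hv => by
      simp only [e]
      rw [dif_pos (hi v hv)]
    have hiso : PIso (gr (Gamma n k)) (sg n k i) e {v | v ∈ w.support} := by
      refine ⟨fun u hu v hv h => ?_, fun u hu v hv => ?_⟩
      · exact Subtype.ext ((he u hu).symm.trans ((congrArg Subtype.val h).trans (he v hv)))
      · rw [gamma_adj, ← he u hu, ← he v hv]
        exact Iff.rfl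
    obtain ⟨w', hw', hl⟩ := exists_cycle_map w hw hiso
    exact (sg_girth hn _ w' hw').trans_eq hl
  · intro x y h
    obtain ⟨i, hi⟩ := exists_stage (F := {x, y}) (toFinite _)
    obtain ⟨l, hl, w, hw⟩ := exists_short_walk hn (x := ⟨x.1, hi x (by simp)⟩)
      (y := ⟨y.1, hi y (by simp)⟩) h
    let φ : sg n k l →g gr (Gamma n k) :=
      ⟨fun z => ⟨z.1, mem_gammaSet.2 ⟨l, z.2⟩⟩, fun {u v} huv => gamma_adj.2 huv⟩
    exact ⟨w.map φ, (Walk.length_map _ _).trans_le hw⟩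
  · exact downSet_empty.strong_gamma hn

/-- The `u`-th vertex of the path `γ_k`. -/
def basePt (n : ℕ) (k : ℕ∞) (u : ℕ) : Gamma n k :=
  open Classical in if h : (u : ℕ∞) ≤ k then ⟨.base u, base_mem_gammaSet.2 h⟩ else
    ⟨.base 0, base_mem_gammaSet.2 (by simp)⟩

lemma basePt_val {u : ℕ} (h : (u : ℕ∞) ≤ k) : (basePt n k u).1 = .base u := by
  exact congrArg Subtype.val (dif_pos h)

lemma downSet_path (l : ℕ) : DownSet (ArcTerm.base '' Iic l : Set (ArcTerm n ℕ)) :=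
  ingredients_downSet (.base l)

lemma basePt_image {l : ℕ} (h : (l : ℕ∞) ≤ k) :
    basePt n k '' Iic l = (fun x => x.1) ⁻¹' (ArcTerm.base '' Iic l : Set (ArcTerm n ℕ)) := by
  ext x
  constructor
  · rintro ⟨u, hu, rfl⟩
    exact ⟨u, hu, (basePt_val (le_trans (by exact_mod_cast hu) h)).symm⟩
  · rintro ⟨u, hu, hx⟩
    exact ⟨u, hu, Subtype.ext ((basePt_val (le_trans (by exact_mod_cast hu) h)).trans hx)⟩

lemma basePt_injOn {l : ℕ} (h : (l : ℕ∞) ≤ k) : InjOn (basePt n k) (Iic l) := by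
  intro u hu v hv he
  have := congrArg Subtype.val he
  rw [basePt_val (le_trans (by exact_mod_cast hu) h),
    basePt_val (le_trans (by exact_mod_cast hv) h)] at this
  injection this

lemma basePt_adj {l : ℕ} (h : (l : ℕ∞) ≤ k) {u v : ℕ} (hu : u ≤ l) (hv : v ≤ l) :
    (gr (Gamma n k)).Adj (basePt n k u) (basePt n k v) ↔ u + 1 = v ∨ v + 1 = u := by
  rw [gamma_adj, basePt_val (le_trans (by exact_mod_cast hu) h),
    basePt_val (le_trans (by exact_mod_cast hv) h), ← Nat.covBy_iff_add_one_eq,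
    ← Nat.covBy_iff_add_one_eq, ← hasse_adj]
  constructor
  · intro ha
    rcases adj_base ha with ⟨w, hw, he⟩ | ⟨c, d, j, he, -⟩
    · injection he with he
      rwa [he]
    · cases he
  · exact fun h => (Joined.base h).adj

/-- The ends of the strong path of length `n + 3` are joined by a clean arc of length `n - 1`;
together they form a cycle of length `2n + 2`. The index along the path is a potential showing the
ends are far enough apart. -/
lemma exists_strongCycle (hn : 3 ≤ n) (hk : ((n + 3 : ℕ) : ℕ∞) ≤ k) :
    ∃ c, StrongCycle n (gr (Gamma n k)) c := by
  have hG := gamma_isGon (k := k) hn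
  have hA : Strong n (gr (Gamma n k)) (basePt n k '' Iic (n + 3)) := by
    rw [basePt_image hk]
    exact (downSet_path _).strong_gamma hn
  have hinj := basePt_injOn (n := n) hk
  have hcol : ∀ u ≤ n + 3, (col (basePt n k u) ↔ Even u) := by
    intro u hu
    rw [gamma_col, basePt_val (le_trans (by exact_mod_cast hu) hk), tcol, colour, decide_eq_true_eq]
  let φ : Gamma n k → ℤ := fun x => match x.1 with
    | .base u => u
    | .arc _ _ _ => 0
  have hφ : ∀ u ≤ n + 3, φ (basePt n k u) = u := by
    intro u hu
    simp only [φ]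
    rw [basePt_val (le_trans (by exact_mod_cast hu) hk)]
  have hpot : Pot (gr (Gamma n k)) (basePt n k '' Iic (n + 3)) φ := by
    rintro _ ⟨u, hu, rfl⟩ _ ⟨v, hv, rfl⟩ ha
    rw [hφ u hu, hφ v hv]
    rw [basePt_adj hk hu hv] at ha
    omega
  obtain ⟨p, p0, p1, hp, hs⟩ := hG.exists_cleanArc hA (a := basePt n k 0) (b := basePt n k (n + 3))
    ⟨0, by simp, rfl⟩ ⟨n + 3, by simp, rfl⟩
    (by
      rw [hcol 0 (by omega), hcol (n + 3) le_rfl, Nat.even_iff, Nat.even_iff, Nat.even_iff]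
      omega)
    (hpot.far (by rw [hφ 0 (by omega), hφ (n + 3) le_rfl]; push_cast; omega))
  let d : ℕ → Gamma n k := fun i => if i ≤ n + 3 then basePt n k i else p (2 * n + 2 - i)
  have d1 : ∀ i ≤ n + 3, d i = basePt n k i := fun i hi => if_pos hi
  have d2 : ∀ i, n + 3 ≤ i → d i = p (2 * n + 2 - i) := by
    intro i hi
    rcases hi.eq_or_lt with rfl | h
    · rw [d1 _ le_rfl, ← p1]
      congr 1
      omega
    · exact if_neg (by omega)
  have hout : ∀ i, n + 3 < i → i < 2 * n + 2 → d i ∉ basePt n k '' Iic (n + 3) := by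
    intro i h1 h2
    rw [d2 i h1.le]
    exact hp.out _ ⟨by omega, by omega⟩
  refine ⟨_, StrongCycle.of_mod (d := d) hn ?_ ?_ ?_ ?_⟩
  · rw [d1 0 (by omega), d2 _ (by omega), Nat.sub_self, p0]
  · intro i hi j hj h
    rw [mem_Iio] at hi hj
    rcases le_or_gt i (n + 3) with hi' | hi' <;> rcases le_or_gt j (n + 3) with hj' | hj'
    · rw [d1 i hi', d1 j hj'] at h
      exact hinj hi' hj' h
    · rw [d1 i hi'] at h
      exact absurd ⟨i, hi', h⟩ (hout j hj' hj)
    · rw [d1 j hj'] at h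
      exact absurd ⟨j, hj', h.symm⟩ (hout i hi' hi)
    · rw [d2 i hi'.le, d2 j hj'.le] at h
      have := hp.inj _ (by omega) _ (by omega) h
      omega
  · intro i hi
    rcases Nat.lt_or_ge i (n + 3) with hi' | hi'
    · rw [d1 i hi'.le, d1 (i + 1) hi', basePt_adj hk hi'.le hi']
      exact Or.inl rfl
    · rw [d2 i hi', d2 (i + 1) (by omega)]
      have := hp.adj (2 * n + 2 - (i + 1)) (by omega)
      rw [show 2 * n + 2 - (i + 1) + 1 = 2 * n + 2 - i by omega] at this
      exact this.symm
  · convert hs using 1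
    ext x
    constructor
    · rintro ⟨i, hi, rfl⟩
      rw [mem_Iio] at hi
      rcases le_or_gt i (n + 3) with hi' | hi'
      · exact Or.inl ⟨i, hi', (d1 i hi').symm⟩
      · exact Or.inr ⟨2 * n + 2 - i, ⟨by omega, by omega⟩, (d2 i hi'.le).symm⟩
    · rintro (⟨i, hi, rfl⟩ | ⟨i, ⟨h1, h2⟩, rfl⟩)
      · rw [mem_Iic] at hi
        exact ⟨i, by rw [mem_Iio]; omega, d1 i hi⟩
      · refine ⟨2 * n + 2 - i, by rw [mem_Iio]; omega, ?_⟩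
        rw [d2 _ (by omega)]
        congr 1
        omega

lemma exists_finite_strong (hn : 3 ≤ n) {A : Set (Gamma n k)} (hA : A.Finite) :
    ∃ H, A ⊆ H ∧ H.Finite ∧ Strong n (gr (Gamma n k)) H := by
  obtain ⟨B, h1, -, h3, h4⟩ := (gammaSet_downSet (n := n) (k := k)).exists_finite
    (hA.image fun x => x.1) (by rintro _ ⟨x, -, rfl⟩; exact x.2)
  exact ⟨_, fun x hx => h1 ⟨x, hx, rfl⟩, h3.preimage fun _ _ _ _ h => Subtype.ext h,
    h4.strong_gamma hn⟩

lemma gamma_rich (hn : 3 ≤ n) (hk : ((n + 3 : ℕ) : ℕ∞) ≤ k) : Rich n (Gamma n k) := by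
  obtain ⟨c, hc⟩ := exists_strongCycle hn hk
  exact hc.rich gamma_isBip (gamma_isGon hn) fun A hA => exists_finite_strong hn hA

lemma elemSub_of_le (hn : 3 ≤ n) (hk : ((n + 3 : ℕ) : ℕ∞) ≤ k) (hkm : k ≤ m) : ElemSub n k m := by
  have hsub : gammaSet n k ⊆ gammaSet n m :=
    gammaSet_mono hn (le_trans (by exact_mod_cast (show 1 ≤ n + 3 by omega)) hk) hkm
  obtain ⟨f, hf⟩ := exists_embedding (gamma_isBip (n := n) (k := k)) (gamma_isBip (n := n) (k := m))
    (fun x => ⟨x.1, hsub x.2⟩) (fun x y h => Subtype.ext (Subtype.mk.inj h))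
    (fun x y => gamma_adj.trans (gamma_adj (x := x) (y := y)).symm) (fun x => Iff.rfl)
  obtain ⟨F, hF⟩ := (gamma_rich hn hk).elementary (gamma_rich hn (hk.trans hkm)) f (by
    have : range f = (fun x : Gamma n m => x.1) ⁻¹' gammaSet n k := by
      ext x
      constructor
      · rintro ⟨y, rfl⟩
        rw [hf]
        exact y.2
      · exact fun hx => ⟨⟨x.1, hx⟩, (hf _).trans (Subtype.ext rfl)⟩
    rw [this]
    exact gammaSet_downSet.strong_gamma hn)
  exact ⟨F, fun x => by rw [hF, hf]⟩

lemma gammaSet_ssubset (hn : 3 ≤ n) (hk : ((n + 3 : ℕ) : ℕ∞) ≤ k) (hkm : k < m) :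
    gammaSet n k ⊂ gammaSet n m := by
  refine ⟨gammaSet_mono hn (le_trans (by exact_mod_cast (show 1 ≤ n + 3 by omega)) hk) hkm.le, ?_⟩
  intro h
  obtain ⟨K, rfl⟩ := ENat.ne_top_iff_exists.1 hkm.ne_top
  have h1 : (ArcTerm.base (K + 1) : ArcTerm n ℕ) ∈ gammaSet n m := by
    rw [base_mem_gammaSet]
    exact Order.add_one_le_of_lt hkm
  have := base_mem_gammaSet.1 (h h1)
  have : K + 1 ≤ K := by exact_mod_cast this
  omega

end GammaStructure

/-! ### Counting vertices against edges. -/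

section Defects

variable {V V' : Type*} {G : SimpleGraph V} {G' : SimpleGraph V'} {n : ℕ}

open Classical in
/-- The number of neighbours of `v` in `S`. -/
noncomputable def nbr (G : SimpleGraph V) (S : Finset V) (v : V) : ℕ := ∑ x ∈ S, if G.Adj v x then 1 else 0

/-- Twice the weighted difference of the numbers of vertices and of edges that is not changed by
clean arcs. -/
noncomputable def defect (n : ℕ) (G : SimpleGraph V) (S : Finset V) : ℤ :=
  2 * (n - 1) * S.card - (n - 2) * ∑ v ∈ S, (nbr G S v : ℤ)

lemma defect_insert [DecidableEq V] {S : Finset V} {v : V} (hv : v ∉ S) :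
    defect n G (insert v S) = defect n G S + 2 * (n - 1) - 2 * (n - 2) * nbr G S v := by
  classical
  have h1 : ∀ w, nbr G (insert v S) w = (if G.Adj w v then 1 else 0) + nbr G S w := fun w => by
    rw [nbr, Finset.sum_insert hv, nbr]
  have h2 : ∑ w ∈ S, (((if G.Adj w v then 1 else 0 : ℕ)) : ℤ) = nbr G S v := by
    rw [nbr]
    push_cast
    exact Finset.sum_congr rfl fun w _ => by simp only [G.adj_comm]
  rw [defect, defect, Finset.sum_insert hv, Finset.card_insert_of_notMem hv]
  simp only [h1, Nat.cast_add, Finset.sum_add_distrib]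
  rw [h2, if_neg (G.loopless.irrefl v)]
  push_cast
  ring

lemma nbr_eq_card [DecidablePred (G.Adj v)] (S : Finset V) :
    nbr G S v = (S.filter (G.Adj v)).card := by
  rw [nbr, Finset.card_filter]
  exact Finset.sum_congr rfl fun x _ => by congr

lemma one_le_nbr {S : Finset V} {v x : V} (hx : x ∈ S) (h : G.Adj v x) : 1 ≤ nbr G S v := by
  classical
  rw [nbr_eq_card]
  exact Finset.card_pos.2 ⟨x, Finset.mem_filter.2 ⟨hx, h⟩⟩

lemma two_le_nbr {S : Finset V} {v x y : V} (hx : x ∈ S) (h : G.Adj v x) (hy : y ∈ S)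
    (h' : G.Adj v y) (hxy : x ≠ y) : 2 ≤ nbr G S v := by
  classical
  rw [nbr_eq_card]
  exact Finset.one_lt_card.2 ⟨x, Finset.mem_filter.2 ⟨hx, h⟩, y, Finset.mem_filter.2 ⟨hy, h'⟩, hxy⟩

lemma Loose.nbr_le {S : Finset V} {v : V} (h : Loose G S v) : nbr G S v ≤ 1 := by
  classical
  rw [nbr_eq_card, Finset.card_le_one]
  intro a ha b hb
  rw [Finset.mem_filter] at ha hb
  exact h a ha.1 b hb.1 ha.2 hb.2

lemma Slim.nbr_le {S : Finset V} {v : V} (h : Slim G S v) : nbr G S v ≤ 2 := by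
  classical
  rw [nbr_eq_card]
  by_contra hlt
  rw [not_le, Finset.two_lt_card] at hlt
  obtain ⟨a, ha, b, hb, c, hc, h1, h2, h3⟩ := hlt
  rw [Finset.mem_filter] at ha hb hc
  rcases h a ha.1 b hb.1 c hc.1 ha.2 hb.2 hc.2 with h | h | h <;> contradiction

lemma Slim.loose {X : Set V} {v y : V} (h : Slim G X v) (hy : y ∈ X) (ha : G.Adj v y) {S : Set V}
    (hS : S ⊆ X) (hyS : y ∉ S) : Loose G S v := by
  intro a ha' b hb' h1 h2
  rcases h a (hS ha') b (hS hb') y hy h1 h2 ha with h | rfl | rfl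
  · exact h
  · exact absurd ha' hyS
  · exact absurd hb' hyS

/-- The set `S` with the first `j` vertices of a path. -/
def addPath [DecidableEq V] (S : Finset V) (p : ℕ → V) (j : ℕ) : Finset V :=
  S ∪ (Finset.Icc 1 j).image p

lemma mem_addPath [DecidableEq V] {S : Finset V} {p : ℕ → V} {j : ℕ} {x : V} :
    x ∈ addPath S p j ↔ x ∈ S ∨ ∃ i, 1 ≤ i ∧ i ≤ j ∧ p i = x := by
  rw [addPath, Finset.mem_union, Finset.mem_image]
  simp only [Finset.mem_Icc, and_assoc]

/-- Vertices are added one at a time, so each edge is counted once, when its second end arrives. For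
`j = n - 2` the change is zero exactly when the new vertices bring `n - 1` edges. -/
lemma defect_addPath [DecidableEq V] {S : Finset V} {p : ℕ → V} {l : ℕ}
    (hS : ∀ i ∈ Icc 1 l, p i ∉ S) (hinj : InjOn p (Icc 1 l)) {j : ℕ} (hj : j ≤ l) :
    defect n G (addPath S p j) = defect n G S + 2 * (n - 1) * j
      - 2 * (n - 2) * ∑ i ∈ Finset.range j, (nbr G (addPath S p i) (p (i + 1)) : ℤ) := by
  induction j with
  | zero => simp [addPath]
  | succ j ih =>
    have h1 : addPath S p (j + 1) = insert (p (j + 1)) (addPath S p j) := by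
      ext x
      rw [Finset.mem_insert, mem_addPath, mem_addPath]
      constructor
      · rintro (h | ⟨i, h1, h2, rfl⟩)
        · exact Or.inr (Or.inl h)
        · rcases h2.eq_or_lt with rfl | h2
          · exact Or.inl rfl
          · exact Or.inr (Or.inr ⟨i, h1, Nat.le_of_lt_succ h2, rfl⟩)
      · rintro (rfl | h | ⟨i, h1, h2, rfl⟩)
        · exact Or.inr ⟨j + 1, by omega, le_rfl, rfl⟩
        · exact Or.inl h
        · exact Or.inr ⟨i, h1, by omega, rfl⟩
    have h2 : p (j + 1) ∉ addPath S p j := by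
      rw [mem_addPath]
      rintro (h | ⟨i, h1, h2, h⟩)
      · exact hS _ ⟨by omega, hj⟩ h
      · have := hinj ⟨h1, by omega⟩ ⟨by omega, hj⟩ h
        omega
    rw [h1, defect_insert h2, ih (by omega), Finset.sum_range_succ]
    push_cast
    ring

lemma defect_addPath_le [DecidableEq V] {S : Finset V} {p : ℕ → V} (hn : 3 ≤ n)
    (hS : ∀ i ∈ Icc 1 (n - 2), p i ∉ S) (hinj : InjOn p (Icc 1 (n - 2)))
    (h1 : ∀ i < n - 3, 1 ≤ nbr G (addPath S p i) (p (i + 1)))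
    (h2 : 2 ≤ nbr G (addPath S p (n - 3)) (p (n - 2))) :
    defect n G (addPath S p (n - 2)) ≤ defect n G S := by
  obtain ⟨q, rfl⟩ := Nat.exists_eq_add_of_le' hn
  rw [defect_addPath hS hinj le_rfl]
  simp only [show q + 3 - 2 = q + 1 by omega, show q + 3 - 3 = q by omega] at h1 h2 ⊢
  rw [Finset.sum_range_succ]
  have h3 : (q : ℤ) ≤ ∑ i ∈ Finset.range q, (nbr G (addPath S p i) (p (i + 1)) : ℤ) := by
    have := Finset.sum_le_sum fun i hi => h1 i (Finset.mem_range.1 hi)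
    simp only [Finset.sum_const, Finset.card_range, smul_eq_mul, mul_one] at this
    exact_mod_cast this
  have h4 : (2 : ℤ) ≤ nbr G (addPath S p q) (p (q + 1)) := by exact_mod_cast h2
  push_cast
  nlinarith

lemma le_defect_addPath [DecidableEq V] {S : Finset V} {p : ℕ → V} (hn : 3 ≤ n)
    (hS : ∀ i ∈ Icc 1 (n - 2), p i ∉ S) (hinj : InjOn p (Icc 1 (n - 2)))
    (h1 : ∀ i < n - 3, nbr G (addPath S p i) (p (i + 1)) ≤ 1)
    (h2 : nbr G (addPath S p (n - 3)) (p (n - 2)) ≤ 2) :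
    defect n G S ≤ defect n G (addPath S p (n - 2)) := by
  obtain ⟨q, rfl⟩ := Nat.exists_eq_add_of_le' hn
  rw [defect_addPath hS hinj le_rfl]
  simp only [show q + 3 - 2 = q + 1 by omega, show q + 3 - 3 = q by omega] at h1 h2 ⊢
  rw [Finset.sum_range_succ]
  have h3 : ∑ i ∈ Finset.range q, (nbr G (addPath S p i) (p (i + 1)) : ℤ) ≤ q := by
    have := Finset.sum_le_sum fun i hi => h1 i (Finset.mem_range.1 hi)
    simp only [Finset.sum_const, Finset.card_range, smul_eq_mul, mul_one] at this
    exact_mod_cast this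
  have h4 : (nbr G (addPath S p q) (p (q + 1)) : ℤ) ≤ 2 := by exact_mod_cast h2
  push_cast
  nlinarith

/-- Peel `S` down to `A`: a loose vertex contributes at least `2(n - 1) - 2(n - 2) = 2`, and a clean
arc brings at most `n - 1` edges, hence contributes nothing negative. -/
lemma Strong.defect_le (hn : 3 ≤ n) {A S : Finset V} (hA : Strong n G A) (h : A ⊆ S) :
    defect n G A ≤ defect n G S := by
  classical
  induction S using Finset.strongInduction with
  | H S ih =>
  by_cases hS : A = S
  · rw [hS]
  have hne : (S \ A).Nonempty := by
    rw [Finset.sdiff_nonempty]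
    exact fun h' => hS (h.antisymm h')
  have hfree := hA (S \ A : Finset V) (Finset.finite_toSet _) hne (by
    rw [Set.disjoint_left]
    intro x hx hx'
    exact (Finset.mem_sdiff.1 hx').2 hx)
  have e : (A : Set V) ∪ (S \ A : Finset V) = S := by
    rw [← Finset.coe_union, Finset.union_sdiff_of_subset h]
  rw [e] at hfree
  rcases hfree with ⟨v, hv, hl⟩ | ⟨p, h1, h2, h3⟩
  · have hv := Finset.mem_sdiff.1 hv
    have h1 := ih (S.erase v) (Finset.erase_ssubset hv.1) (Finset.subset_erase.2 ⟨h, hv.2⟩)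
    have h2 := defect_insert (n := n) (G := G) (Finset.notMem_erase v S)
    rw [Finset.insert_erase hv.1] at h2
    have h3 : (nbr G (S.erase v) v : ℤ) ≤ 1 := by
      exact_mod_cast (hl.mono (by exact_mod_cast Finset.erase_subset v S)).nbr_le
    have hn' : (3 : ℤ) ≤ n := by exact_mod_cast hn
    nlinarith
  · have hp : ∀ i ∈ Icc 1 (n - 2), p i ∈ S ∧ p i ∉ A := fun i hi => Finset.mem_sdiff.1 (h2 i hi).1
    have hsub : (Finset.Icc 1 (n - 2)).image p ⊆ S := by
      intro x hx
      obtain ⟨i, hi, rfl⟩ := Finset.mem_image.1 hx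
      exact (hp i (by simpa using hi)).1
    have hS : addPath (S \ (Finset.Icc 1 (n - 2)).image p) p (n - 2) = S :=
      Finset.sdiff_union_of_subset hsub
    have hout : ∀ i ∈ Icc 1 (n - 2), p i ∉ S \ (Finset.Icc 1 (n - 2)).image p := fun i hi h =>
      (Finset.mem_sdiff.1 h).2 (Finset.mem_image_of_mem p (by simpa using hi))
    have hle : ∀ j ≤ n - 2, addPath (S \ (Finset.Icc 1 (n - 2)).image p) p j ⊆ S := by
      intro j hj x hx
      rw [← hS, mem_addPath]
      exact (mem_addPath.1 hx).imp_right fun ⟨i, h1, h2, h⟩ => ⟨i, h1, by omega, h⟩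
    refine (ih _ (Finset.sdiff_ssubset hsub ?_) ?_).trans
      ((le_defect_addPath hn hout h1 ?_ ?_).trans_eq (by rw [hS]))
    · exact ⟨p 1, Finset.mem_image_of_mem p (by simp; omega)⟩
    · intro x hx
      refine Finset.mem_sdiff.2 ⟨h hx, fun hx' => ?_⟩
      obtain ⟨i, hi, rfl⟩ := Finset.mem_image.1 hx'
      exact (hp i (by simpa using hi)).2 hx
    · intro i hi
      -- The successor on the arc is a neighbour still missing when this vertex is added, so at most
      -- one of its two neighbours is present.
      refine ((h2 (i + 1) ⟨by omega, by omega⟩).2.loose (y := p (i + 2))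
        (hp _ ⟨by omega, by omega⟩).1 (h3 (i + 1) (by omega) (by omega)) (S := addPath _ p i)
        (by exact_mod_cast hle i (by omega)) ?_).nbr_le
      intro h
      rcases mem_addPath.1 h with h | ⟨j, j1, j2, h⟩
      · exact hout _ ⟨by omega, by omega⟩ h
      · have := h1 ⟨j1, by omega⟩ ⟨by omega, by omega⟩ h
        omega
    · exact ((h2 (n - 2) ⟨by omega, le_rfl⟩).2.mono
        (by exact_mod_cast hle (n - 3) (by omega))).nbr_le

/-- The defect of a path of length `l`. -/
lemma defect_path [DecidableEq V] {p : ℕ → V} {l : ℕ} (hinj : InjOn p (Iic l))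
    (hadj : ∀ u ≤ l, ∀ v ≤ l, (G.Adj (p u) (p v) ↔ u + 1 = v ∨ v + 1 = u)) :
    defect n G ((Finset.range (l + 1)).image p) = 2 * (n - 1) + 2 * l := by
  induction l with
  | zero =>
    rw [zero_add, Finset.range_one, Finset.image_singleton, defect]
    simp [nbr]
  | succ l ih =>
    have hout : p (l + 1) ∉ (Finset.range (l + 1)).image p := by
      intro h
      obtain ⟨i, hi, h⟩ := Finset.mem_image.1 h
      rw [Finset.mem_range] at hi
      have := hinj (show i ≤ l + 1 by omega) (show l + 1 ≤ l + 1 from le_rfl) h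
      omega
    have hnbr : nbr G ((Finset.range (l + 1)).image p) (p (l + 1)) = 1 := by
      apply le_antisymm
      · refine Loose.nbr_le ?_
        have key : ∀ x ∈ (Finset.range (l + 1)).image p, G.Adj (p (l + 1)) x → x = p l := by
          intro x hx ha
          obtain ⟨i, hi, rfl⟩ := Finset.mem_image.1 hx
          rw [Finset.mem_range] at hi
          rw [hadj _ le_rfl _ (by omega)] at ha
          congr 1
          omega
        exact fun x hx y hy ax ay => (key x hx ax).trans (key y hy ay).symm
      · exact one_le_nbr (Finset.mem_image_of_mem p (Finset.self_mem_range_succ l))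
          ((hadj _ le_rfl _ (by omega)).2 (Or.inr rfl))
    rw [Finset.range_add_one, Finset.image_insert, defect_insert hout, hnbr,
      ih (hinj.mono (Iic_subset_Iic.2 (by omega))) fun u hu v hv => hadj u (by omega) v (by omega)]
    push_cast
    ring

lemma Strong.image (hn : 3 ≤ n) {h : V → V'} (H : PIso G G' h univ) {A : Set V}
    (hr : Strong n G' (range h)) (hA : Strong n G A) : Strong n G' (h '' A) := by
  refine hr.of_subset (image_subset_range _ _) fun C hC hne hdis hsub => ?_
  obtain ⟨C, rfl⟩ : ∃ C', C = h '' C' := ⟨_, (image_preimage_eq_of_subset hsub).symm⟩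
  rw [← image_union, (H.mono (subset_univ _)).free_image hn subset_union_right]
  refine hA C (hC.of_finite_image (H.inj.mono (subset_univ _))) hne.of_image ?_
  rw [Set.disjoint_left] at hdis ⊢
  exact fun x hx hx' => hdis ⟨x, hx, rfl⟩ ⟨x, hx', rfl⟩

end Defects

/-! ### No elementary embedding from a longer path to a shorter one. -/

section Chain

variable {n : ℕ} {k m : ℕ∞}

lemma arc_mem_gammaSet {a b : ArcTerm n ℕ} {j : Fin (n - 2)}
    (h : ArcTerm.arc a b j ∈ gammaSet n k) : a ≠ b := by
  obtain ⟨i, hi⟩ := mem_gammaSet.1 h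
  clear h
  induction i with
  | zero =>
    obtain ⟨u, -, hu⟩ := mem_st_zero.1 hi
    cases hu
  | succ i ih =>
    rcases mem_st_succ.1 hi with h | ⟨a', b', j', h, hr, -⟩
    · exact ih h
    · injection h with h1 h2
      subst h1 h2
      rintro rfl
      exact irrefl_of WellOrderingRel _ hr

open Classical in
/-- Original vertices generate a downset by clean arcs. -/
lemma DownSet.defect_le (hn : 3 ≤ n) {H : Finset (ArcTerm n ℕ)} (hH : DownSet (H : Set (ArcTerm n ℕ)))
    (hne : ∀ a b j, ArcTerm.arc a b j ∈ H → a ≠ b) :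
    defect n (tg n) H ≤ defect n (tg n) (H.filter fun x => ∃ u, x = .base u) := by
  induction H using Finset.strongInduction with
  | H H ih =>
  by_cases hbase : ∀ x ∈ H, ∃ u, x = .base u
  · rw [Finset.filter_true_of_mem hbase]
  push Not at hbase
  obtain ⟨y, hy, hyb⟩ := hbase
  -- Induction removes a whole arc of greatest rank, on which no other name depends. When it is put
  -- back, its vertices bring at least `n - 1` edges.
  obtain ⟨x, hx, hmax⟩ := Finset.exists_max_image H rank ⟨y, hy⟩
  cases x with
  | base u =>
    exfalso
    cases y with
    | base v => exact hyb v rfl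
    | arc a b j =>
      have := hmax _ hy
      simp only [rank] at this
      omega
  | arc a b j =>
    set P := (Finset.Icc 1 (n - 2)).image (arcPt a b) with hP
    have hPmem : ∀ z, z ∈ P ↔ ∃ l, z = .arc a b l := by
      intro z
      rw [hP, Finset.mem_image]
      constructor
      · rintro ⟨i, hi, rfl⟩
        rw [Finset.mem_Icc] at hi
        exact ⟨_, arcPt_of_mem hi.1 hi.2⟩
      · rintro ⟨l, rfl⟩
        have := l.2
        exact ⟨l.1 + 1, by rw [Finset.mem_Icc]; omega, arcPt_succ a b l⟩
    have hPH : P ⊆ H := by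
      intro z hz
      obtain ⟨l, rfl⟩ := (hPmem z).1 hz
      exact hH.all _ _ _ _ hx
    have hrank : ∀ z ∈ P, ∀ c d l, ArcTerm.arc c d l ∈ H → z ≠ c ∧ z ≠ d := by
      intro z hz c d l h
      obtain ⟨l', rfl⟩ := (hPmem z).1 hz
      have := hmax _ h
      simp only [rank] at this
      constructor <;>
      · rintro rfl
        simp only [rank] at this
        omega
    have hdown : DownSet ((H \ P : Finset _) : Set (ArcTerm n ℕ)) := by
      simp only [Finset.coe_sdiff]
      refine ⟨⟨?_, ?_, ?_⟩, ?_⟩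
      · rintro c d l ⟨h1, h2⟩
        exact ⟨hH.left _ _ _ h1, fun h => (hrank _ h c d l h1).1 rfl⟩
      · rintro c d l ⟨h1, h2⟩
        exact ⟨hH.right _ _ _ h1, fun h => (hrank _ h c d l h1).2 rfl⟩
      · rintro c d l l' ⟨h1, h2⟩
        refine ⟨hH.all _ _ _ _ h1, fun h => h2 ?_⟩
        obtain ⟨l₂, h⟩ := (hPmem _).1 h
        injection h with e1 e2
        exact (hPmem _).2 ⟨l, by rw [e1, e2]⟩
      · rintro u ⟨h1, h2⟩
        refine ⟨hH.base _ h1, fun h => ?_⟩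
        obtain ⟨l, h⟩ := (hPmem _).1 h
        cases h
    have hadd : addPath (H \ P) (arcPt a b) (n - 2) = H := Finset.sdiff_union_of_subset hPH
    have ha : a ∈ H \ P := Finset.mem_sdiff.2 ⟨hH.left _ _ _ hx, fun h => (hrank _ h a b j hx).1 rfl⟩
    have hb : b ∈ H \ P := Finset.mem_sdiff.2 ⟨hH.right _ _ _ hx, fun h => (hrank _ h a b j hx).2 rfl⟩
    have hmem : ∀ i ≤ n - 2, arcPt a b i ∈ addPath (H \ P) (arcPt a b) i := by
      intro i hi
      rcases Nat.eq_zero_or_pos i with rfl | h0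
      · rw [mem_addPath, arcPt_zero]
        exact Or.inl ha
      · exact mem_addPath.2 (Or.inr ⟨i, h0, le_rfl, rfl⟩)
    have hadj := fun i hi => (arcPt_adj (H := hasse ℕ) hn a b (m := i) hi).symm
    have hlt : H \ P ⊂ H := Finset.sdiff_ssubset hPH ⟨_, (hPmem _).2 ⟨j, rfl⟩⟩
    refine (le_of_eq (by rw [hadd])).trans ((defect_addPath_le (S := H \ P) (p := arcPt a b) hn
      ?_ ?_ ?_ ?_).trans ((ih _ hlt hdown fun c d l h => hne c d l (Finset.sdiff_subset h)).trans_eq ?_))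
    · intro i hi h
      exact (Finset.mem_sdiff.1 h).2 ((hPmem _).2 ⟨_, arcPt_of_mem hi.1 hi.2⟩)
    · intro i hi i' hi' h
      rw [arcPt_of_mem hi.1 hi.2, arcPt_of_mem hi'.1 hi'.2] at h
      injection h with _ _ h
      have := congrArg Fin.val h
      have := hi.1
      have := hi'.1
      simp only at *
      omega
    · exact fun i hi => one_le_nbr (hmem i (by omega)) (hadj i (by omega))
    · have h1 := hadj (n - 3) (by omega)
      have h2 := (hadj (n - 2) (by omega)).symm
      rw [show n - 3 + 1 = n - 2 by omega] at h1
      rw [show n - 2 + 1 = n - 1 by omega, arcPt_last hn] at h2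
      refine two_le_nbr (hmem (n - 3) (by omega)) h1 (mem_addPath.2 (Or.inl hb)) h2 ?_
      intro he
      -- For `n = 3` the two neighbours of the only interior vertex are the ends, and they are
      -- distinct only because `a ≠ b`.
      rcases Nat.eq_zero_or_pos (n - 3) with h0 | h0
      · rw [h0, arcPt_zero] at he
        exact hne a b j hx he
      · exact (Finset.mem_sdiff.1 hb).2 ((hPmem _).2 ⟨_, he.symm.trans (arcPt_of_mem h0 (by omega))⟩)
    · congr 1
      ext z
      rw [Finset.mem_filter, Finset.mem_filter, Finset.mem_sdiff]
      constructor
      · exact fun h => ⟨h.1.1, h.2⟩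
      · rintro ⟨h1, u, rfl⟩
        refine ⟨⟨h1, fun h => ?_⟩, u, rfl⟩
        obtain ⟨l, h⟩ := (hPmem _).1 h
        cases h

/-- For `k > m` the path of length `m + 1` in `Γ^k` would have an image that is strong in `Γ^m`,
hence in the graph of all names. A finite set of names containing it, generated from `γ_m`, has
defect at most that of a path of length `m`, contradicting `Strong.defect_le`. -/
lemma le_of_elementary (hn : 3 ≤ n) (f : Gamma n k ↪ₑ[bipLang] Gamma n m) : k ≤ m := by
  classical
  by_contra hlt
  rw [not_le] at hlt
  obtain ⟨M, rfl⟩ := ENat.ne_top_iff_exists.1 hlt.ne_top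
  have hM : ((M + 1 : ℕ) : ℕ∞) ≤ k := by exact_mod_cast Order.add_one_le_of_lt hlt
  have : Nonempty (Gamma n k) := ⟨basePt n k 0⟩
  have hf := (gamma_isGon hn).strong_range f
  have hA : Strong n (gr (Gamma n k)) (basePt n k '' Iic (M + 1)) := by
    rw [basePt_image hM]
    exact (downSet_path _).strong_gamma hn
  have hfiso := map_pIso f.toEmbedding univ
  let p : ℕ → ArcTerm n ℕ := fun u => (f (basePt n k u)).1
  have hr : range (fun x : Gamma n M => x.1) = gammaSet n M := Subtype.range_coe
  have hp : Strong n (tg n) (p '' Iic (M + 1)) := by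
    have hs : Strong n (tg n) (range (fun x : Gamma n M => x.1)) := by
      rw [hr]
      exact gammaSet_downSet.strong hn
    have h1 := Strong.image hn gamma_pIso hs (Strong.image hn hfiso hf hA)
    rw [image_image, image_image] at h1
    exact h1
  have hpinj : InjOn p (Iic (M + 1)) := fun u hu v hv h =>
    basePt_injOn hM hu hv (f.injective (Subtype.ext h))
  have hpadj : ∀ u ≤ M + 1, ∀ v ≤ M + 1, ((tg n).Adj (p u) (p v) ↔ u + 1 = v ∨ v + 1 = u) := by
    intro u hu v hv
    rw [← basePt_adj hM hu hv, ← map_adj f.toEmbedding, gamma_adj]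
    exact Iff.rfl
  -- Including `γ_m` itself makes the original vertices of `B` exactly those of a path of length
  -- `M`.
  obtain ⟨B, h1, h2, h3, h4⟩ := (gammaSet_downSet (n := n) (k := M)).exists_finite
    (F := p '' Iic (M + 1) ∪ ArcTerm.base '' Iic M)
    (((finite_Iic _).image _).union ((finite_Iic _).image _)) (by
      rintro x (⟨u, -, rfl⟩ | ⟨u, hu, rfl⟩)
      · exact (f _).2
      · exact base_mem_gammaSet.2 (by exact_mod_cast hu))
  lift B to Finset (ArcTerm n ℕ) using h3
  have e1 : (B.filter fun x => ∃ u, x = .base u) = (Finset.range (M + 1)).image .base := by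
    ext x
    rw [Finset.mem_filter, Finset.mem_image]
    constructor
    · rintro ⟨hx, u, rfl⟩
      have := base_mem_gammaSet.1 (h2 hx)
      have : u ≤ M := by exact_mod_cast this
      exact ⟨u, Finset.mem_range.2 (by omega), rfl⟩
    · rintro ⟨u, hu, rfl⟩
      rw [Finset.mem_range] at hu
      exact ⟨h1 (Or.inr ⟨u, Nat.le_of_lt_succ hu, rfl⟩), u, rfl⟩
  have l1 := h4.defect_le hn fun a b j h => arc_mem_gammaSet (h2 h)
  rw [e1, defect_path (G := tg n) (fun u _ v _ h => by injection h) (by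
    intro u hu v hv
    rw [← basePt_adj (n := n) (k := M) le_rfl hu hv, gamma_adj,
      basePt_val (by exact_mod_cast hu), basePt_val (by exact_mod_cast hv)])] at l1
  have e2 : ((Finset.range (M + 1 + 1)).image p : Set (ArcTerm n ℕ)) = p '' Iic (M + 1) := by
    rw [Finset.coe_image, Finset.coe_range]
    congr 1
    ext u
    rw [mem_Iio, mem_Iic]
    omega
  rw [← e2] at hp h1
  have l2 := hp.defect_le hn (S := B) (by
    have := (subset_union_left).trans h1
    exact_mod_cast this)
  rw [defect_path hpinj hpadj] at l2
  have := l2.trans l1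
  push_cast at this
  omega

end Chain

end FreePolygon

theorem mainTheorem5 (n : ℕ) (hn : 3 ≤ n) :
    (∀ k m : ℕ∞, ((n + 3 : ℕ) : ℕ∞) ≤ k → ((n + 3 : ℕ) : ℕ∞) ≤ m →
      (FreePolygon.ElemSub n k m ↔ k ≤ m) ∧
      (Nonempty (FirstOrder.Language.ElementaryEmbedding FreePolygon.bipLang
        (FreePolygon.Gamma n k) (FreePolygon.Gamma n m)) ↔ k ≤ m)) ∧
    (∀ k m : ℕ∞, ((n + 3 : ℕ) : ℕ∞) ≤ k → k < m →
      FreePolygon.ElemSub n k m ∧ FreePolygon.gammaSet n k ⊂ FreePolygon.gammaSet n m) := by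
  refine ⟨fun k m hk _ => ⟨⟨fun ⟨f, _⟩ => FreePolygon.le_of_elementary hn f,
    FreePolygon.elemSub_of_le hn hk⟩, fun ⟨f⟩ => FreePolygon.le_of_elementary hn f, fun h => ?_⟩,
    fun k m hk h => ⟨FreePolygon.elemSub_of_le hn hk h.le, FreePolygon.gammaSet_ssubset hn hk h⟩⟩
  obtain ⟨f, _⟩ := FreePolygon.elemSub_of_le hn hk h
  exact ⟨f⟩
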